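/- **Setting.** Let $\{\zeta(j)\}_{j\in\mathbb Z}$ be i.i.d. random variables with mean zero and unit variance, let $d>0$, and let $(b_d(k))_{k\ge0}$ be real numbers with $b_d(k)\sim \frac{c_d}{\Gamma(d)}k^{d-1}$ as $k\to\infty$ for some $c_d\neq0$. Let $\lambda_N>0$ with $\lambda_N\to0$, and let $X_{d,\lambda_N}(j)=\sum_{k=0}^\infty e^{-\lambda_N k}b_d(k)\zeta(j-k)$, $j\in\mathbb Z$. Let $1\le q<p$ and $$\mu(s;\theta)=\sum_{i=1}^{q}a_i s^{i-1}+\sum_{i=q+1}^{p}a_i (s-\eta)_+^{\,i-q},\qquad x_+=\max(x,0),\qquad \theta=(a_1,\dots,a_p,\eta)\in\Theta=\mathbb R^p\times(0,1).$$ Fix the true parameter $\theta=(a_1,\dots,a_p,\eta)\in\Theta$ with $a_{q+1}\neq0$, and observe $Y(j)=\mu(j/N;\theta)+X_{d,\lambda_N}(j)$, $j=1,\dots,N$. Let $\hat\theta=\hat\theta_N$ be a least squares estimator, that is, a random vector such that, almost surely, whenever $\tau\mapsto\sum_{j=1}^N\big(Y(j)-\mu(j/N;\tau)\big)^2$ has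 a minimizer over $\Theta$, $\hat\theta_N$ is one. Let $\mathbf e_N=(X_{d,\lambda_N}(1),\dots,X_{d,\lambda_N}(N))^T$ and let $\mathbf M_{N+}=[\mu_{(i+)}(t/N)]_{t=1,\dots,N;\,i=1,\dots,p+1}$, where $\mu_{(i+)}(s)$ is the right partial derivative of $\mu(s;\theta)$ with respect to the $i$-th coordinate of $\theta$, at the true $\theta$. Let $\|\cdot\|$ be the Euclidean norm. **Theorem 4.1.** For every $\Delta>0$: (a) If $N\lambda_N\to\infty$, $0<d<1$ and $\lambda_N=o\big(N^{-1/(2-2d)}\big)$, then, as $N\to\infty$, $$\mathbb P\Big(\lambda_N^d\sqrt N\,\big\|\hat\theta_N-\theta-(\mathbf M_{N+}^T\mathbf M_{N+})^{-1}\mathbf M_{N+}^T\mathbf e_N\big\|>\Delta\Big)\to0 .$$ (b) If $N\lambda_N\to\lambda_*\in[0,\infty)$ and $0<d<\tfrac12$, then, as $N\to\infty$, $$\mathbb P\Big(N^{1/2-d}\,\big\|\hat\theta_N-\theta-(\mathbf M_{N+}^T\mathbf M_{N+})^{-1}\mathbf M_{N+}^T\mathbf e_N\big\|>\Delta\Big)\to0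 .$$ -/

import Mathlib

open Filter Topology MeasureTheory ProbabilityTheory Asymptotics Matrix

noncomputable section

namespace SplineRegression

/-- The innovations `ζ(j)`, `j ∈ ℤ`: independent, identically distributed, with mean zero and
unit variance. -/
structure IsIIDInnovation {Ω : Type*} [MeasurableSpace Ω] (P : Measure Ω)
    (ζ : ℤ → Ω → ℝ) : Prop where
  measurable : ∀ j, Measurable (ζ j)
  indep : iIndepFun ζ P
  identDistrib : ∀ i j, IdentDistrib (ζ i) (ζ j) P P
  memLp : ∀ j, MemLp (ζ j) 2 P
  mean : ∀ j, ∫ ω, ζ j ω ∂P = 0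
  variance : ∀ j, ProbabilityTheory.variance (ζ j) P = 1

/-- The coefficients `b_d(k)` are asymptotically equivalent to `(c / Γ(d)) k ^ (d - 1)`
as `k → ∞`, for some constant `c ≠ 0`. -/
def IsTemperedCoeff (d : ℝ) (b : ℕ → ℝ) : Prop :=
  ∃ c : ℝ, c ≠ 0 ∧
    b ~[atTop] fun k : ℕ => c / Real.Gamma d * (k : ℝ) ^ (d - 1)

/-- The tempered linear process `X(j) = ∑_{k ≥ 0} e^{-lam k} b(k) ζ(j - k)`, `j ∈ ℤ`. When
`lam > 0`, `b` grows at most polynomially and the `ζ(j)` are identically distributed and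
integrable, the series converges absolutely with probability one. -/
def temperedProcess {Ω : Type*} (b : ℕ → ℝ) (ζ : ℤ → Ω → ℝ) (lam : ℝ) (j : ℤ) (ω : Ω) : ℝ :=
  ∑' k : ℕ, Real.exp (-lam * k) * b k * ζ (j - k) ω

/-- The truncated power spline basis `f₁, …, f_p` with knot `η`: the powers
`1, s, …, s ^ (q - 1)` followed by `(s - η)₊, …, (s - η)₊ ^ (p - q)`.
The index `i : Fin p` counts from `0`. -/
def splineBasis {p : ℕ} (q : ℕ) (η : ℝ) (i : Fin p) (s : ℝ) : ℝ :=
  if (i : ℕ) < q then s ^ (i : ℕ) else (max (s - η) 0) ^ ((i : ℕ) - q + 1)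

/-- Parameter vectors `θ = (a₁, …, a_p, η)`, with the Euclidean norm. -/
abbrev Param (p : ℕ) := EuclideanSpace ℝ (Fin (p + 1))

/-- The parameter space `Θ = ℝ ^ p × (0, 1)`. -/
def paramSpace (p : ℕ) : Set (Param p) :=
  {τ | τ (Fin.last p) ∈ Set.Ioo (0 : ℝ) 1}

/-- The regression function `μ(s; θ) = ∑ᵢ aᵢ fᵢ(s)`. -/
def splineMean {p : ℕ} (q : ℕ) (τ : Param p) (s : ℝ) : ℝ :=
  ∑ i : Fin p, τ i.castSucc * splineBasis q (τ (Fin.last p)) i s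

/-- The right partial derivative of `μ(s; θ)` with respect to the `i`-th coordinate of `θ`. -/
def rightPartial {p : ℕ} (q : ℕ) (τ : Param p) (i : Fin (p + 1)) (s : ℝ) : ℝ :=
  derivWithin (fun x : ℝ => splineMean q (WithLp.toLp 2 (Function.update (⇑τ) i x)) s)
    (Set.Ioi (τ i)) (τ i)

/-- The design points `1/N, 2/N, …, 1`, indexed by `Fin N`. -/
def designPoint (N : ℕ) (t : Fin N) : ℝ := (((t : ℕ) + 1 : ℕ) : ℝ) / (N : ℝ)

/-- The `N × (p + 1)` matrix of right partial derivatives of `μ` at the design points. -/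
def gradMatrix {p : ℕ} (q : ℕ) (τ : Param p) (N : ℕ) : Matrix (Fin N) (Fin (p + 1)) ℝ :=
  Matrix.of fun t i => rightPartial q τ i (designPoint N t)

/-- The error vector `e_N = (X(1), …, X(N))ᵀ` for the tempering parameter `lam`. -/
def errorVec {Ω : Type*} (b : ℕ → ℝ) (ζ : ℤ → Ω → ℝ) (lam : ℝ) (N : ℕ) (ω : Ω) :
    Fin N → ℝ :=
  fun t => temperedProcess b ζ lam (((t : ℕ) + 1 : ℕ) : ℤ) ω

/-- The observations `Y(j) = μ(j / N; θ) + X(j)`, `j = 1, …, N`. -/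
def observation {Ω : Type*} {p : ℕ} (q : ℕ) (θ : Param p) (b : ℕ → ℝ) (ζ : ℤ → Ω → ℝ)
    (lam : ℝ) (N : ℕ) (ω : Ω) : Fin N → ℝ :=
  fun t => splineMean q θ (designPoint N t) + errorVec b ζ lam N ω t

/-- The least squares criterion `∑ⱼ (Y(j) - μ(j / N; τ))²`. -/
def lsCriterion {p : ℕ} (q : ℕ) {N : ℕ} (Y : Fin N → ℝ) (τ : Param p) : ℝ :=
  ∑ t : Fin N, (Y t - splineMean q τ (designPoint N t)) ^ 2

/-- `τ` is a least squares estimate for the data `Y`: a minimizer of the criterion over `Θ`. -/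
def IsLeastSquares {p : ℕ} (q : ℕ) {N : ℕ} (Y : Fin N → ℝ) (τ : Param p) : Prop :=
  τ ∈ paramSpace p ∧ ∀ τ' ∈ paramSpace p, lsCriterion q Y τ ≤ lsCriterion q Y τ'

/-- The linearized term `(Mᵀ M)⁻¹ Mᵀ e_N`, where `M` is the matrix of right partial derivatives
at the parameter `θ`. -/
def linearTerm {p : ℕ} (q : ℕ) (θ : Param p) {N : ℕ} (e : Fin N → ℝ) : Param p :=
  WithLp.toLp 2
    ((((gradMatrix q θ N)ᵀ * gradMatrix q θ N)⁻¹ * (gradMatrix q θ N)ᵀ) *ᵥ e)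

end SplineRegression

end

open SplineRegression

/-!
The proof separates a deterministic statement about least squares with one free knot from moment
bounds for the noise.

*Deterministic part.* Let `e` be the noise vector and `D(τ)` the vector of values of `μ(·; τ) - μ(·;
θ)` at the design points. A parameter `τ` fits at least as well as `θ` exactly when `‖D(τ)‖² ≤ 2 ⟪e,
D(τ)⟫`. The difference `D(τ)` is a polynomial, plus a polynomial on the design points above the true
knot `η`, plus a polynomial supported on the window between `η` and the knot of `τ`. Three bounds on
`e` control the three kinds of inner product: `OneKnotBound` for polynomials with a break at `η`,
`WindowBound` for polynomials on a window ending at `η`, by a small multiple of the number of design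
points in the window plus `N / r`, and `TwoKnotBound` for piecewise polynomials with an arbitrary
second break. The last one gives consistency, since `D` identifies `θ`
(`exists_norm_sub_le_of_norm_meanShift_le`). The first two give the rate `1 / r`
(`rate_of_quadratic_bound`) and, by comparing the criterion at `τ` with its value at `θ + (Mᵀ M)⁻¹
Mᵀ e`, the linearization (`norm_sub_sq_le_of_fit_of_small`, `leastSquares_linearization`). Although
`μ` is not differentiable in the knot, `D(τ)` differs from `M (τ - θ)` by a quadratic remainder and
a term supported on the window, whose squared norm is of order `N ‖τ - θ‖³`. The linear lower bounds
`‖D(τ)‖ ≥ c √N ‖τ - θ‖` near `θ`, and the identification of `θ` by `D`, come from the uniform grid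
bound `exists_grid_lower_bound`.

*Probabilistic part.* The three bounds hold with high probability for any array of square integrable
vectors whose linear functionals satisfy `E ⟪g, e⟫² ≤ C (N / r²) ‖g‖²` and whose squares are
uniformly integrable (`IsRegularNoise`). `OneKnotBound` is Chebyshev's inequality in a space of
bounded dimension. For `WindowBound` the window is split along a grid of quadratically growing
points, for which the suitably weighted variances have a finite sum that tends to zero.
`TwoKnotBound` uses a finite grid of knots and, in the leftover block, truncation of the noise.

*The noise.* The innovations are orthonormal in `L²`, and the errors are a filter applied to them.
Minkowski's inequality bounds the linear functionals by the `ℓ¹` norm of one part of the filter plus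
`√N` times the `ℓ²` norm of the rest (`norm_sum_filter_le`). With coefficients of order `e^{-λk}
k^{d-1}`, everything in `ℓ¹` gives `λ^{-d}`, and a split at `k = N` gives `N^d`. These are the two
rates of the theorem. The hypotheses of strong tempering force `d < 1/2` (`lt_half_of_isLittleO`),
so the untempered filter is square summable, which makes the squares of the errors uniformly
integrable in `N`.
-/

namespace SplineRegression

open scoped RealInnerProductSpace Polynomial

/-! ### Design points in an interval -/

lemma designPoint_pos {N : ℕ} (t : Fin N) : 0 < designPoint N t := by
  have h : 0 < N := t.pos
  unfold designPoint
  positivity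

lemma designPoint_le_one {N : ℕ} (t : Fin N) : designPoint N t ≤ 1 := by
  have h : 0 < N := t.pos
  unfold designPoint
  rw [div_le_one (by exact_mod_cast h)]
  exact_mod_cast t.isLt

/-- A nondegenerate subinterval of `[0, 1]` contains a positive proportion of the design points. -/
lemma card_designPoint_mem_Ioo_ge {a b : ℝ} (ha : 0 ≤ a) (hab : a < b) (hb : b ≤ 1) {N : ℕ}
    (hN : 4 / (b - a) ≤ N) :
    (b - a) / 4 * N ≤
      ((Finset.univ.filter fun t : Fin N => designPoint N t ∈ Set.Ioo a b).card : ℝ) := by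
  have hba : 0 < b - a := sub_pos.2 hab
  have hNpos : (0 : ℝ) < N := lt_of_lt_of_le (by positivity) hN
  rw [div_le_iff₀ hba] at hN
  -- The `n` indices from `⌊N a⌋` on give points of `(a, b)`: half of the expected number is
  -- counted, which leaves room for rounding at the ends.
  set n : ℕ := ⌊(N : ℝ) * (b - a) / 2⌋₊ with hn
  have hn1 : (n : ℝ) ≤ N * (b - a) / 2 := Nat.floor_le (by positivity)
  have hn2 : (N : ℝ) * (b - a) / 2 < n + 1 := Nat.lt_floor_add_one _
  have hm1 : ((⌊(N : ℝ) * a⌋₊ : ℕ) : ℝ) ≤ N * a := Nat.floor_le (by positivity)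
  have hm2 : (N : ℝ) * a < (⌊(N : ℝ) * a⌋₊ : ℕ) + 1 := Nat.lt_floor_add_one _
  have hNb : (N : ℝ) * b ≤ N := by nlinarith
  have key : ∀ j : Fin n, ((⌊(N : ℝ) * a⌋₊ + j : ℕ) : ℝ) + 1 < N * b := by
    intro j
    have : ((j : ℕ) : ℝ) + 1 ≤ n := by exact_mod_cast j.isLt
    push_cast
    nlinarith
  have hlt : ∀ j : Fin n, ⌊(N : ℝ) * a⌋₊ + (j : ℕ) < N := by
    intro j
    have := key j
    exact_mod_cast (show ((⌊(N : ℝ) * a⌋₊ + j : ℕ) : ℝ) < N by linarith)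
  have hcard : n ≤ (Finset.univ.filter fun t : Fin N => designPoint N t ∈ Set.Ioo a b).card := by
    have := Finset.card_le_card_of_injOn (s := (Finset.univ : Finset (Fin n)))
      (t := Finset.univ.filter fun t : Fin N => designPoint N t ∈ Set.Ioo a b)
      (fun j => ⟨⌊(N : ℝ) * a⌋₊ + j, hlt j⟩) ?_ ?_
    · simpa using this
    · intro j _
      simp only [Finset.coe_filter, Finset.mem_univ, true_and, Set.mem_ofPred_eq, Set.mem_Ioo,
        designPoint]
      have := key j
      rw [lt_div_iff₀ hNpos, div_lt_iff₀ hNpos]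
      push_cast at this ⊢
      have : (0 : ℝ) ≤ (j : ℕ) := Nat.cast_nonneg _
      constructor <;> nlinarith
    · intro i _ j _ hij
      simpa [Fin.ext_iff] using hij
  have : (n : ℝ) ≤ ((Finset.univ.filter fun t : Fin N => designPoint N t ∈ Set.Ioo a b).card : ℝ) :=
    by exact_mod_cast hcard
  nlinarith

/-- The index `t` stands for the point `(t + 1) / N`, so the points above `x` are those with index
at least `⌊N x⌋`. -/
lemma lt_designPoint_iff {N : ℕ} (t : Fin N) {x : ℝ} (hx : 0 ≤ x) :
    x < designPoint N t ↔ ⌊(N : ℝ) * x⌋₊ ≤ (t : ℕ) := by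
  have h : (0 : ℝ) < N := by exact_mod_cast t.pos
  rw [designPoint, lt_div_iff₀ h, mul_comm, ← Nat.floor_lt (by positivity), Nat.lt_succ_iff]

/-! ### Uniform lower bounds for discrete square norms -/

/-- If every member of a compact family of functions is nonzero at some point of `(0, 1)`
where the family is jointly continuous, then the sums of squares over the design points
grow linearly in `N`, uniformly over the family. -/
theorem exists_grid_lower_bound {X : Type*} [TopologicalSpace X] {S : Set X} (hS : IsCompact S)
    (F : X → ℝ → ℝ)
    (hF : ∀ x ∈ S, ∃ s ∈ Set.Ioo (0 : ℝ) 1, F x s ≠ 0 ∧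
      ContinuousAt (fun y : X × ℝ => F y.1 y.2) (x, s)) :
    ∃ c : ℝ, 0 < c ∧ ∃ N₀ : ℕ, ∀ N : ℕ, N₀ ≤ N → ∀ x ∈ S,
      c * N ≤ ∑ t : Fin N, (F x (designPoint N t)) ^ 2 := by
  refine IsCompact.induction_on hS (p := fun S => ∃ c : ℝ, 0 < c ∧ ∃ N₀ : ℕ, ∀ N : ℕ, N₀ ≤ N →
    ∀ x ∈ S, c * N ≤ ∑ t : Fin N, (F x (designPoint N t)) ^ 2) ?_ ?_ ?_ ?_
  · exact ⟨1, one_pos, 0, by simp⟩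
  · rintro s t hst ⟨c, hc, N₀, h⟩
    exact ⟨c, hc, N₀, fun N hN x hx => h N hN x (hst hx)⟩
  · rintro s t ⟨c, hc, N₀, h⟩ ⟨c', hc', N₀', h'⟩
    refine ⟨min c c', lt_min hc hc', max N₀ N₀', fun N hN x hx => ?_⟩
    rcases hx with hx | hx
    · exact (mul_le_mul_of_nonneg_right (min_le_left _ _) N.cast_nonneg).trans
        (h N (le_trans (le_max_left _ _) hN) x hx)
    · exact (mul_le_mul_of_nonneg_right (min_le_right _ _) N.cast_nonneg).trans
        (h' N (le_trans (le_max_right _ _) hN) x hx)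
  · intro x hx
    obtain ⟨s, hs, hne, hcont⟩ := hF x hx
    have hpos : 0 < |F x s| := abs_pos.2 hne
    have hev : ∀ᶠ y : X × ℝ in 𝓝 (x, s), |F x s| / 2 < |F y.1 y.2| :=
      hcont.abs.eventually (lt_mem_nhds (by simpa using half_lt_self hpos))
    rw [nhds_prod_eq, Filter.eventually_prod_iff] at hev
    obtain ⟨pa, hpa, pb, hpb, hev⟩ := hev
    obtain ⟨l, u, hlu, hsub⟩ := mem_nhds_iff_exists_Ioo_subset.1 (hpb.and (Ioo_mem_nhds hs.1 hs.2))
    set a := max l 0 with ha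
    set b := min u 1 with hb
    have hab : a < b := (max_lt hlu.1 hs.1).trans (lt_min hlu.2 hs.2)
    refine ⟨{y | pa y}, mem_nhdsWithin_of_mem_nhds hpa,
      (|F x s| / 2) ^ 2 * ((b - a) / 4), by have := sub_pos.2 hab; positivity,
      ⌈4 / (b - a)⌉₊, fun N hN y hy => ?_⟩
    have hcard := card_designPoint_mem_Ioo_ge (le_max_right _ _) hab (min_le_right _ _)
      ((Nat.le_ceil _).trans (by exact_mod_cast hN))
    calc (|F x s| / 2) ^ 2 * ((b - a) / 4) * N
        = ((b - a) / 4 * N) * (|F x s| / 2) ^ 2 := by ring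
      _ ≤ ((Finset.univ.filter fun t : Fin N => designPoint N t ∈ Set.Ioo a b).card : ℝ) *
          (|F x s| / 2) ^ 2 := mul_le_mul_of_nonneg_right hcard (by positivity)
      _ = ∑ t ∈ Finset.univ.filter fun t : Fin N => designPoint N t ∈ Set.Ioo a b,
          (|F x s| / 2) ^ 2 := by simp
      _ ≤ ∑ t ∈ Finset.univ.filter fun t : Fin N => designPoint N t ∈ Set.Ioo a b,
          (F y (designPoint N t)) ^ 2 := by
        refine Finset.sum_le_sum fun t ht => ?_
        have ht' := (Finset.mem_filter.1 ht).2
        have hm : designPoint N t ∈ Set.Ioo l u :=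
          ⟨(le_max_left _ _).trans_lt ht'.1, ht'.2.trans_le (min_le_left _ _)⟩
        have := hev hy (hsub hm).1
        rw [← sq_abs (F y _)]
        exact pow_le_pow_left₀ (by positivity) this.le 2
      _ ≤ _ := Finset.sum_le_sum_of_subset_of_nonneg (Finset.filter_subset _ _)
          fun _ _ _ => sq_nonneg _

/-- Homogeneous form of `exists_grid_lower_bound`: a family of functions depending linearly on
a finite-dimensional parameter `v`, and on a further parameter in a compact set, has discrete
norm at least of order `√N ‖v‖`. -/
theorem exists_grid_lower_bound_linear {E X : Type*} [NormedAddCommGroup E] [NormedSpace ℝ E]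
    [FiniteDimensional ℝ E] [TopologicalSpace X] {S : Set X} (hS : IsCompact S)
    (F : E → X → ℝ → ℝ) (hsmul : ∀ (a : ℝ) v x s, F (a • v) x s = a * F v x s)
    (hF : ∀ v x, v ≠ 0 → x ∈ S → ∃ s ∈ Set.Ioo (0 : ℝ) 1, F v x s ≠ 0 ∧
      ContinuousAt (fun y : (E × X) × ℝ => F y.1.1 y.1.2 y.2) ((v, x), s)) :
    ∃ c : ℝ, 0 < c ∧ ∃ N₀ : ℕ, ∀ N : ℕ, N₀ ≤ N → ∀ v, ∀ x ∈ S,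
      c * N * ‖v‖ ^ 2 ≤ ∑ t : Fin N, (F v x (designPoint N t)) ^ 2 := by
  have : ProperSpace E := FiniteDimensional.proper ℝ E
  obtain ⟨c, hc, N₀, h⟩ := exists_grid_lower_bound ((isCompact_sphere (0 : E) 1).prod hS)
    (fun y : E × X => F y.1 y.2) (fun y hy => hF y.1 y.2
      (by rintro h0; have := hy.1; simp [h0] at this) hy.2)
  refine ⟨c, hc, N₀, fun N hN v x hx => ?_⟩
  rcases eq_or_ne v 0 with rfl | hv
  · simp only [norm_zero]
    rw [zero_pow two_ne_zero, mul_zero]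
    exact Finset.sum_nonneg fun _ _ => sq_nonneg _
  have hv' : 0 < ‖v‖ := norm_pos_iff.2 hv
  have := h N hN (‖v‖⁻¹ • v, x) ⟨by simp [norm_smul, hv'.ne'], hx⟩
  have h2 : ∀ t : Fin N, (F v x (designPoint N t)) ^ 2 =
      ‖v‖ ^ 2 * (F (‖v‖⁻¹ • v) x (designPoint N t)) ^ 2 := by
    intro t
    rw [hsmul]
    field_simp
  rw [Finset.sum_congr rfl fun t _ => h2 t, ← Finset.mul_sum, mul_comm]
  exact mul_le_mul_of_nonneg_left this (by positivity)

/-! ### The two polynomial pieces of a spline -/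

/-- The coefficients `(a₁, …, a_p)` of a parameter vector. -/
def coeffs {p : ℕ} (τ : Param p) : Fin p → ℝ := fun i => τ i.castSucc

/-- The knot `η` of a parameter vector. -/
def knot {p : ℕ} (τ : Param p) : ℝ := τ (Fin.last p)

/-- The polynomial piece of the spline to the left of the knot. -/
noncomputable def leftPoly {p : ℕ} (q : ℕ) (a : Fin p → ℝ) : ℝ[X] :=
  ∑ i : Fin p, if (i : ℕ) < q then Polynomial.C (a i) * Polynomial.X ^ (i : ℕ) else 0

/-- The polynomial which is added to `leftPoly` to the right of the knot `η`. -/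
noncomputable def jumpPoly {p : ℕ} (q : ℕ) (a : Fin p → ℝ) (η : ℝ) : ℝ[X] :=
  ∑ i : Fin p, if (i : ℕ) < q then 0 else
    Polynomial.C (a i) * (Polynomial.X - Polynomial.C η) ^ ((i : ℕ) - q + 1)

/-- The directional derivative of `jumpPoly` at `θ` in the direction `δ`: the change, to first
order, of the polynomial added to the right of the knot. -/
noncomputable def tangentPoly {p : ℕ} (q : ℕ) (θ δ : Param p) : ℝ[X] :=
  jumpPoly q (coeffs δ) (knot θ) -
    Polynomial.C (knot δ) * Polynomial.derivative (jumpPoly q (coeffs θ) (knot θ))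

section Pieces

variable {p q : ℕ}

lemma eval_leftPoly (a : Fin p → ℝ) (s : ℝ) :
    (leftPoly q a).eval s = ∑ i : Fin p, if (i : ℕ) < q then a i * s ^ (i : ℕ) else 0 := by
  rw [leftPoly, Polynomial.eval_finsetSum]
  refine Finset.sum_congr rfl fun i _ => ?_
  split_ifs <;> simp

lemma eval_jumpPoly (a : Fin p → ℝ) (η s : ℝ) :
    (jumpPoly q a η).eval s =
      ∑ i : Fin p, if (i : ℕ) < q then 0 else a i * (s - η) ^ ((i : ℕ) - q + 1) := by
  rw [jumpPoly, Polynomial.eval_finsetSum]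
  refine Finset.sum_congr rfl fun i _ => ?_
  split_ifs <;> simp

lemma eval_derivative_jumpPoly (a : Fin p → ℝ) (η s : ℝ) :
    (Polynomial.derivative (jumpPoly q a η)).eval s =
      ∑ i : Fin p, if (i : ℕ) < q then 0 else
        a i * (((i : ℕ) - q + 1 : ℕ) * (s - η) ^ ((i : ℕ) - q)) := by
  rw [jumpPoly, Polynomial.derivative_sum, Polynomial.eval_finsetSum]
  refine Finset.sum_congr rfl fun i _ => ?_
  split_ifs
  · simp
  · simp [Polynomial.derivative_pow]

lemma leftPoly_mem_degreeLT (a : Fin p → ℝ) : leftPoly q a ∈ Polynomial.degreeLT ℝ p := by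
  refine Submodule.sum_mem _ fun i _ => ?_
  split_ifs
  · rw [Polynomial.mem_degreeLT]
    exact (Polynomial.degree_C_mul_X_pow_le _ _).trans_lt (by exact_mod_cast i.isLt)
  · exact Submodule.zero_mem _

lemma jumpPoly_mem_degreeLT (hq : 1 ≤ q) (a : Fin p → ℝ) (η : ℝ) :
    jumpPoly q a η ∈ Polynomial.degreeLT ℝ p := by
  refine Submodule.sum_mem _ fun i _ => ?_
  split_ifs with h
  · exact Submodule.zero_mem _
  · rw [← Polynomial.smul_eq_C_mul]
    refine Submodule.smul_mem _ _ ?_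
    rw [Polynomial.mem_degreeLT, Polynomial.degree_pow, Polynomial.degree_X_sub_C, nsmul_one]
    have := i.isLt
    exact_mod_cast (show (i : ℕ) - q + 1 < p by omega)

lemma tangentPoly_mem_degreeLT (hq : 1 ≤ q) (θ δ : Param p) :
    tangentPoly q θ δ ∈ Polynomial.degreeLT ℝ p := by
  refine Submodule.sub_mem _ (jumpPoly_mem_degreeLT hq _ _) ?_
  rw [← Polynomial.smul_eq_C_mul]
  refine Submodule.smul_mem _ _ ?_
  rw [Polynomial.mem_degreeLT]
  exact (Polynomial.degree_derivative_le).trans_lt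
    (Polynomial.mem_degreeLT.1 (jumpPoly_mem_degreeLT hq _ _))

lemma sum_splineBasis_eq (a : Fin p → ℝ) (η s : ℝ) :
    ∑ i : Fin p, a i * splineBasis q η i s =
      (leftPoly q a).eval s + if η < s then (jumpPoly q a η).eval s else 0 := by
  rw [eval_leftPoly, eval_jumpPoly]
  split_ifs with hs
  · rw [← Finset.sum_add_distrib]
    refine Finset.sum_congr rfl fun i _ => ?_
    unfold splineBasis
    split_ifs
    · ring
    · rw [max_eq_left (by linarith)]
      ring
  · rw [add_zero]
    refine Finset.sum_congr rfl fun i _ => ?_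
    unfold splineBasis
    split_ifs
    · ring
    · rw [max_eq_right (by linarith)]
      simp

lemma splineMean_eq (τ : Param p) (s : ℝ) :
    splineMean q τ s = (leftPoly q (coeffs τ)).eval s +
      if knot τ < s then (jumpPoly q (coeffs τ) (knot τ)).eval s else 0 :=
  sum_splineBasis_eq (coeffs τ) (knot τ) s

/-! ### Right partial derivatives -/

lemma rightPartial_castSucc (τ : Param p) (j : Fin p) (s : ℝ) :
    rightPartial q τ j.castSucc s = splineBasis q (knot τ) j s := by
  have hfun : (fun x : ℝ =>
      splineMean q (WithLp.toLp 2 (Function.update (⇑τ) j.castSucc x) : Param p) s) =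
      fun x => splineMean q τ s + (x - τ j.castSucc) * splineBasis q (knot τ) j s := by
    funext x
    have hlast : Function.update (⇑τ) j.castSucc x (Fin.last p) = knot τ :=
      Function.update_of_ne (Fin.castSucc_lt_last j).ne' _ _
    simp only [splineMean, hlast]
    have : ∀ i : Fin p, Function.update (⇑τ) j.castSucc x i.castSucc
        = τ i.castSucc + if i = j then x - τ j.castSucc else 0 := by
      intro i
      rcases eq_or_ne i j with rfl | hij
      · simp
      · rw [Function.update_of_ne (by simpa using hij), if_neg hij, add_zero]
    simp only [this, add_mul, Finset.sum_add_distrib, ite_mul, zero_mul, Finset.sum_ite_eq',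
      Finset.mem_univ, if_true]
    rfl
  have hd : HasDerivAt (fun x : ℝ =>
      splineMean q τ s + (x - τ j.castSucc) * splineBasis q (knot τ) j s)
      (splineBasis q (knot τ) j s) (τ j.castSucc) := by
    simpa using (((hasDerivAt_id (τ j.castSucc)).sub_const (τ j.castSucc)).mul_const
      (splineBasis q (knot τ) j s)).const_add (splineMean q τ s)
  rw [rightPartial, hfun]
  exact hd.hasDerivWithinAt.derivWithin (uniqueDiffWithinAt_Ioi _)

/-- The right derivative in the knot vanishes at `s = η` too, since moving the knot to the right
leaves `(s - η)₊` equal to zero there. -/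
lemma rightPartial_last (τ : Param p) (s : ℝ) :
    rightPartial q τ (Fin.last p) s =
      if knot τ < s then -(Polynomial.derivative (jumpPoly q (coeffs τ) (knot τ))).eval s
      else 0 := by
  have hfun : (fun x : ℝ =>
      splineMean q (WithLp.toLp 2 (Function.update (⇑τ) (Fin.last p) x) : Param p) s) =
      fun x => (leftPoly q (coeffs τ)).eval s +
        if x < s then (jumpPoly q (coeffs τ) x).eval s else 0 := by
    funext x
    rw [splineMean_eq]
    have h1 : coeffs (WithLp.toLp 2 (Function.update (⇑τ) (Fin.last p) x) : Param p)
        = coeffs τ := by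
      funext i
      exact Function.update_of_ne (Fin.castSucc_lt_last i).ne _ _
    have h2 : knot (WithLp.toLp 2 (Function.update (⇑τ) (Fin.last p) x) : Param p) = x := by
      simp [knot]
    rw [h1, h2]
  rw [rightPartial, hfun]
  change derivWithin _ (Set.Ioi (knot τ)) (knot τ) = _
  split_ifs with hs
  · have hd : HasDerivAt (fun x : ℝ => (leftPoly q (coeffs τ)).eval s +
        (jumpPoly q (coeffs τ) x).eval s)
        (-(Polynomial.derivative (jumpPoly q (coeffs τ) (knot τ))).eval s) (knot τ) := by
      refine HasDerivAt.const_add _ ?_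
      simp only [eval_jumpPoly, eval_derivative_jumpPoly]
      rw [← Finset.sum_neg_distrib]
      refine HasDerivAt.fun_sum fun i _ => ?_
      split_ifs
      · simpa using hasDerivAt_const (knot τ) (0 : ℝ)
      · have := (((hasDerivAt_id (knot τ)).const_sub s).pow ((i : ℕ) - q + 1)).const_mul
          (coeffs τ i)
        refine this.congr_deriv ?_
        simp
    have heq : (fun x : ℝ => (leftPoly q (coeffs τ)).eval s +
        if x < s then (jumpPoly q (coeffs τ) x).eval s else 0) =ᶠ[𝓝 (knot τ)]
        fun x => (leftPoly q (coeffs τ)).eval s + (jumpPoly q (coeffs τ) x).eval s := by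
      filter_upwards [Iio_mem_nhds hs] with x hx
      rw [if_pos (Set.mem_Iio.1 hx)]
    exact (hd.congr_of_eventuallyEq heq).hasDerivWithinAt.derivWithin (uniqueDiffWithinAt_Ioi _)
  · have hd : HasDerivWithinAt (fun _ : ℝ => (leftPoly q (coeffs τ)).eval s + 0) 0
        (Set.Ioi (knot τ)) (knot τ) := hasDerivWithinAt_const _ _ _
    refine (hd.congr (fun x hx => ?_) ?_).derivWithin (uniqueDiffWithinAt_Ioi _)
    · rw [if_neg (by have := Set.mem_Ioi.1 hx; linarith)]
    · rw [if_neg hs]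

/-- The gradient in the direction `δ` is again a pair of polynomials separated by the knot. -/
lemma sum_rightPartial_mul (θ δ : Param p) (s : ℝ) :
    ∑ i, rightPartial q θ i s * δ i = (leftPoly q (coeffs δ)).eval s +
      if knot θ < s then (tangentPoly q θ δ).eval s else 0 := by
  rw [Fin.sum_univ_castSucc, rightPartial_last]
  have h := sum_splineBasis_eq (q := q) (coeffs δ) (knot θ) s
  have h' : ∑ i : Fin p, rightPartial q θ i.castSucc s * δ i.castSucc =
      ∑ i : Fin p, coeffs δ i * splineBasis q (knot θ) i s :=
    Finset.sum_congr rfl fun i _ => by rw [rightPartial_castSucc, mul_comm]; rfl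
  rw [h', h]
  split_ifs
  · simp only [tangentPoly, Polynomial.eval_sub, Polynomial.eval_mul, Polynomial.eval_C]
    change _ + _ * knot δ = _
    ring
  · simp

/-! ### Size of the pieces -/

lemma abs_coeffs_le (δ : Param p) (i : Fin p) : |coeffs δ i| ≤ ‖δ‖ :=
  PiLp.norm_apply_le δ i.castSucc

lemma abs_knot_le (δ : Param p) : |knot δ| ≤ ‖δ‖ :=
  PiLp.norm_apply_le δ (Fin.last p)

lemma norm_le_sum_abs_coeffs_add (δ : Param p) : ‖δ‖ ≤ ‖coeffs δ‖ * p + |knot δ| := by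
  have h1 : ‖δ‖ ≤ ∑ i, |δ i| := by
    rw [EuclideanSpace.norm_eq]
    refine Real.sqrt_le_iff.2 ⟨Finset.sum_nonneg fun _ _ => abs_nonneg _, ?_⟩
    simp only [Real.norm_eq_abs]
    exact Finset.sum_sq_le_sq_sum_of_nonneg fun _ _ => abs_nonneg _
  rw [Fin.sum_univ_castSucc] at h1
  refine h1.trans (add_le_add ?_ le_rfl)
  calc ∑ i : Fin p, |δ i.castSucc| ≤ ∑ _i : Fin p, ‖coeffs δ‖ :=
        Finset.sum_le_sum fun i _ => norm_le_pi_norm (coeffs δ) i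
    _ = ‖coeffs δ‖ * p := by simp [mul_comm]

lemma abs_eval_jumpPoly_le (a : Fin p → ℝ) {η s : ℝ} (h : |s - η| ≤ 1) :
    |(jumpPoly q a η).eval s| ≤ (∑ i, |a i|) * |s - η| := by
  rw [eval_jumpPoly, Finset.sum_mul]
  refine (Finset.abs_sum_le_sum_abs _ _).trans (Finset.sum_le_sum fun i _ => ?_)
  split_ifs
  · simp only [abs_zero]; positivity
  · rw [abs_mul, abs_pow, pow_succ]
    refine mul_le_mul_of_nonneg_left ?_ (abs_nonneg _)
    exact mul_le_of_le_one_left (abs_nonneg _) (pow_le_one₀ (abs_nonneg _) h)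

lemma abs_sub_pow_sub_pow_le {x h : ℝ} (hx : |x| ≤ 1) (hh : |h| ≤ 1) (n : ℕ) :
    |(x - h) ^ n - x ^ n| ≤ 3 ^ n * |h| := by
  induction n with
  | zero => simp
  | succ n ih =>
    have h1 : (x - h) ^ (n + 1) - x ^ (n + 1) = (x - h) * ((x - h) ^ n - x ^ n) + -(h * x ^ n) := by
      ring
    have h2 : |x - h| ≤ 2 := (abs_sub _ _).trans (by linarith)
    have h3 : |x ^ n| ≤ 1 := by rw [abs_pow]; exact pow_le_one₀ (abs_nonneg _) hx
    have h4 : (1 : ℝ) ≤ 3 ^ n := one_le_pow₀ (by norm_num)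
    rw [h1]
    refine (abs_add_le _ _).trans ?_
    rw [abs_mul, abs_neg, abs_mul]
    have h5 := mul_le_mul h2 ih (abs_nonneg _) (by norm_num)
    have h6 := mul_le_mul_of_nonneg_left h3 (abs_nonneg h)
    have h7 := mul_le_mul_of_nonneg_right h4 (abs_nonneg h)
    rw [pow_succ]
    linarith

lemma abs_sub_pow_sub_taylor_le {x h : ℝ} (hx : |x| ≤ 1) (hh : |h| ≤ 1) (n : ℕ) :
    |(x - h) ^ n - x ^ n + n * x ^ (n - 1) * h| ≤ 3 ^ n * h ^ 2 := by
  induction n with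
  | zero => simp [sq_nonneg]
  | succ n ih =>
    have h1 : (x - h) ^ (n + 1) - x ^ (n + 1) + ((n + 1 : ℕ) : ℝ) * x ^ (n + 1 - 1) * h =
        (x - h) * ((x - h) ^ n - x ^ n + n * x ^ (n - 1) * h) + n * x ^ (n - 1) * h ^ 2 := by
      rcases n with _ | n
      · simp
      · push_cast
        ring
    have h2 : |x - h| ≤ 2 := (abs_sub _ _).trans (by linarith)
    have h3 : |x ^ (n - 1)| ≤ 1 := by rw [abs_pow]; exact pow_le_one₀ (abs_nonneg _) hx
    have h4 : (n : ℝ) ≤ 3 ^ n := by exact_mod_cast (Nat.lt_pow_self (by norm_num)).le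
    rw [h1]
    refine (abs_add_le _ _).trans ?_
    rw [abs_mul, abs_mul, abs_mul, abs_of_nonneg (sq_nonneg h), Nat.abs_cast]
    have h5 := mul_le_mul h2 ih (abs_nonneg _) (by norm_num)
    have h6 : (n : ℝ) * |x ^ (n - 1)| * h ^ 2 ≤ 3 ^ n * h ^ 2 :=
      mul_le_mul_of_nonneg_right
        ((mul_le_of_le_one_right n.cast_nonneg h3).trans h4) (sq_nonneg h)
    rw [pow_succ (3 : ℝ) n]
    linarith

/-- Second-order Taylor bound for the polynomial added to the right of the knot. -/
lemma abs_eval_jumpPoly_remainder_le (θ δ : Param p) {s : ℝ} (hs : |s - knot θ| ≤ 1)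
    (hδ : |knot δ| ≤ 1) :
    |(jumpPoly q (coeffs (θ + δ)) (knot (θ + δ)) - jumpPoly q (coeffs θ) (knot θ) -
      tangentPoly q θ δ).eval s| ≤ 3 ^ (p + 1) * (∑ i, |coeffs θ i| + p) * ‖δ‖ ^ 2 := by
  have hkey : (jumpPoly q (coeffs (θ + δ)) (knot (θ + δ)) - jumpPoly q (coeffs θ) (knot θ) -
      tangentPoly q θ δ).eval s = ∑ i : Fin p, if (i : ℕ) < q then 0 else
        (coeffs θ i * ((s - knot θ - knot δ) ^ ((i : ℕ) - q + 1) - (s - knot θ) ^ ((i : ℕ) - q + 1)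
          + ((i : ℕ) - q + 1 : ℕ) * (s - knot θ) ^ ((i : ℕ) - q + 1 - 1) * knot δ) +
        coeffs δ i * ((s - knot θ - knot δ) ^ ((i : ℕ) - q + 1)
          - (s - knot θ) ^ ((i : ℕ) - q + 1))) := by
    have hc : ∀ i, coeffs (θ + δ) i = coeffs θ i + coeffs δ i := fun i => rfl
    have hk : s - knot (θ + δ) = s - knot θ - knot δ := by
      rw [sub_sub]; rfl
    simp only [tangentPoly, Polynomial.eval_sub, Polynomial.eval_mul, Polynomial.eval_C,
      eval_jumpPoly, eval_derivative_jumpPoly, hk, hc]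
    rw [Finset.mul_sum, ← Finset.sum_sub_distrib, ← Finset.sum_sub_distrib,
      ← Finset.sum_sub_distrib]
    refine Finset.sum_congr rfl fun i _ => ?_
    split_ifs
    · ring
    · simp only [Nat.add_sub_cancel]
      ring
  rw [hkey, mul_assoc, add_mul, mul_add, Finset.sum_mul, Finset.mul_sum]
  have hp : (3 : ℝ) ^ (p + 1) * (p * ‖δ‖ ^ 2) = ∑ _i : Fin p, 3 ^ (p + 1) * ‖δ‖ ^ 2 := by
    simp; ring
  rw [hp, ← Finset.sum_add_distrib]
  refine (Finset.abs_sum_le_sum_abs _ _).trans (Finset.sum_le_sum fun i _ => ?_)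
  split_ifs
  · simp only [abs_zero]; positivity
  · have hpow : (3 : ℝ) ^ ((i : ℕ) - q + 1) ≤ 3 ^ (p + 1) :=
      pow_le_pow_right₀ (by norm_num) (by have := i.isLt; omega)
    have hd := abs_knot_le δ
    have hd2 : knot δ ^ 2 ≤ ‖δ‖ ^ 2 := by
      rw [← sq_abs]; exact pow_le_pow_left₀ (abs_nonneg _) hd 2
    have h1 := abs_sub_pow_sub_taylor_le hs hδ ((i : ℕ) - q + 1)
    have h2 := abs_sub_pow_sub_pow_le hs hδ ((i : ℕ) - q + 1)
    refine (abs_add_le _ _).trans (add_le_add ?_ ?_)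
    · rw [abs_mul, mul_left_comm]
      exact mul_le_mul_of_nonneg_left
        (h1.trans (mul_le_mul hpow hd2 (sq_nonneg _) (by positivity))) (abs_nonneg _)
    · rw [abs_mul]
      calc |coeffs δ i| * _ ≤ ‖δ‖ * (3 ^ (p + 1) * ‖δ‖) :=
            mul_le_mul (abs_coeffs_le δ i)
              (h2.trans (mul_le_mul hpow hd (abs_nonneg _) (by positivity)))
              (abs_nonneg _) (norm_nonneg _)
        _ = _ := by ring

/-! ### Identifiability of the pieces -/

lemma exists_eval_ne_zero_of_ne_zero {P : ℝ[X]} (hP : P ≠ 0) {a b : ℝ} (hab : a < b) :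
    ∃ s ∈ Set.Ioo a b, P.eval s ≠ 0 := by
  by_contra! h
  exact hP (Polynomial.eq_zero_of_infinite_isRoot P ((Set.Ioo_infinite hab).mono h))

lemma eq_zero_of_leftPoly_eq_zero {a : Fin p → ℝ} (h : leftPoly q a = 0) (i : Fin p)
    (hi : (i : ℕ) < q) : a i = 0 := by
  have := congrArg (fun P : ℝ[X] => P.coeff (i : ℕ)) h
  simp only [leftPoly, Polynomial.finsetSum_coeff, Polynomial.coeff_zero] at this
  rw [Finset.sum_eq_single i] at this
  · simpa [hi] using this
  · intro j _ hj
    have hj' : (i : ℕ) ≠ j := fun h => hj (Fin.ext h.symm)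
    split_ifs
    · simp [Polynomial.coeff_X_pow, hj']
    · simp
  · simp

/-- Translation by the knot turns `jumpPoly` into a polynomial whose coefficients are the `a i`. -/
lemma eq_zero_of_jumpPoly_eq_zero {a : Fin p → ℝ} {η : ℝ} (h : jumpPoly q a η = 0) (i : Fin p)
    (hi : ¬ (i : ℕ) < q) : a i = 0 := by
  have h0 : (jumpPoly q a η).comp (Polynomial.X + Polynomial.C η) = 0 := by rw [h]; simp
  have := congrArg (fun P : ℝ[X] => P.coeff ((i : ℕ) - q + 1)) h0
  simp only [jumpPoly, Polynomial.sum_comp, Polynomial.finsetSum_coeff,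
    Polynomial.coeff_zero] at this
  rw [Finset.sum_eq_single i] at this
  · simpa [hi] using this
  · intro j _ hj
    split_ifs with hjq
    · simp
    · have hj' : ¬ ((i : ℕ) - q = j - q) := fun h => hj (Fin.ext (by omega))
      simp [Polynomial.coeff_X_pow, hj']
  · simp

lemma eval_knot_tangentPoly (hqp : q < p) (θ δ : Param p) :
    (tangentPoly q θ δ).eval (knot θ) = -(knot δ * coeffs θ ⟨q, hqp⟩) := by
  simp only [tangentPoly, Polynomial.eval_sub, Polynomial.eval_mul, Polynomial.eval_C,
    eval_jumpPoly, eval_derivative_jumpPoly, sub_self]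
  rw [Finset.sum_eq_zero (fun i _ => by split_ifs <;> simp),
    Finset.sum_eq_single (⟨q, hqp⟩ : Fin p)]
  · simp
  · intro i _ hi
    split_ifs with h
    · rfl
    · have : (i : ℕ) - q ≠ 0 := fun h' => hi (Fin.ext (by simp; omega))
      simp [this]
  · simp

/-- The gradient is injective: the value of `tangentPoly` at the knot determines the component of
`δ` in the direction of the knot, because the kink is present. -/
lemma eq_zero_of_tangent_eq_zero (hqp : q < p) {θ δ : Param p}
    (hkink : coeffs θ ⟨q, hqp⟩ ≠ 0) (h1 : leftPoly q (coeffs δ) = 0)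
    (h2 : tangentPoly q θ δ = 0) : δ = 0 := by
  have hk : knot δ = 0 := by
    have := eval_knot_tangentPoly hqp θ δ
    rw [h2] at this
    simpa [hkink] using this
  have hj : jumpPoly q (coeffs δ) (knot θ) = 0 := by simpa [tangentPoly, hk] using h2
  ext i
  refine Fin.lastCases hk (fun j => ?_) i
  by_cases hjq : (j : ℕ) < q
  · exact eq_zero_of_leftPoly_eq_zero h1 j hjq
  · exact eq_zero_of_jumpPoly_eq_zero hj j hjq

end Pieces

/-! ### Polynomials sampled on sets of design points -/

/-- The vector of values of a polynomial at the design points with index in `A`, extended by zero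
to the other indices. -/
noncomputable def evalOn (N : ℕ) (A : Set (Fin N)) : ℝ[X] →ₗ[ℝ] EuclideanSpace ℝ (Fin N) where
  toFun P := WithLp.toLp 2 (A.indicator fun t => P.eval (designPoint N t))
  map_add' P Q := by
    ext t
    by_cases h : t ∈ A <;> simp [h]
  map_smul' c P := by
    ext t
    by_cases h : t ∈ A <;> simp [h]

/-- The indices of the design points to the right of `x`. -/
def above (N : ℕ) (x : ℝ) : Set (Fin N) := {t | x < designPoint N t}

/-- The indices of the design points between `x` and `y`. -/
def window (N : ℕ) (x y : ℝ) : Set (Fin N) := {t | designPoint N t ∈ Set.uIoc x y}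

lemma evalOn_apply (N : ℕ) (A : Set (Fin N)) (P : ℝ[X]) (t : Fin N) :
    evalOn N A P t = A.indicator (fun t => P.eval (designPoint N t)) t := rfl

lemma evalOn_above_apply (N : ℕ) (x : ℝ) (P : ℝ[X]) (t : Fin N) :
    evalOn N (above N x) P t = if x < designPoint N t then P.eval (designPoint N t) else 0 := by
  classical
  rw [evalOn_apply, Set.indicator_apply]
  rfl

lemma evalOn_univ_apply (N : ℕ) (P : ℝ[X]) (t : Fin N) :
    evalOn N Set.univ P t = P.eval (designPoint N t) := by
  rw [evalOn_apply, Set.indicator_univ]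

/-- Moving a break from `x` to `y` changes a sampled polynomial on the window between them only;
the sign depends on the order of `x` and `y`. -/
lemma evalOn_above_sub (N : ℕ) (x y : ℝ) (P : ℝ[X]) :
    evalOn N (above N y) P - evalOn N (above N x) P = evalOn N (window N x y) P ∨
    evalOn N (above N y) P - evalOn N (above N x) P = -evalOn N (window N x y) P := by
  classical
  rcases le_total x y with h | h
  · right
    ext t
    simp only [PiLp.sub_apply, PiLp.neg_apply, evalOn_apply, Set.indicator_apply, window, above,
      Set.mem_ofPred_eq, Set.uIoc_of_le h, Set.mem_Ioc]
    split_ifs <;> grind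
  · left
    ext t
    simp only [PiLp.sub_apply, evalOn_apply, Set.indicator_apply, window, above,
      Set.mem_ofPred_eq, Set.uIoc_of_ge h, Set.mem_Ioc]
    split_ifs <;> grind

lemma norm_sq_le_card_mul {N : ℕ} (A : Finset (Fin N)) (v : EuclideanSpace ℝ (Fin N)) {U : ℝ}
    (h0 : ∀ t ∉ A, v t = 0) (hU : ∀ t ∈ A, |v t| ≤ U) : ‖v‖ ^ 2 ≤ A.card * U ^ 2 := by
  rw [EuclideanSpace.real_norm_sq_eq, ← Finset.sum_subset (Finset.subset_univ A)
    (fun t _ ht => by rw [h0 t ht]; simp)]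
  calc ∑ t ∈ A, v t ^ 2 ≤ ∑ _t ∈ A, U ^ 2 := Finset.sum_le_sum fun t ht => by
        rw [← sq_abs]; exact pow_le_pow_left₀ (abs_nonneg _) (hU t ht) 2
    _ = _ := by simp

lemma norm_le_sqrt_mul {N : ℕ} (v : EuclideanSpace ℝ (Fin N)) {U : ℝ} (hU0 : 0 ≤ U)
    (hU : ∀ t, |v t| ≤ U) : ‖v‖ ≤ √N * U := by
  have h := norm_sq_le_card_mul Finset.univ v (U := U) (by simp) (fun t _ => hU t)
  rw [Finset.card_univ, Fintype.card_fin] at h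
  refine le_of_sq_le_sq ?_ (by positivity)
  rwa [mul_pow, Real.sq_sqrt N.cast_nonneg]

lemma card_window_le {N : ℕ} {x y : ℝ} (hx : 0 ≤ x) (hy : 0 ≤ y) (A : Finset (Fin N))
    (hA : ∀ t ∈ A, t ∈ window N x y) : (A.card : ℝ) ≤ N * |y - x| + 1 := by
  wlog hxy : x ≤ y generalizing x y
  · rw [abs_sub_comm]
    exact this hy hx (fun t ht => by simpa [window, Set.uIoc_comm] using hA t ht)
      (le_of_not_ge hxy)
  rw [abs_of_nonneg (sub_nonneg.2 hxy)]
  have hcard : A.card ≤ (Finset.Ico ⌊(N : ℝ) * x⌋₊ ⌊(N : ℝ) * y⌋₊).card := by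
    refine Finset.card_le_card_of_injOn (fun t : Fin N => (t : ℕ)) (fun t ht => ?_)
      (fun i _ j _ h => Fin.ext h)
    have := hA t ht
    simp only [window, Set.mem_ofPred_eq, Set.uIoc_of_le hxy, Set.mem_Ioc] at this
    simp only [Finset.coe_Ico, Set.mem_Ico]
    refine ⟨(lt_designPoint_iff t hx).1 this.1, ?_⟩
    by_contra! h
    exact absurd this.2 (not_le.2 ((lt_designPoint_iff t hy).2 h))
  rw [Nat.card_Ico] at hcard
  have h1 : ((⌊(N : ℝ) * y⌋₊ : ℕ) : ℝ) ≤ N * y := Nat.floor_le (by positivity)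
  have h2 : (N : ℝ) * x < (⌊(N : ℝ) * x⌋₊ : ℕ) + 1 := Nat.lt_floor_add_one _
  have h3 : ⌊(N : ℝ) * x⌋₊ ≤ ⌊(N : ℝ) * y⌋₊ := Nat.floor_le_floor (by gcongr)
  have h4 : (A.card : ℝ) ≤ (⌊(N : ℝ) * y⌋₊ : ℕ) - (⌊(N : ℝ) * x⌋₊ : ℕ) := by
    rw [← Nat.cast_sub h3]; exact_mod_cast hcard
  nlinarith

lemma norm_sq_evalOn_window_le {N : ℕ} {x y : ℝ} (hx : 0 ≤ x) (hy : 0 ≤ y) (P : ℝ[X]) {U : ℝ}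
    (hU : ∀ t ∈ window N x y, |P.eval (designPoint N t)| ≤ U) :
    ‖evalOn N (window N x y) P‖ ^ 2 ≤ (N * |y - x| + 1) * U ^ 2 := by
  classical
  refine (norm_sq_le_card_mul (Finset.univ.filter fun t => t ∈ window N x y) _ (U := U)
    ?_ ?_).trans (mul_le_mul_of_nonneg_right (card_window_le hx hy _ (by simp)) (sq_nonneg U))
  · intro t ht
    rw [evalOn_apply, Set.indicator_of_notMem (by simpa using ht)]
  · intro t ht
    have ht' : t ∈ window N x y := by simpa using ht
    rw [evalOn_apply, Set.indicator_of_mem ht']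
    exact hU t ht'

/-! ### The regression vector and its linearization -/

/-- The vector of differences `μ(t/N; τ) - μ(t/N; θ)`. -/
noncomputable def meanShift {p : ℕ} (q : ℕ) (θ τ : Param p) (N : ℕ) : EuclideanSpace ℝ (Fin N) :=
  WithLp.toLp 2 fun t => splineMean q τ (designPoint N t) - splineMean q θ (designPoint N t)

/-- The vector `M δ`, where `M` is the matrix of right partial derivatives at `θ`. -/
noncomputable def gradVec {p : ℕ} (q : ℕ) (θ δ : Param p) (N : ℕ) : EuclideanSpace ℝ (Fin N) :=
  WithLp.toLp 2 (gradMatrix q θ N *ᵥ δ)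

/-- The second-order Taylor remainder of the polynomial added to the right of the knot. -/
noncomputable def jumpRemainder {p : ℕ} (q : ℕ) (θ δ : Param p) : ℝ[X] :=
  jumpPoly q (coeffs (θ + δ)) (knot (θ + δ)) - jumpPoly q (coeffs θ) (knot θ) - tangentPoly q θ δ

/-- The part of the linearization error that comes from the design points between the true knot
and the knot of `θ + δ`. -/
noncomputable def windowError {p : ℕ} (q : ℕ) (θ δ : Param p) (N : ℕ) :
    EuclideanSpace ℝ (Fin N) :=
  evalOn N (above N (knot (θ + δ))) (jumpPoly q (coeffs (θ + δ)) (knot (θ + δ))) -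
    evalOn N (above N (knot θ)) (jumpPoly q (coeffs (θ + δ)) (knot (θ + δ)))

section Vectors

variable {p q : ℕ}

lemma gradVec_apply (θ δ : Param p) (N : ℕ) (t : Fin N) :
    gradVec q θ δ N t = (leftPoly q (coeffs δ)).eval (designPoint N t) +
      if knot θ < designPoint N t then (tangentPoly q θ δ).eval (designPoint N t) else 0 :=
  sum_rightPartial_mul θ δ (designPoint N t)

lemma gradVec_eq (θ δ : Param p) (N : ℕ) :
    gradVec q θ δ N = evalOn N Set.univ (leftPoly q (coeffs δ)) +
      evalOn N (above N (knot θ)) (tangentPoly q θ δ) := by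
  ext t
  rw [gradVec_apply, PiLp.add_apply, evalOn_univ_apply, evalOn_above_apply]

lemma gradVec_sub (θ δ δ' : Param p) (N : ℕ) :
    gradVec q θ (δ - δ') N = gradVec q θ δ N - gradVec q θ δ' N := by
  simp only [gradVec, WithLp.ofLp_sub, Matrix.mulVec_sub, WithLp.toLp_sub]

lemma meanShift_eq (θ τ : Param p) (N : ℕ) :
    meanShift q θ τ N =
      evalOn N Set.univ (leftPoly q (coeffs τ) - leftPoly q (coeffs θ)) +
      evalOn N (above N (knot θ)) (-jumpPoly q (coeffs θ) (knot θ)) +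
      evalOn N (above N (knot τ)) (jumpPoly q (coeffs τ) (knot τ)) := by
  ext t
  simp only [meanShift, splineMean_eq, PiLp.add_apply, evalOn_univ_apply, evalOn_above_apply,
    Polynomial.eval_sub, Polynomial.eval_neg]
  split_ifs <;> ring

lemma leftPoly_coeffs_add (θ δ : Param p) :
    leftPoly q (coeffs (θ + δ)) = leftPoly q (coeffs θ) + leftPoly q (coeffs δ) := by
  simp only [leftPoly]
  rw [← Finset.sum_add_distrib]
  refine Finset.sum_congr rfl fun i _ => ?_
  split_ifs
  · rw [← add_mul, ← Polynomial.C_add]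
    rfl
  · simp

/-- The linearization of the regression vector at `θ`, with its error split into a smooth part
to the right of the true knot and a part supported between the two knots. -/
lemma meanShift_add_eq (θ δ : Param p) (N : ℕ) :
    meanShift q θ (θ + δ) N = gradVec q θ δ N +
      (evalOn N (above N (knot θ)) (jumpRemainder q θ δ) + windowError q θ δ N) := by
  rw [meanShift_eq, gradVec_eq, windowError, jumpRemainder, leftPoly_coeffs_add]
  simp only [map_sub, map_add, map_neg]
  abel

lemma meanShift_self (θ : Param p) (N : ℕ) : meanShift q θ θ N = 0 := by
  ext t
  simp [meanShift]

/-- The least squares criterion in terms of the noise vector. -/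
lemma lsCriterion_eq (θ τ : Param p) {N : ℕ} (Y : Fin N → ℝ) (e : EuclideanSpace ℝ (Fin N))
    (hY : ∀ t, Y t = splineMean q θ (designPoint N t) + e t) :
    lsCriterion q Y τ = ‖e - meanShift q θ τ N‖ ^ 2 := by
  rw [EuclideanSpace.real_norm_sq_eq, lsCriterion]
  refine Finset.sum_congr rfl fun t _ => ?_
  rw [hY, PiLp.sub_apply, meanShift]
  ring

/-! ### Lower bounds for the regression vector -/

/-- The gradient matrix has smallest singular value at least of order `√N`. -/
lemma exists_norm_gradVec_ge (hqp : q < p) {θ : Param p} (hθ : θ ∈ paramSpace p)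
    (hkink : coeffs θ ⟨q, hqp⟩ ≠ 0) :
    ∃ c : ℝ, 0 < c ∧ ∃ N₀ : ℕ, ∀ N : ℕ, N₀ ≤ N → ∀ δ : Param p,
      c * N * ‖δ‖ ^ 2 ≤ ‖gradVec q θ δ N‖ ^ 2 := by
  have hη : knot θ ∈ Set.Ioo (0 : ℝ) 1 := hθ
  obtain ⟨c, hc, N₀, h⟩ := exists_grid_lower_bound_linear (E := Param p) (X := Unit)
    isCompact_univ (fun δ _ s => ∑ i, rightPartial q θ i s * δ i)
    (fun a v _ s => by
      rw [Finset.mul_sum]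
      exact Finset.sum_congr rfl fun i _ => by simp; ring)
    (fun δ x hδ _ => by
      simp only [sum_rightPartial_mul]
      by_cases hl : leftPoly q (coeffs δ) = 0
      · have ht : tangentPoly q θ δ ≠ 0 := fun h => hδ (eq_zero_of_tangent_eq_zero hqp hkink hl h)
        obtain ⟨s, hs, hne⟩ := exists_eval_ne_zero_of_ne_zero ht hη.2
        refine ⟨s, ⟨hη.1.trans hs.1, hs.2⟩, by simpa [hl, hs.1] using hne, ?_⟩
        have hev : ∀ᶠ y : (Param p × Unit) × ℝ in 𝓝 ((δ, x), s), knot θ < y.2 :=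
          continuousAt_snd.eventually (lt_mem_nhds hs.1)
        refine ContinuousAt.congr (f := fun y : (Param p × Unit) × ℝ =>
          (leftPoly q (coeffs y.1.1)).eval y.2 + (tangentPoly q θ y.1.1).eval y.2) ?_ ?_
        · simp only [tangentPoly, Polynomial.eval_sub, Polynomial.eval_mul, Polynomial.eval_C,
            eval_leftPoly, eval_jumpPoly, eval_derivative_jumpPoly, knot, coeffs]
          refine Continuous.continuousAt ?_
          refine Continuous.add (continuous_finsetSum _ fun i _ => ?_)
            (Continuous.sub (continuous_finsetSum _ fun i _ => ?_)
              (Continuous.mul ?_ (continuous_finsetSum _ fun i _ => ?_)))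
          all_goals (try split_ifs) <;> fun_prop
        · filter_upwards [hev] with y hy
          rw [if_pos hy]
      · obtain ⟨s, hs, hne⟩ := exists_eval_ne_zero_of_ne_zero hl hη.1
        refine ⟨s, ⟨hs.1, hs.2.trans hη.2⟩, by simpa [not_lt.2 hs.2.le] using hne, ?_⟩
        have hev : ∀ᶠ y : (Param p × Unit) × ℝ in 𝓝 ((δ, x), s), y.2 < knot θ :=
          continuousAt_snd.eventually (gt_mem_nhds hs.2)
        refine ContinuousAt.congr (f := fun y : (Param p × Unit) × ℝ =>
          (leftPoly q (coeffs y.1.1)).eval y.2) ?_ ?_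
        · simp only [eval_leftPoly, coeffs]
          refine Continuous.continuousAt (continuous_finsetSum _ fun i _ => ?_)
          split_ifs <;> fun_prop
        · filter_upwards [hev] with y hy
          rw [if_neg (not_lt.2 hy.le), add_zero])
  refine ⟨c, hc, N₀, fun N hN δ => ?_⟩
  rw [EuclideanSpace.real_norm_sq_eq (gradVec q θ δ N)]
  exact h N hN δ () trivial

lemma continuous_splineBasis (i : Fin p) :
    Continuous fun y : ℝ × ℝ => splineBasis q y.1 i y.2 := by
  unfold splineBasis
  split_ifs <;> fun_prop

/-- Splines with a knot bounded away from `0` and `1` are linearly independent on the design points,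
uniformly in the knot. -/
lemma exists_norm_spline_ge {u v : ℝ} (hu : 0 < u) (hv : v < 1) :
    ∃ c : ℝ, 0 < c ∧ ∃ N₀ : ℕ, ∀ N : ℕ, N₀ ≤ N → ∀ a : Fin p → ℝ, ∀ η ∈ Set.Icc u v,
      c * N * ‖a‖ ^ 2 ≤ ∑ t : Fin N, (∑ i, a i * splineBasis q η i (designPoint N t)) ^ 2 := by
  refine exists_grid_lower_bound_linear (E := Fin p → ℝ) (X := ℝ) isCompact_Icc
    (fun a η s => ∑ i, a i * splineBasis q η i s)
    (fun b a η s => by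
      rw [Finset.mul_sum]
      exact Finset.sum_congr rfl fun i _ => by simp; ring)
    (fun a η ha hη => ?_)
  have hcont : Continuous fun y : ((Fin p → ℝ) × ℝ) × ℝ =>
      ∑ i, y.1.1 i * splineBasis q y.1.2 i y.2 := by
    refine continuous_finsetSum _ fun i _ => ?_
    have := (continuous_splineBasis (q := q) i).comp
      (show Continuous fun y : ((Fin p → ℝ) × ℝ) × ℝ => (y.1.2, y.2) by fun_prop)
    exact Continuous.mul (by fun_prop) this
  have hη0 : 0 < η := hu.trans_le hη.1
  have hη1 : η < 1 := hη.2.trans_lt hv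
  by_cases hl : leftPoly q a = 0
  · have hj : jumpPoly q a η ≠ 0 := fun h => ha (by
      ext i
      by_cases hi : (i : ℕ) < q
      · exact eq_zero_of_leftPoly_eq_zero hl i hi
      · exact eq_zero_of_jumpPoly_eq_zero h i hi)
    obtain ⟨s, hs, hne⟩ := exists_eval_ne_zero_of_ne_zero hj hη1
    refine ⟨s, ⟨hη0.trans hs.1, hs.2⟩, ?_, hcont.continuousAt⟩
    rw [sum_splineBasis_eq, if_pos hs.1, hl]
    simpa using hne
  · obtain ⟨s, hs, hne⟩ := exists_eval_ne_zero_of_ne_zero hl hη0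
    refine ⟨s, ⟨hs.1, hs.2.trans hη1⟩, ?_, hcont.continuousAt⟩
    rw [sum_splineBasis_eq, if_neg (not_lt.2 hs.2.le)]
    simpa using hne

/-- A spline with knot away from the true knot is a single polynomial near the true knot, hence
stays away from the true regression function. -/
lemma exists_norm_meanShift_ge (hq : 1 ≤ q) (hqp : q < p) {θ : Param p} (hθ : θ ∈ paramSpace p)
    (hkink : coeffs θ ⟨q, hqp⟩ ≠ 0) {κ : ℝ} (hκ : 0 < κ) :
    ∃ c : ℝ, 0 < c ∧ ∃ N₀ : ℕ, ∀ N : ℕ, N₀ ≤ N → ∀ τ : Param p, κ ≤ |knot τ - knot θ| →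
      c * N ≤ ‖meanShift q θ τ N‖ ^ 2 := by
  classical
  have hη : knot θ ∈ Set.Ioo (0 : ℝ) 1 := hθ
  set η := knot θ with hηdef
  set Q := jumpPoly q (coeffs θ) η with hQ
  have hQ0 : Q ≠ 0 := fun h => hkink (eq_zero_of_jumpPoly_eq_zero h ⟨q, hqp⟩ (by simp))
  set l := max 0 (η - κ) with hl
  set u := min 1 (η + κ) with hu
  have hlη : l < η := max_lt hη.1 (by linarith)
  have hηu : η < u := lt_min hη.2 (by linarith)
  have hl0 : 0 ≤ l := le_max_left _ _
  have hu1 : u ≤ 1 := min_le_left _ _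
  -- In the window `(l, u)` the difference is a polynomial, with coefficients `v.1`, plus a
  -- multiple `v.2` of the true jump.
  set F : (Fin p → ℝ) × ℝ → Unit → ℝ → ℝ := fun v _ s =>
    if s ∈ Set.Ioo l u then (∑ i : Fin p, v.1 i * s ^ (i : ℕ)) +
      v.2 * (if η < s then Q.eval s else 0) else 0 with hF
  obtain ⟨c, hc, N₀, h⟩ := exists_grid_lower_bound_linear (E := (Fin p → ℝ) × ℝ) (X := Unit)
    isCompact_univ F
    (fun a v _ s => by
      simp only [hF]
      split_ifs
      · simp only [Prod.smul_fst, Prod.smul_snd, Pi.smul_apply, smul_eq_mul, mul_add,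
          Finset.mul_sum, mul_assoc]
      · simp [Finset.mul_sum, mul_assoc]
      · simp)
    (fun v x hv _ => by
      obtain ⟨a, z⟩ := v
      set R : ℝ[X] := ∑ i : Fin p, Polynomial.C (a i) * Polynomial.X ^ (i : ℕ) with hR
      have hRe : ∀ s, R.eval s = ∑ i : Fin p, a i * s ^ (i : ℕ) := fun s => by
        simp [hR, Polynomial.eval_finsetSum]
      by_cases hR0 : R = 0
      · have ha : a = 0 := by
          ext i
          have : R.coeff i = 0 := by rw [hR0]; simp
          rw [hR, Polynomial.finsetSum_coeff, Finset.sum_eq_single i] at this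
          · simpa using this
          · intro j _ hj
            have hj' : (i : ℕ) ≠ j := fun h => hj (Fin.ext h.symm)
            simp [Polynomial.coeff_X_pow, hj']
          · simp
        have hz : z ≠ 0 := fun hz => hv (by rw [ha, hz]; rfl)
        obtain ⟨s, hs, hne⟩ := exists_eval_ne_zero_of_ne_zero hQ0 hηu
        have hsm : s ∈ Set.Ioo l u := ⟨hlη.trans hs.1, hs.2⟩
        refine ⟨s, ⟨hl0.trans_lt hsm.1, hsm.2.trans_le hu1⟩, ?_, ?_⟩
        · simp only [hF]
          rw [if_pos hsm, if_pos hs.1, ha]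
          simpa using ⟨hz, hne⟩
        · refine ContinuousAt.congr (f := fun y : (((Fin p → ℝ) × ℝ) × Unit) × ℝ =>
            (∑ i : Fin p, y.1.1.1 i * y.2 ^ (i : ℕ)) + y.1.1.2 * Q.eval y.2) ?_ ?_
          · exact Continuous.continuousAt (by fun_prop)
          · filter_upwards [continuousAt_snd.eventually (Ioo_mem_nhds hs.1 hs.2)] with y hy
            simp only [hF]
            rw [if_pos ⟨hlη.trans hy.1, hy.2⟩, if_pos hy.1]
      · obtain ⟨s, hs, hne⟩ := exists_eval_ne_zero_of_ne_zero hR0 hlη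
        have hsm : s ∈ Set.Ioo l u := ⟨hs.1, hs.2.trans hηu⟩
        refine ⟨s, ⟨hl0.trans_lt hsm.1, hsm.2.trans_le hu1⟩, ?_, ?_⟩
        · simp only [hF]
          rw [if_pos hsm, if_neg (not_lt.2 hs.2.le), ← hRe]
          simpa using hne
        · refine ContinuousAt.congr (f := fun y : (((Fin p → ℝ) × ℝ) × Unit) × ℝ =>
            ∑ i : Fin p, y.1.1.1 i * y.2 ^ (i : ℕ)) ?_ ?_
          · exact Continuous.continuousAt (by fun_prop)
          · filter_upwards [continuousAt_snd.eventually (Ioo_mem_nhds hs.1 hs.2)] with y hy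
            simp only [hF]
            rw [if_pos ⟨hy.1, hy.2.trans hηu⟩, if_neg (not_lt.2 hy.2.le)]
            ring)
  -- The knot of `τ` lies on one side of `(l, u)`, and the polynomial `R` depends on the side.
  refine ⟨c, hc, N₀, fun N hN τ hτ => ?_⟩
  obtain ⟨R, hR, hRs⟩ : ∃ R ∈ Polynomial.degreeLT ℝ p, ∀ s ∈ Set.Ioo l u,
      splineMean q τ s - splineMean q θ s = R.eval s + -1 * (if η < s then Q.eval s else 0) := by
    rcases le_abs.1 hτ with h | h
    · refine ⟨leftPoly q (coeffs τ) - leftPoly q (coeffs θ), Submodule.sub_mem _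
        (leftPoly_mem_degreeLT _) (leftPoly_mem_degreeLT _), fun s hs => ?_⟩
      have : s < η + κ := hs.2.trans_le (min_le_right _ _)
      rw [splineMean_eq, splineMean_eq, if_neg (not_lt.2 (by linarith : s ≤ knot τ)),
        Polynomial.eval_sub]
      ring
    · refine ⟨leftPoly q (coeffs τ) - leftPoly q (coeffs θ) + jumpPoly q (coeffs τ) (knot τ),
        Submodule.add_mem _ (Submodule.sub_mem _
        (leftPoly_mem_degreeLT _) (leftPoly_mem_degreeLT _)) (jumpPoly_mem_degreeLT hq _ _),
        fun s hs => ?_⟩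
      have : η - κ < s := (le_max_right _ _).trans_lt hs.1
      rw [splineMean_eq, splineMean_eq, if_pos (by linarith : knot τ < s),
        Polynomial.eval_add, Polynomial.eval_sub]
      ring
  have hReval : ∀ s, R.eval s = ∑ i : Fin p, R.coeff i * s ^ (i : ℕ) := by
    intro s
    rw [Polynomial.eval_eq_sum_range' (n := p), Finset.sum_range]
    rcases eq_or_ne R 0 with rfl | h0
    · simp; omega
    · exact (Polynomial.natDegree_lt_iff_degree_lt h0).2 (Polynomial.mem_degreeLT.1 hR)
  have hv := h N hN ((fun i : Fin p => R.coeff i), -1) () trivial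
  have hnorm : (1 : ℝ) ≤ ‖((fun i : Fin p => R.coeff (i : ℕ)), (-1 : ℝ))‖ ^ 2 := by
    refine one_le_pow₀ ?_
    simp [Prod.norm_def]
  calc c * N ≤ c * N * ‖((fun i : Fin p => R.coeff (i : ℕ)), (-1 : ℝ))‖ ^ 2 :=
        le_mul_of_one_le_right (by positivity) hnorm
    _ ≤ _ := hv
    _ ≤ _ := by
      rw [EuclideanSpace.real_norm_sq_eq]
      refine Finset.sum_le_sum fun t _ => ?_
      simp only [hF, meanShift]
      split_ifs with hs hs'
      · rw [hRs _ hs, hReval, if_pos hs']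
      · rw [hRs _ hs, hReval, if_neg hs']
      · rw [zero_pow two_ne_zero]; exact sq_nonneg _

lemma abs_splineBasis_sub_le {x y s : ℝ} (hx : x ∈ Set.Ioo (0 : ℝ) 1)
    (hy : y ∈ Set.Ioo (0 : ℝ) 1) (hs1 : s ≤ 1) (i : Fin p) :
    |splineBasis q x i s - splineBasis q y i s| ≤ 3 ^ (p + 1) * |x - y| := by
  unfold splineBasis
  split_ifs
  · simp only [sub_self, abs_zero]; positivity
  · have h1 : |max (s - y) 0| ≤ 1 := by
      rw [abs_of_nonneg (le_max_right _ _)]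
      exact max_le (by linarith [hy.1]) zero_le_one
    have h2 : |max (s - y) 0 - max (s - x) 0| ≤ |x - y| := by
      refine (abs_max_sub_max_le_abs _ _ _).trans_eq ?_
      congr 1
      ring
    have h3 : |x - y| ≤ 1 := by
      rw [abs_le]; constructor <;> linarith [hx.1, hx.2, hy.1, hy.2]
    have := abs_sub_pow_sub_pow_le h1 (h2.trans h3) ((i : ℕ) - q + 1)
    rw [sub_sub_cancel] at this
    refine this.trans (mul_le_mul (pow_le_pow_right₀ (by norm_num) ?_) h2 (abs_nonneg _)
      (by positivity))
    have := i.isLt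
    omega

/-- Parameters whose regression vector is close to the true one are close to the true parameter.
First the knots are within `κ` of each other; then replacing one knot by the other costs little,
and the coefficients are compared for a common knot. -/
lemma exists_norm_sub_le_of_norm_meanShift_le (hq : 1 ≤ q) (hqp : q < p) {θ : Param p}
    (hθ : θ ∈ paramSpace p) (hkink : coeffs θ ⟨q, hqp⟩ ≠ 0) {ρ : ℝ} (hρ : 0 < ρ) :
    ∃ c : ℝ, 0 < c ∧ ∃ N₀ : ℕ, ∀ N : ℕ, N₀ ≤ N → ∀ τ ∈ paramSpace p,
      ‖meanShift q θ τ N‖ ^ 2 ≤ c * N → ‖τ - θ‖ ≤ ρ := by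
  have hη : knot θ ∈ Set.Ioo (0 : ℝ) 1 := hθ
  obtain ⟨c₂, hc₂, N₂, h₂⟩ := exists_norm_spline_ge (p := p) (q := q)
    (show 0 < knot θ / 2 by linarith [hη.1]) (show (1 + knot θ) / 2 < 1 by linarith [hη.2])
  set A := 3 ^ (p + 1) * ∑ i, |coeffs θ i| with hA
  have hA0 : 0 ≤ A := by positivity
  have hρ' : 0 < ρ / (2 * (p + 1)) := by positivity
  set g := ρ / (2 * (p + 1)) with hg
  -- `κ` is so small that moving the knot by `κ` changes the fit by little.
  obtain ⟨κ, hκ, hκ1, hκ2, hκ3, hκ4⟩ : ∃ κ : ℝ, 0 < κ ∧ κ ≤ knot θ / 2 ∧ κ ≤ (1 - knot θ) / 2 ∧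
      κ ≤ ρ / 2 ∧ 2 * (A * κ) ^ 2 ≤ c₂ * g ^ 2 / 2 := by
    have hlim : Tendsto (fun κ : ℝ => 2 * (A * κ) ^ 2) (𝓝[>] 0) (𝓝 0) := by
      have : Continuous fun κ : ℝ => 2 * (A * κ) ^ 2 := by fun_prop
      simpa using (this.tendsto 0).mono_left nhdsWithin_le_nhds
    have hpos : 0 < c₂ * g ^ 2 / 2 := by positivity
    have h1 : ∀ x : ℝ, 0 < x → ∀ᶠ κ : ℝ in 𝓝[>] 0, κ ≤ x := fun x hx =>
      nhdsWithin_le_nhds (eventually_le_nhds hx)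
    have hall := (hlim.eventually (gt_mem_nhds hpos)).and
      ((h1 (knot θ / 2) (by linarith [hη.1])).and ((h1 ((1 - knot θ) / 2) (by linarith [hη.2])).and
      ((h1 (ρ / 2) (by linarith)).and (self_mem_nhdsWithin : Set.Ioi (0 : ℝ) ∈ 𝓝[>] 0))))
    obtain ⟨κ, a, b, c, d, e⟩ := hall.exists
    exact ⟨κ, e, b, c, d, a.le⟩
  obtain ⟨c₁, hc₁, N₁, h₁⟩ := exists_norm_meanShift_ge hq hqp hθ hkink hκ
  refine ⟨min (c₁ / 2) (c₂ * g ^ 2 / 4), by positivity, max (max N₁ N₂) 1,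
    fun N hN τ hτ hle => ?_⟩
  have hτ' : knot τ ∈ Set.Ioo (0 : ℝ) 1 := hτ
  have hN1 : N₁ ≤ N := (le_max_left _ _).trans ((le_max_left _ _).trans hN)
  have hN2 : N₂ ≤ N := (le_max_right _ _).trans ((le_max_left _ _).trans hN)
  have hN0 : (0 : ℝ) < N := by exact_mod_cast (le_max_right _ _).trans hN
  have hclose : |knot τ - knot θ| < κ := by
    by_contra! h
    have h3 := h₁ N hN1 τ h
    have h4 := mul_le_mul_of_nonneg_right (min_le_left (c₁ / 2) (c₂ * g ^ 2 / 4)) hN0.le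
    nlinarith
  have hcl := abs_lt.1 hclose
  have h3 := h₂ N hN2 (coeffs τ - coeffs θ) (knot τ) ⟨by linarith, by linarith⟩
  have h4 : ∑ t : Fin N, (∑ i, (coeffs τ - coeffs θ) i *
      splineBasis q (knot τ) i (designPoint N t)) ^ 2 ≤
      2 * ‖meanShift q θ τ N‖ ^ 2 + N * (2 * (A * κ) ^ 2) := by
    rw [EuclideanSpace.real_norm_sq_eq, Finset.mul_sum]
    have : (N : ℝ) * (2 * (A * κ) ^ 2) = ∑ _t : Fin N, 2 * (A * κ) ^ 2 := by simp
    rw [this, ← Finset.sum_add_distrib]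
    refine Finset.sum_le_sum fun t _ => ?_
    set s := designPoint N t with hs
    have hsplit : ∑ i, (coeffs τ - coeffs θ) i * splineBasis q (knot τ) i s =
        (splineMean q τ s - splineMean q θ s) -
        ∑ i, coeffs θ i * (splineBasis q (knot τ) i s - splineBasis q (knot θ) i s) := by
      change _ = (∑ i, coeffs τ i * splineBasis q (knot τ) i s -
        ∑ i, coeffs θ i * splineBasis q (knot θ) i s) - _
      rw [← Finset.sum_sub_distrib, ← Finset.sum_sub_distrib]
      refine Finset.sum_congr rfl fun i _ => ?_
      rw [Pi.sub_apply]
      ring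
    have hsmall : |∑ i, coeffs θ i * (splineBasis q (knot τ) i s - splineBasis q (knot θ) i s)| ≤
        A * κ := by
      refine (Finset.abs_sum_le_sum_abs _ _).trans ?_
      rw [hA, mul_right_comm, Finset.mul_sum]
      refine Finset.sum_le_sum fun i _ => ?_
      rw [abs_mul, mul_comm]
      refine mul_le_mul_of_nonneg_right ?_ (abs_nonneg _)
      exact (abs_splineBasis_sub_le hτ' hη (designPoint_le_one t) i).trans
        (mul_le_mul_of_nonneg_left hclose.le (by positivity))
    have hsq := sq_le_sq' (abs_le.1 hsmall).1 (abs_le.1 hsmall).2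
    rw [hsplit]
    change _ ≤ 2 * (splineMean q τ s - splineMean q θ s) ^ 2 + _
    nlinarith [sq_nonneg ((splineMean q τ s - splineMean q θ s) +
      ∑ i, coeffs θ i * (splineBasis q (knot τ) i s - splineBasis q (knot θ) i s))]
  have h5 : ‖meanShift q θ τ N‖ ^ 2 ≤ c₂ * g ^ 2 / 4 * N :=
    hle.trans (mul_le_mul_of_nonneg_right (min_le_right _ _) hN0.le)
  have h6 : c₂ * N * ‖coeffs τ - coeffs θ‖ ^ 2 ≤ c₂ * N * g ^ 2 := by
    have h7 := mul_le_mul_of_nonneg_left hκ4 hN0.le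
    nlinarith
  have h7 : ‖coeffs τ - coeffs θ‖ ≤ g :=
    le_of_sq_le_sq (le_of_mul_le_mul_left h6 (by positivity)) hρ'.le
  calc ‖τ - θ‖ ≤ ‖coeffs (τ - θ)‖ * p + |knot (τ - θ)| := norm_le_sum_abs_coeffs_add _
    _ ≤ g * (p + 1) + ρ / 2 := by
      refine add_le_add (mul_le_mul h7 (by linarith) p.cast_nonneg hρ'.le) ?_
      exact hclose.le.trans hκ3
    _ = ρ := by rw [hg]; field_simp; ring

end Vectors

/-! ### Bounds on the noise -/

/-- The noise vector `e` has inner product at most `B ‖u‖` with every piecewise polynomial `u`,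
of degree less than `D`, that is broken at the fixed point `x`. -/
def OneKnotBound (D : ℕ) (x : ℝ) {N : ℕ} (e : EuclideanSpace ℝ (Fin N)) (B : ℝ) : Prop :=
  ∀ f ∈ Polynomial.degreeLT ℝ D, ∀ g ∈ Polynomial.degreeLT ℝ D,
    |⟪e, evalOn N Set.univ f + evalOn N (above N x) g⟫| ≤
      B * ‖evalOn N Set.univ f + evalOn N (above N x) g‖

/-- The noise vector `e` has inner product at most `B ‖u‖` with every piecewise polynomial `u`,
of degree less than `D`, that is broken at the fixed point `x` and at one arbitrary point of
`(0, 1)`. -/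
def TwoKnotBound (D : ℕ) (x : ℝ) {N : ℕ} (e : EuclideanSpace ℝ (Fin N)) (B : ℝ) : Prop :=
  ∀ y ∈ Set.Ioo (0 : ℝ) 1, ∀ f ∈ Polynomial.degreeLT ℝ D, ∀ g ∈ Polynomial.degreeLT ℝ D,
    ∀ h ∈ Polynomial.degreeLT ℝ D,
    |⟪e, evalOn N Set.univ f + evalOn N (above N x) g + evalOn N (above N y) h⟫| ≤
      B * ‖evalOn N Set.univ f + evalOn N (above N x) g + evalOn N (above N y) h‖

/-- The inner products of the noise vector `e` with bounded polynomials on windows between `x`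
and another point `y` are small relative to the number of design points in the window, up to an
additive constant `n₀`. -/
def WindowBound (D : ℕ) (x : ℝ) {N : ℕ} (e : EuclideanSpace ℝ (Fin N)) (ε n₀ : ℝ) : Prop :=
  ∀ y ∈ Set.Ioo (0 : ℝ) 1, ∀ f ∈ Polynomial.degreeLT ℝ D, ∀ U : ℝ, 0 ≤ U →
    (∀ t ∈ window N x y, |f.eval (designPoint N t)| ≤ U) →
    |⟪e, evalOn N (window N x y) f⟫| ≤ ε * U * (N * |y - x| + n₀)

section Core

variable {p q : ℕ}

/-! ### The linear term -/

lemma inner_gradVec (θ v : Param p) {N : ℕ} (w : EuclideanSpace ℝ (Fin N)) :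
    ⟪gradVec q θ v N, w⟫ = v ⬝ᵥ ((gradMatrix q θ N)ᵀ *ᵥ w) := by
  rw [EuclideanSpace.inner_eq_star_dotProduct, gradVec, star_trivial, dotProduct_comm,
    Matrix.dotProduct_mulVec, Matrix.vecMul_transpose]

/-- The normal equations. Injectivity of the gradient makes `Mᵀ M` invertible, so that the matrix
inverse in `linearTerm` is a true inverse. -/
lemma inner_gradVec_sub_linearTerm (θ : Param p) {N : ℕ} (e : EuclideanSpace ℝ (Fin N))
    (hinj : ∀ v : Param p, gradVec q θ v N = 0 → v = 0) (v : Param p) :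
    ⟪gradVec q θ v N, e - gradVec q θ (linearTerm q θ e) N⟫ = 0 := by
  have hunit : IsUnit ((gradMatrix q θ N)ᵀ * gradMatrix q θ N) := by
    rw [← Matrix.mulVec_injective_iff_isUnit]
    refine (injective_iff_map_eq_zero
      (Matrix.mulVecLin ((gradMatrix q θ N)ᵀ * gradMatrix q θ N))).2 fun v hv => ?_
    have h0 : ⟪gradVec q θ (WithLp.toLp 2 v) N, gradVec q θ (WithLp.toLp 2 v) N⟫ = 0 := by
      rw [inner_gradVec]
      simp only [gradVec, Matrix.mulVec_mulVec]
      rw [Matrix.mulVecLin_apply] at hv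
      rw [hv, dotProduct_zero]
    have := hinj _ (inner_self_eq_zero.1 h0)
    simpa using congrArg WithLp.ofLp this
  rw [inner_gradVec]
  have : (gradMatrix q θ N)ᵀ *ᵥ (e - gradVec q θ (linearTerm q θ e) N).ofLp = 0 := by
    simp only [gradVec, linearTerm, WithLp.ofLp_sub, Matrix.mulVec_sub, Matrix.mulVec_mulVec]
    rw [← Matrix.mul_assoc, ← Matrix.mul_assoc, Matrix.mul_nonsing_inv _
      ((Matrix.isUnit_iff_isUnit_det _).1 hunit), Matrix.one_mul, sub_self]
  rw [this, dotProduct_zero]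

/-! ### Size of the linearization error -/

/-- Bounds on both parts of the linearization error. -/
lemma exists_remainder_bound {θ : Param p} (hθ : θ ∈ paramSpace p) :
    ∃ ρ : ℝ, 0 < ρ ∧ ∃ C : ℝ, 1 ≤ C ∧ ∀ δ : Param p, ‖δ‖ ≤ ρ →
      θ + δ ∈ paramSpace p ∧ ∀ N : ℕ,
        ‖evalOn N (above N (knot θ)) (jumpRemainder q θ δ)‖ ≤ √N * (C * ‖δ‖ ^ 2) ∧
        ‖windowError q θ δ N‖ ^ 2 ≤ (N * ‖δ‖ + 1) * (C * ‖δ‖) ^ 2 ∧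
        ∀ t ∈ window N (knot θ) (knot (θ + δ)),
          |(jumpPoly q (coeffs (θ + δ)) (knot (θ + δ))).eval (designPoint N t)| ≤ C * ‖δ‖ := by
  have hη : knot θ ∈ Set.Ioo (0 : ℝ) 1 := hθ
  set A := ∑ i, |coeffs θ i| with hA
  have hA0 : 0 ≤ A := by positivity
  have h3 : (1 : ℝ) ≤ 3 ^ (p + 1) := one_le_pow₀ (by norm_num)
  refine ⟨min (knot θ / 2) ((1 - knot θ) / 2), lt_min (by linarith [hη.1]) (by linarith [hη.2]),
    3 ^ (p + 1) * (A + p) + 1, le_add_of_nonneg_left (by positivity), fun δ hδ => ?_⟩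
  set C := 3 ^ (p + 1) * (A + p) + 1 with hC
  have hAC : A + p ≤ C := by
    have := mul_le_mul_of_nonneg_right h3 (show 0 ≤ A + p by positivity)
    linarith
  have hC0 : 0 ≤ C := by positivity
  have hkδ := abs_knot_le δ
  have hk : knot (θ + δ) = knot θ + knot δ := rfl
  have hδ1 : ‖δ‖ ≤ knot θ / 2 := hδ.trans (min_le_left _ _)
  have hδ2 : ‖δ‖ ≤ (1 - knot θ) / 2 := hδ.trans (min_le_right _ _)
  have hab := abs_le.1 hkδ
  have hη' : knot (θ + δ) ∈ Set.Ioo (0 : ℝ) 1 := by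
    rw [hk]; constructor <;> linarith [hη.1, hη.2]
  have hδ1' : ‖δ‖ ≤ 1 := by linarith [hη.2]
  refine ⟨hη', fun N => ?_⟩
  have hwin : ∀ t ∈ window N (knot θ) (knot (θ + δ)),
      |(jumpPoly q (coeffs (θ + δ)) (knot (θ + δ))).eval (designPoint N t)| ≤ C * ‖δ‖ := by
    intro t ht
    have ht' : |designPoint N t - knot (θ + δ)| ≤ ‖δ‖ := by
      have h1 := Set.abs_sub_right_of_mem_uIcc (Set.uIoc_subset_uIcc ht)
      rw [abs_sub_comm] at h1
      refine h1.trans ?_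
      rw [hk, add_sub_cancel_left]
      exact hkδ
    refine (abs_eval_jumpPoly_le _ (ht'.trans hδ1')).trans
      (mul_le_mul ?_ ht' (abs_nonneg _) hC0)
    refine le_trans ?_ hAC
    calc ∑ i, |coeffs (θ + δ) i| ≤ ∑ i, (|coeffs θ i| + 1) :=
          Finset.sum_le_sum fun i _ => (abs_add_le _ _).trans
            (add_le_add le_rfl ((abs_coeffs_le δ i).trans hδ1'))
      _ = A + p := by rw [Finset.sum_add_distrib]; simp [hA]
  refine ⟨norm_le_sqrt_mul _ (by positivity) fun t => ?_, ?_, hwin⟩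
  · rw [evalOn_above_apply]
    split_ifs
    · refine (abs_eval_jumpPoly_remainder_le θ δ ?_ (hkδ.trans hδ1')).trans
        (mul_le_mul_of_nonneg_right (by rw [hC]; linarith) (sq_nonneg _))
      have h0 := designPoint_pos t
      have h1 := designPoint_le_one t
      rw [abs_le]
      constructor <;> linarith [hη.1, hη.2]
    · rw [abs_zero]; positivity
  · have hn : ‖windowError q θ δ N‖ = ‖evalOn N (window N (knot θ) (knot (θ + δ)))
        (jumpPoly q (coeffs (θ + δ)) (knot (θ + δ)))‖ := by
      rcases evalOn_above_sub N (knot θ) (knot (θ + δ))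
        (jumpPoly q (coeffs (θ + δ)) (knot (θ + δ))) with h | h
      · rw [windowError, h]
      · rw [windowError, h, norm_neg]
    rw [hn]
    refine (norm_sq_evalOn_window_le hη.1.le hη'.1.le _ hwin).trans
      (mul_le_mul_of_nonneg_right ?_ (sq_nonneg _))
    rw [hk, add_sub_cancel_left]
    gcongr

lemma abs_inner_windowError_le (hq : 1 ≤ q) {θ δ : Param p} {N : ℕ}
    {e : EuclideanSpace ℝ (Fin N)} {ε n₀ C : ℝ} (hε : 0 ≤ ε) (hC : 0 ≤ C)
    (hw : WindowBound p (knot θ) e ε n₀) (hmem : θ + δ ∈ paramSpace p)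
    (hU : ∀ t ∈ window N (knot θ) (knot (θ + δ)),
      |(jumpPoly q (coeffs (θ + δ)) (knot (θ + δ))).eval (designPoint N t)| ≤ C * ‖δ‖) :
    |⟪e, windowError q θ δ N⟫| ≤ ε * (C * ‖δ‖) * (N * ‖δ‖ + n₀) := by
  have hn : |⟪e, windowError q θ δ N⟫| = |⟪e, evalOn N (window N (knot θ) (knot (θ + δ)))
        (jumpPoly q (coeffs (θ + δ)) (knot (θ + δ)))⟫| := by
    rcases evalOn_above_sub N (knot θ) (knot (θ + δ))
      (jumpPoly q (coeffs (θ + δ)) (knot (θ + δ))) with h | h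
    · rw [windowError, h]
    · rw [windowError, h, inner_neg_right, abs_neg]
  rw [hn]
  refine (hw _ hmem _ (jumpPoly_mem_degreeLT hq _ _) _ (by positivity) hU).trans
    (mul_le_mul_of_nonneg_left ?_ (by positivity))
  have : |knot (θ + δ) - knot θ| ≤ ‖δ‖ := by
    rw [show knot (θ + δ) = knot θ + knot δ from rfl, add_sub_cancel_left]
    exact abs_knot_le δ
  exact add_le_add (mul_le_mul_of_nonneg_left this N.cast_nonneg) le_rfl

lemma gradVec_add_remainder_eq (θ δ : Param p) (N : ℕ) :
    gradVec q θ δ N + evalOn N (above N (knot θ)) (jumpRemainder q θ δ) =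
      evalOn N Set.univ (leftPoly q (coeffs δ)) +
      evalOn N (above N (knot θ)) (tangentPoly q θ δ + jumpRemainder q θ δ) := by
  rw [gradVec_eq, map_add, add_assoc]

lemma jumpRemainder_mem_degreeLT (hq : 1 ≤ q) (θ δ : Param p) :
    jumpRemainder q θ δ ∈ Polynomial.degreeLT ℝ p :=
  Submodule.sub_mem _ (Submodule.sub_mem _ (jumpPoly_mem_degreeLT hq _ _)
    (jumpPoly_mem_degreeLT hq _ _)) (tangentPoly_mem_degreeLT hq _ _)

/-! ### Comparison of the criterion at two parameters -/

lemma norm_sq_le_of_norm_sub_sq_le {E : Type*} [NormedAddCommGroup E] [InnerProductSpace ℝ E]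
    {e v : E} (h : ‖e - v‖ ^ 2 ≤ ‖e‖ ^ 2) : ‖v‖ ^ 2 ≤ 2 * ⟪e, v⟫ := by
  rw [norm_sub_sq_real] at h
  linarith

/-- If `v` fits `e` at least as well as `w` does, where `v = a + x` and `w = b + y` with
`e - b` orthogonal to `a` and `b`, then `a` is close to `b` up to the errors `x` and `y`. -/
lemma norm_sub_sq_le_of_fit_le {E : Type*} [NormedAddCommGroup E] [InnerProductSpace ℝ E]
    {e a b x y : E} (ha : ⟪a, e - b⟫ = 0) (hb : ⟪b, e - b⟫ = 0)
    (h : ‖e - (a + x)‖ ^ 2 ≤ ‖e - (b + y)‖ ^ 2) :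
    ‖b - a - x‖ ^ 2 ≤ ‖y‖ ^ 2 + 2 * ⟪e - b, x⟫ - 2 * ⟪e - b, y⟫ := by
  have h1 : e - (a + x) = (e - b) + (b - a - x) := by abel
  have h2 : e - (b + y) = (e - b) - y := by abel
  rw [h1, h2, norm_add_sq_real, norm_sub_sq_real (e - b) y, inner_sub_right, inner_sub_right,
    real_inner_comm b (e - b), real_inner_comm a (e - b), ha, hb] at h
  linarith

lemma continuous_lsCriterion {N : ℕ} (Y : Fin N → ℝ) :
    Continuous fun τ : Param p => lsCriterion q Y τ := by
  unfold lsCriterion splineMean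
  refine continuous_finsetSum _ fun t _ => Continuous.pow (Continuous.sub continuous_const
    (continuous_finsetSum _ fun i _ => Continuous.mul (by fun_prop) ?_)) 2
  exact (continuous_splineBasis (q := q) i).comp
    (show Continuous fun τ : Param p => (τ (Fin.last p), designPoint N t) by fun_prop)

/-- The preliminary rate of convergence: `D` is the norm of the shift of the regression vector,
`u` that of the shift of the parameter, `W` that of the window error, and `s` stands for `√N`. -/
lemma rate_of_quadratic_bound {D W u s r K ε C c : ℝ} (hc : 0 < c) (hs : 0 < s) (hr : 0 < r)
    (hK : 0 ≤ K) (hu : 0 ≤ u) (hD : c / 2 * (s * u) ≤ D)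
    (hW : W ≤ c / 4 * (s * u)) (hsmall : 16 * ε * C ≤ c ^ 2)
    (h : D ^ 2 ≤ 2 * (K * s / r * (D + W) + ε * (C * u) * (s ^ 2 * u + s ^ 2 / r))) :
    u ≤ (12 * K / c + 1) / r := by
  have hsu : 0 ≤ s * u := by positivity
  rcases eq_or_lt_of_le hu with h0 | hupos
  · rw [← h0]; positivity
  have hDpos : 0 < D := lt_of_lt_of_le (by positivity) hD
  set x := s * u with hx
  have hxD : x ≤ 2 / c * D := by
    rw [div_mul_eq_mul_div, le_div_iff₀ hc]; linarith
  have hσ : 0 ≤ s / r := by positivity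
  have h1 : K * s / r * (D + W) ≤ K * (s / r) * (3 / 2 * D) := by
    rw [mul_div_assoc]
    exact mul_le_mul_of_nonneg_left (by linarith) (by positivity)
  have h2 : ε * (C * u) * (s ^ 2 * u + s ^ 2 / r) = ε * C * (x * (x + s / r)) := by
    rw [hx]; field_simp
  have h3 : ε * C * (x * (x + s / r)) ≤ c ^ 2 / 16 * ((2 / c * D) * (2 / c * D + s / r)) := by
    refine mul_le_mul (by linarith) ?_ (by positivity) (by positivity)
    exact mul_le_mul hxD (by linarith) (by positivity) (by positivity)
  have h4 : c ^ 2 / 16 * ((2 / c * D) * (2 / c * D + s / r)) = D * (D / 4 + c / 8 * (s / r)) := by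
    field_simp
    ring
  have h5 : D * D ≤ D * (3 * K * (s / r) + D / 2 + c / 4 * (s / r)) := by
    rw [h2] at h
    nlinarith
  have h6 := le_of_mul_le_mul_left h5 hDpos
  have h7 : c / 2 * x ≤ (6 * K + c / 2) * (s / r) := by linarith
  have h8 : u ≤ (2 / c) * ((6 * K + c / 2) * (1 / r)) := by
    have : c / 2 * u * s ≤ (6 * K + c / 2) * (1 / r) * s := by
      rw [hx] at h7
      calc _ = c / 2 * (s * u) := by ring
        _ ≤ _ := h7
        _ = _ := by ring
    have := le_of_mul_le_mul_right this hs
    rw [div_mul_eq_mul_div, le_div_iff₀ hc]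
    linarith
  refine h8.trans_eq ?_
  field_simp
  ring

/-- Constants governing the linearization near the true parameter: `ρ` is the radius of the
neighbourhood, `C` bounds the errors and `c` is the lower bound for the gradient. -/
lemma exists_local_bounds (hqp : q < p) {θ : Param p} (hθ : θ ∈ paramSpace p)
    (hkink : coeffs θ ⟨q, hqp⟩ ≠ 0) :
    ∃ ρ : ℝ, 0 < ρ ∧ ∃ C : ℝ, 1 ≤ C ∧ ∃ c : ℝ, 0 < c ∧ ∃ N₀ : ℕ, 1 ≤ N₀ ∧ ∀ N : ℕ, N₀ ≤ N →
      (∀ v : Param p, c * (√N * ‖v‖) ≤ ‖gradVec q θ v N‖) ∧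
      ∀ δ : Param p, ‖δ‖ ≤ ρ → θ + δ ∈ paramSpace p ∧
        ‖evalOn N (above N (knot θ)) (jumpRemainder q θ δ)‖ ≤ √N * (C * ‖δ‖ ^ 2) ∧
        ‖windowError q θ δ N‖ ^ 2 ≤ (N * ‖δ‖ + 1) * (C * ‖δ‖) ^ 2 ∧
        (∀ t ∈ window N (knot θ) (knot (θ + δ)),
          |(jumpPoly q (coeffs (θ + δ)) (knot (θ + δ))).eval (designPoint N t)| ≤ C * ‖δ‖) ∧
        ‖windowError q θ δ N‖ ≤ c / 4 * (√N * ‖δ‖) ∧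
        c / 2 * (√N * ‖δ‖) ≤ ‖meanShift q θ (θ + δ) N‖ := by
  obtain ⟨c₀, hc₀, N₀, hgrad⟩ := exists_norm_gradVec_ge hqp hθ hkink
  obtain ⟨ρ, hρ, C, hC, hrem⟩ := exists_remainder_bound (q := q) hθ
  have hC0 : 0 < C := by linarith
  set c := √c₀ with hcdef
  have hc : 0 < c := Real.sqrt_pos.2 hc₀
  have hc2 : c ^ 2 = c₀ := Real.sq_sqrt hc₀.le
  -- For `‖δ‖ ≤ c / (4 C)` the smooth remainder is at most a quarter of the lower bound for the
  -- gradient, and for `‖δ‖ ≤ c² / (32 C²)` and `N ≥ 32 C² / c²` so is the window error.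
  refine ⟨min ρ (min (c / (4 * C)) (c ^ 2 / (32 * C ^ 2))), by positivity, C, hC, c, hc,
    max (max N₀ 1) ⌈32 * C ^ 2 / c ^ 2⌉₊, (le_max_right _ _).trans (le_max_left _ _),
    fun N hN => ?_⟩
  have hN1 : N₀ ≤ N := (le_max_left _ _).trans ((le_max_left _ _).trans hN)
  have hNpos : (0 : ℝ) < N := by
    exact_mod_cast (le_max_right N₀ 1).trans ((le_max_left _ _).trans hN)
  have hN2 : 32 * C ^ 2 / c ^ 2 ≤ N := (Nat.le_ceil _).trans
    (by exact_mod_cast (le_max_right _ _).trans hN)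
  rw [div_le_iff₀ (by positivity)] at hN2
  have hsq : √(N : ℝ) ^ 2 = N := Real.sq_sqrt hNpos.le
  have hg : ∀ v : Param p, c * (√N * ‖v‖) ≤ ‖gradVec q θ v N‖ := fun v => by
    refine le_of_sq_le_sq ?_ (norm_nonneg _)
    have := hgrad N hN1 v
    calc _ = c ^ 2 * √(N : ℝ) ^ 2 * ‖v‖ ^ 2 := by ring
      _ = c₀ * N * ‖v‖ ^ 2 := by rw [hsq, hc2]
      _ ≤ _ := this
  refine ⟨hg, fun δ hδ => ?_⟩
  obtain ⟨hmem, hb⟩ := hrem δ (hδ.trans (min_le_left _ _))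
  obtain ⟨hb1, hb2, hb3⟩ := hb N
  have hδ1 : ‖δ‖ ≤ c / (4 * C) := hδ.trans ((min_le_right _ _).trans (min_le_left _ _))
  have hδ2 : ‖δ‖ ≤ c ^ 2 / (32 * C ^ 2) := hδ.trans ((min_le_right _ _).trans (min_le_right _ _))
  rw [le_div_iff₀ (by positivity)] at hδ1 hδ2
  have hW : ‖windowError q θ δ N‖ ≤ c / 4 * (√N * ‖δ‖) := by
    refine le_of_sq_le_sq (hb2.trans ?_) (by positivity)
    have h1 : (N * ‖δ‖ + 1) * C ^ 2 ≤ N * (c ^ 2 / 16) := by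
      have := mul_le_mul_of_nonneg_left hδ2 hNpos.le
      nlinarith
    calc _ = (N * ‖δ‖ + 1) * C ^ 2 * ‖δ‖ ^ 2 := by ring
      _ ≤ N * (c ^ 2 / 16) * ‖δ‖ ^ 2 := mul_le_mul_of_nonneg_right h1 (sq_nonneg _)
      _ = (c / 4) ^ 2 * √(N : ℝ) ^ 2 * ‖δ‖ ^ 2 := by rw [hsq]; ring
      _ = _ := by ring
  refine ⟨hmem, hb1, hb2, hb3, hW, ?_⟩
  have h2 : ‖evalOn N (above N (knot θ)) (jumpRemainder q θ δ)‖ ≤ c / 4 * (√N * ‖δ‖) := by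
    refine hb1.trans ?_
    have : √N * ‖δ‖ * (C * ‖δ‖) ≤ √N * ‖δ‖ * (c / 4) :=
      mul_le_mul_of_nonneg_left (by linarith) (by positivity)
    calc _ = √N * ‖δ‖ * (C * ‖δ‖) := by ring
      _ ≤ _ := this
      _ = _ := by ring
  rw [meanShift_add_eq]
  set x := gradVec q θ δ N
  set y := evalOn N (above N (knot θ)) (jumpRemainder q θ δ)
  set z := windowError q θ δ N
  have h3 : ‖x‖ ≤ ‖x + (y + z)‖ + (‖y‖ + ‖z‖) := by
    have h4 : x = (x + (y + z)) - (y + z) := by abel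
    calc ‖x‖ = ‖(x + (y + z)) - (y + z)‖ := congrArg _ h4
      _ ≤ ‖x + (y + z)‖ + ‖y + z‖ := norm_sub_le _ _
      _ ≤ _ := by gcongr; exact norm_add_le _ _
  linarith [hg δ]

end Core

/-! ### Linearization of least squares estimates -/

section Expansion

variable {p q : ℕ}

/-- Near the true parameter, at distance of order `1 / r`, the linearization error is negligible
with respect to `√N / r`, and so is its inner product with the noise. -/
lemma remainder_small (hq : 1 ≤ q) {θ δ : Param p} {N : ℕ} {e : EuclideanSpace ℝ (Fin N)}
    {r K K₂ C ε ω : ℝ} (hr : 0 < r) (hrN : r ≤ N) (hK : 0 ≤ K) (hK₂ : 0 ≤ K₂)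
    (hC : 1 ≤ C) (hε : 0 ≤ ε) (hω : 0 ≤ ω)
    (h₁ : OneKnotBound p (knot θ) e (K * (√N / r)))
    (hw : WindowBound p (knot θ) e ε (N / r))
    (hmem : θ + δ ∈ paramSpace p)
    (hb1 : ‖evalOn N (above N (knot θ)) (jumpRemainder q θ δ)‖ ≤ √N * (C * ‖δ‖ ^ 2))
    (hb2 : ‖windowError q θ δ N‖ ^ 2 ≤ (N * ‖δ‖ + 1) * (C * ‖δ‖) ^ 2)
    (hb3 : ∀ t ∈ window N (knot θ) (knot (θ + δ)),
      |(jumpPoly q (coeffs (θ + δ)) (knot (θ + δ))).eval (designPoint N t)| ≤ C * ‖δ‖)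
    (hδ : ‖δ‖ ≤ K₂ / r) (hr1 : C * K₂ ^ 2 / r ≤ ω / 2)
    (hr2 : C ^ 2 * K₂ ^ 2 * (K₂ + 1) / r ≤ (ω / 2) ^ 2) (hεω : ε * (C * K₂ * (K₂ + 1)) ≤ ω) :
    ‖evalOn N (above N (knot θ)) (jumpRemainder q θ δ) + windowError q θ δ N‖ ≤ ω * (√N / r) ∧
    |⟪e, evalOn N (above N (knot θ)) (jumpRemainder q θ δ) + windowError q θ δ N⟫| ≤
      (K + 1) * ω * (√N / r) ^ 2 := by
  have hN : (0 : ℝ) < N := hr.trans_le hrN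
  set σ := √N / r with hσ
  have hσ0 : 0 ≤ σ := by positivity
  have hσ2 : σ ^ 2 = N / r ^ 2 := by rw [hσ, div_pow, Real.sq_sqrt hN.le]
  have hδ2 : ‖δ‖ ^ 2 ≤ (K₂ / r) ^ 2 := pow_le_pow_left₀ (norm_nonneg _) hδ 2
  have hC0 : 0 ≤ C := by linarith
  have hs : ‖evalOn N (above N (knot θ)) (jumpRemainder q θ δ)‖ ≤ ω / 2 * σ := by
    calc _ ≤ √N * (C * ‖δ‖ ^ 2) := hb1
      _ ≤ √N * (C * (K₂ / r) ^ 2) := by gcongr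
      _ = C * K₂ ^ 2 / r * σ := by rw [hσ]; field_simp
      _ ≤ _ := mul_le_mul_of_nonneg_right hr1 hσ0
  have hW : ‖windowError q θ δ N‖ ≤ ω / 2 * σ := by
    refine le_of_sq_le_sq (hb2.trans ?_) (by positivity)
    have h1 : (N : ℝ) * ‖δ‖ + 1 ≤ N / r * (K₂ + 1) := by
      have h2 : (N : ℝ) * ‖δ‖ ≤ N * (K₂ / r) := mul_le_mul_of_nonneg_left hδ hN.le
      have h3 : 1 ≤ (N : ℝ) / r := (one_le_div hr).2 hrN
      calc (N : ℝ) * ‖δ‖ + 1 ≤ N * (K₂ / r) + N / r := add_le_add h2 h3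
        _ = _ := by ring
    calc (N * ‖δ‖ + 1) * (C * ‖δ‖) ^ 2 = (N * ‖δ‖ + 1) * (C ^ 2 * ‖δ‖ ^ 2) := by ring
      _ ≤ (N / r * (K₂ + 1)) * (C ^ 2 * (K₂ / r) ^ 2) := by gcongr
      _ = C ^ 2 * K₂ ^ 2 * (K₂ + 1) / r * σ ^ 2 := by rw [hσ2]; field_simp
      _ ≤ (ω / 2) ^ 2 * σ ^ 2 := mul_le_mul_of_nonneg_right hr2 (sq_nonneg _)
      _ = _ := by ring
  refine ⟨(norm_add_le _ _).trans (by linarith), ?_⟩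
  rw [inner_add_right]
  have h2 : |⟪e, evalOn N (above N (knot θ)) (jumpRemainder q θ δ)⟫| ≤ K * ω * σ ^ 2 := by
    have := h₁ 0 (Submodule.zero_mem _) _ (jumpRemainder_mem_degreeLT hq θ δ)
    rw [map_zero, zero_add] at this
    refine this.trans ((mul_le_mul_of_nonneg_left hs (by positivity)).trans ?_)
    have : 0 ≤ K * ω * σ ^ 2 := by positivity
    nlinarith
  have h3 : |⟪e, windowError q θ δ N⟫| ≤ ω * σ ^ 2 := by
    calc _ ≤ ε * (C * ‖δ‖) * (N * ‖δ‖ + N / r) :=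
          abs_inner_windowError_le hq hε hC0 hw hmem hb3
      _ ≤ ε * (C * (K₂ / r)) * (N * (K₂ / r) + N / r) := by gcongr
      _ = ε * (C * K₂ * (K₂ + 1)) * σ ^ 2 := by rw [hσ2]; field_simp
      _ ≤ _ := mul_le_mul_of_nonneg_right hεω (sq_nonneg _)
  calc _ ≤ _ := abs_add_le _ _
    _ ≤ K * ω * σ ^ 2 + ω * σ ^ 2 := add_le_add h2 h3
    _ = _ := by ring

/-- A quantitative form of `norm_sub_sq_le_of_fit_le`, in which the errors `x` and `y` and their
inner products with `e` are small relative to `σ`. -/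
lemma norm_sub_sq_le_of_fit_of_small {E : Type*} [NormedAddCommGroup E] [InnerProductSpace ℝ E]
    {e a b x y : E} {K ω σ : ℝ} (ha : ⟪a, e - b⟫ = 0) (hb : ⟪b, e - b⟫ = 0)
    (h : ‖e - (a + x)‖ ^ 2 ≤ ‖e - (b + y)‖ ^ 2) (hK : 0 ≤ K) (hω : 0 ≤ ω) (hω1 : ω ≤ 1)
    (hσ : 0 ≤ σ) (hbK : ‖b‖ ≤ K * σ)
    (hx1 : ‖x‖ ≤ ω * σ) (hx2 : |⟪e, x⟫| ≤ (K + 1) * ω * σ ^ 2)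
    (hy1 : ‖y‖ ≤ ω * σ) (hy2 : |⟪e, y⟫| ≤ (K + 1) * ω * σ ^ 2) :
    ‖b - a‖ ^ 2 ≤ (16 * K + 12) * ω * σ ^ 2 := by
  have hcmp := norm_sub_sq_le_of_fit_le ha hb h
  have hperp : ∀ z : E, ‖z‖ ≤ ω * σ → |⟪e, z⟫| ≤ (K + 1) * ω * σ ^ 2 →
      |⟪e - b, z⟫| ≤ (2 * K + 1) * (ω * σ ^ 2) := by
    intro z hz1 hz2
    rw [inner_sub_left]
    have h3 : |⟪b, z⟫| ≤ K * σ * (ω * σ) :=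
      (abs_real_inner_le_norm _ _).trans (mul_le_mul hbK hz1 (norm_nonneg _) (by positivity))
    refine (abs_sub _ _).trans ((add_le_add hz2 h3).trans_eq ?_)
    ring
  have h3 := (abs_le.1 (hperp x hx1 hx2)).2
  have h4 := (abs_le.1 (hperp y hy1 hy2)).1
  have hωσ : (ω * σ) ^ 2 ≤ ω * σ ^ 2 := by
    have : ω ^ 2 ≤ ω := by nlinarith
    rw [mul_pow]
    exact mul_le_mul_of_nonneg_right this (sq_nonneg _)
  have hx1' := (pow_le_pow_left₀ (norm_nonneg x) hx1 2).trans hωσ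
  have hy1' := (pow_le_pow_left₀ (norm_nonneg y) hy1 2).trans hωσ
  have h6 : ‖b - a‖ ≤ ‖b - a - x‖ + ‖x‖ := by
    have := norm_add_le (b - a - x) x
    rwa [sub_add_cancel] at this
  have h7 := pow_le_pow_left₀ (norm_nonneg _) h6 2
  have h8 := add_sq_le (a := ‖b - a - x‖) (b := ‖x‖)
  set z := ω * σ ^ 2 with hz
  have h9 : (16 * K + 12) * ω * σ ^ 2 = (16 * K + 12) * z := by rw [hz]; ring
  rw [h9]
  linarith

/-- The deterministic part of the argument: for noise that satisfies the three bounds, with `ε`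
small and `r` and `N` large, a least squares estimate exists, and every least squares estimate is
within `Δ / r` of its linearization. -/
theorem leastSquares_linearization (hq : 1 ≤ q) (hqp : q < p) {θ : Param p}
    (hθ : θ ∈ paramSpace p) (hkink : coeffs θ ⟨q, hqp⟩ ≠ 0) {K Δ : ℝ} (hK : 0 ≤ K)
    (hΔ : 0 < Δ) :
    ∃ ε : ℝ, 0 < ε ∧ ∃ r₀ : ℝ, 0 < r₀ ∧ ∃ N₀ : ℕ, ∀ N : ℕ, N₀ ≤ N → ∀ r : ℝ, r₀ ≤ r → r ≤ √N →
      ∀ e : EuclideanSpace ℝ (Fin N), OneKnotBound p (knot θ) e (K * (√N / r)) →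
        WindowBound p (knot θ) e ε (N / r) → TwoKnotBound p (knot θ) e (ε * √N) →
        ∀ Y : Fin N → ℝ, (∀ t, Y t = splineMean q θ (designPoint N t) + e t) →
          (∃ τ : Param p, IsLeastSquares q Y τ) ∧
          ∀ τ : Param p, IsLeastSquares q Y τ → r * ‖τ - θ - linearTerm q θ e‖ ≤ Δ := by
  obtain ⟨ρ, hρ, C, hC, c, hc, N₁, hN₁, hloc⟩ := exists_local_bounds hqp hθ hkink
  obtain ⟨c₃, hc₃, N₃, hcons⟩ := exists_norm_sub_le_of_norm_meanShift_le hq hqp hθ hkink hρ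
  have hC0 : 0 < C := by linarith
  -- Both the estimation error and the linear term are at most `K₂ / r`. The number `ω` bounds the
  -- relative size of the linearization error, and `ω ≤ c² Δ² / (16 K + 12)` is what the last step
  -- needs. The three conditions on `ε` serve the rate, consistency and the window error.
  set K₂ := 12 * K / c + 1 with hK₂
  have hK₂0 : 0 < K₂ := by positivity
  set ω := min 1 (c ^ 2 * Δ ^ 2 / (16 * K + 12)) with hωdef
  have hω : 0 < ω := by positivity
  have hω1 : ω ≤ 1 := min_le_left _ _
  set ε := min (c ^ 2 / (16 * C)) (min (√c₃ / 2) (ω / (C * K₂ * (K₂ + 1)))) with hεdef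
  have hε : 0 < ε := by positivity
  have hε1 : 16 * ε * C ≤ c ^ 2 := by
    have : ε ≤ c ^ 2 / (16 * C) := min_le_left _ _
    rw [le_div_iff₀ (by positivity)] at this
    linarith
  have hε2 : (2 * ε) ^ 2 ≤ c₃ := by
    have : ε ≤ √c₃ / 2 := (min_le_right _ _).trans (min_le_left _ _)
    rw [← Real.sq_sqrt hc₃.le]
    exact pow_le_pow_left₀ (by positivity) (by linarith) 2
  have hε3 : ε * (C * K₂ * (K₂ + 1)) ≤ ω := by
    have : ε ≤ ω / (C * K₂ * (K₂ + 1)) := (min_le_right _ _).trans (min_le_right _ _)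
    rwa [le_div_iff₀ (by positivity)] at this
  set r₀ := max (max (C * K₂ ^ 2 / (ω / 2)) (C ^ 2 * K₂ ^ 2 * (K₂ + 1) / (ω / 2) ^ 2))
    (K₂ / ρ) with hr₀
  refine ⟨ε, hε, r₀, lt_max_of_lt_right (by positivity), max N₁ N₃,
    fun N hN r hr hrN e h₁ hw h₂ Y hY => ?_⟩
  have hr0 : 0 < r := lt_of_lt_of_le (lt_max_of_lt_right (by positivity)) hr
  have hNN₁ : N₁ ≤ N := (le_max_left _ _).trans hN
  have hN1 : (1 : ℝ) ≤ N := by exact_mod_cast hN₁.trans hNN₁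
  have hNpos : (0 : ℝ) < N := by linarith
  have hsN : 0 < √(N : ℝ) := Real.sqrt_pos.2 hNpos
  have hsq : √(N : ℝ) ^ 2 = N := Real.sq_sqrt hNpos.le
  have hrN' : r ≤ N := hrN.trans (Real.sqrt_le_iff.2 ⟨hNpos.le, by nlinarith⟩)
  have hr1 : C * K₂ ^ 2 / r ≤ ω / 2 := by
    have := ((le_max_left _ _).trans (le_max_left _ _)).trans hr
    rw [div_le_iff₀ (by positivity)] at this
    rw [div_le_iff₀ hr0]
    linarith
  have hr2 : C ^ 2 * K₂ ^ 2 * (K₂ + 1) / r ≤ (ω / 2) ^ 2 := by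
    have := ((le_max_right _ _).trans (le_max_left _ _)).trans hr
    rw [div_le_iff₀ (by positivity)] at this
    rw [div_le_iff₀ hr0]
    linarith
  have hr3 : K₂ / r ≤ ρ := by
    have := (le_max_right _ _).trans hr
    rw [div_le_iff₀ hρ] at this
    rw [div_le_iff₀ hr0]
    linarith
  obtain ⟨hgrad, hnear⟩ := hloc N hNN₁
  have hcrit : ∀ τ, lsCriterion q Y τ = ‖e - meanShift q θ τ N‖ ^ 2 := fun τ =>
    lsCriterion_eq θ τ Y e hY
  have hcritθ : lsCriterion q Y θ = ‖e‖ ^ 2 := by rw [hcrit, meanShift_self, sub_zero]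
  -- Parameters at least as good as the true one are near it.
  have hsub : ∀ τ ∈ paramSpace p, lsCriterion q Y τ ≤ lsCriterion q Y θ → ‖τ - θ‖ ≤ ρ := by
    intro τ hτ hle
    refine hcons N ((le_max_right _ _).trans hN) τ hτ ?_
    rw [hcritθ, hcrit] at hle
    have h3 := norm_sq_le_of_norm_sub_sq_le hle
    have h4 : ⟪e, meanShift q θ τ N⟫ ≤ ε * √N * ‖meanShift q θ τ N‖ := by
      rw [meanShift_eq]
      exact (le_abs_self _).trans (h₂ _ hτ _ (Submodule.sub_mem _ (leftPoly_mem_degreeLT _)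
        (leftPoly_mem_degreeLT _)) _ (Submodule.neg_mem _ (jumpPoly_mem_degreeLT hq _ _)) _
        (jumpPoly_mem_degreeLT hq _ _))
    have h5 : ‖meanShift q θ τ N‖ ≤ 2 * ε * √N := by
      rcases eq_or_lt_of_le (norm_nonneg (meanShift q θ τ N)) with h0 | h0
      · rw [← h0]; positivity
      · exact le_of_mul_le_mul_right (by nlinarith) h0
    calc ‖meanShift q θ τ N‖ ^ 2 ≤ (2 * ε * √N) ^ 2 := pow_le_pow_left₀ (norm_nonneg _) h5 2
      _ = (2 * ε) ^ 2 * N := by rw [mul_pow, hsq]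
      _ ≤ _ := mul_le_mul_of_nonneg_right hε2 hNpos.le
  constructor
  · -- The minimum over a small closed ball is a global one.
    obtain ⟨τ, hτ, hmin⟩ := (isCompact_closedBall θ ρ).exists_isMinOn
      ⟨θ, Metric.mem_closedBall_self hρ.le⟩ (continuous_lsCriterion (q := q) Y).continuousOn
    rw [Metric.mem_closedBall, dist_eq_norm] at hτ
    refine ⟨τ, ?_, fun τ' hτ' => ?_⟩
    · have := (hnear (τ - θ) hτ).1
      rwa [add_sub_cancel] at this
    · have hτθ : lsCriterion q Y τ ≤ lsCriterion q Y θ := hmin (Metric.mem_closedBall_self hρ.le)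
      rcases le_total (lsCriterion q Y τ') (lsCriterion q Y θ) with h | h
      · refine hmin ?_
        rw [Metric.mem_closedBall, dist_eq_norm]
        exact hsub τ' hτ' h
      · exact hτθ.trans h
  · rintro τ ⟨hτ, hmin⟩
    obtain ⟨δ, rfl⟩ : ∃ δ, τ = θ + δ := ⟨τ - θ, by abel⟩
    rw [add_sub_cancel_left]
    have hδρ : ‖δ‖ ≤ ρ := by
      have := hsub _ hτ (hmin θ hθ)
      rwa [add_sub_cancel_left] at this
    set L := linearTerm q θ e with hL
    set σ := √N / r with hσ
    have hσ0 : 0 < σ := by positivity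
    have horth : ∀ v : Param p, ⟪gradVec q θ v N, e - gradVec q θ L N⟫ = 0 :=
      inner_gradVec_sub_linearTerm θ e fun v hv => by
        have := hgrad v
        rw [hv, norm_zero] at this
        have h0 : c * √N * ‖v‖ ≤ 0 := by linarith
        exact norm_le_zero_iff.1 (nonpos_of_mul_nonpos_right h0 (by positivity))
    -- The rate of convergence of the estimate.
    have hδr : ‖δ‖ ≤ K₂ / r := by
      obtain ⟨-, hb1, hb2, hb3, hW, hD⟩ := hnear δ hδρ
      have hle := hmin θ hθ
      rw [hcritθ, hcrit] at hle
      have h3 := norm_sq_le_of_norm_sub_sq_le hle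
      have h4 : ⟪e, meanShift q θ (θ + δ) N⟫ ≤
          K * √N / r * (‖meanShift q θ (θ + δ) N‖ + ‖windowError q θ δ N‖) +
          ε * (C * ‖δ‖) * (√N ^ 2 * ‖δ‖ + √N ^ 2 / r) := by
        have h5 := h₁ _ (leftPoly_mem_degreeLT (q := q) (coeffs δ)) _
          (Submodule.add_mem _ (tangentPoly_mem_degreeLT hq θ δ)
            (jumpRemainder_mem_degreeLT hq θ δ))
        rw [← gradVec_add_remainder_eq] at h5
        have h6 := abs_inner_windowError_le hq hε.le hC0.le hw hτ hb3
        have h7 : meanShift q θ (θ + δ) N = gradVec q θ δ N +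
            evalOn N (above N (knot θ)) (jumpRemainder q θ δ) + windowError q θ δ N := by
          rw [meanShift_add_eq, add_assoc]
        have h8 : gradVec q θ δ N + evalOn N (above N (knot θ)) (jumpRemainder q θ δ) =
            meanShift q θ (θ + δ) N - windowError q θ δ N := by rw [h7, add_sub_cancel_right]
        have h9 : ⟪e, meanShift q θ (θ + δ) N⟫ = ⟪e, gradVec q θ δ N +
            evalOn N (above N (knot θ)) (jumpRemainder q θ δ)⟫ + ⟪e, windowError q θ δ N⟫ := by
          rw [h7, inner_add_right]
        rw [h9, hsq]
        refine add_le_add ((le_abs_self _).trans (h5.trans ?_)) ((le_abs_self _).trans h6)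
        rw [h8, mul_div_assoc]
        exact mul_le_mul_of_nonneg_left (norm_sub_le _ _) (by positivity)
      exact rate_of_quadratic_bound hc hsN hr0 hK (norm_nonneg _) hD hW hε1
        (h3.trans (mul_le_mul_of_nonneg_left h4 zero_le_two))
    -- `M L` is the projection of `e` onto the range of `M`.
    have hMLK : ‖gradVec q θ L N‖ ≤ K * σ := by
      have h3 : ‖gradVec q θ L N‖ ^ 2 ≤ K * σ * ‖gradVec q θ L N‖ := by
        have h4 := horth L
        rw [inner_sub_right, real_inner_self_eq_norm_sq, real_inner_comm] at h4
        have h5 := h₁ _ (leftPoly_mem_degreeLT (q := q) (coeffs L)) _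
          (tangentPoly_mem_degreeLT hq θ L)
        rw [← gradVec_eq] at h5
        have h6 := (le_abs_self _).trans h5
        linarith
      rcases eq_or_lt_of_le (norm_nonneg (gradVec q θ L N)) with h0 | h0
      · rw [← h0]; positivity
      · exact le_of_mul_le_mul_right (by nlinarith) h0
    have hLr : ‖L‖ ≤ K₂ / r := by
      have h3 : c * ‖L‖ * √N ≤ K / r * √N := by
        have := (hgrad L).trans hMLK
        rw [hσ] at this
        calc _ = c * (√N * ‖L‖) := by ring
          _ ≤ _ := this
          _ = _ := by ring
      have h4 := le_of_mul_le_mul_right h3 hsN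
      have h5 : ‖L‖ ≤ K / c / r := by
        rw [div_div, mul_comm c r, ← div_div, le_div_iff₀ hc]
        linarith
      refine h5.trans (div_le_div_of_nonneg_right ?_ hr0.le)
      rw [hK₂, mul_div_assoc]
      have : 0 ≤ K / c := by positivity
      linarith
    -- Comparison of the estimate with its linearization.
    obtain ⟨hLm, hL1, hL2, hL3, -, -⟩ := hnear L (hLr.trans hr3)
    obtain ⟨hδm, hδ1, hδ2, hδ3, -, -⟩ := hnear δ hδρ
    obtain ⟨hx1, hx2⟩ := remainder_small hq hr0 hrN' hK hK₂0.le hC hε.le hω.le h₁ hw hδm hδ1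
      hδ2 hδ3 hδr hr1 hr2 hε3
    obtain ⟨hy1, hy2⟩ := remainder_small hq hr0 hrN' hK hK₂0.le hC hε.le hω.le h₁ hw hLm hL1
      hL2 hL3 hLr hr1 hr2 hε3
    have hfit := hmin _ hLm
    rw [hcrit, hcrit, meanShift_add_eq, meanShift_add_eq] at hfit
    set x := evalOn N (above N (knot θ)) (jumpRemainder q θ δ) + windowError q θ δ N
    set y := evalOn N (above N (knot θ)) (jumpRemainder q θ L) + windowError q θ L N
    have h5 : ‖gradVec q θ (L - δ) N‖ ^ 2 ≤ (16 * K + 12) * ω * σ ^ 2 := by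
      rw [gradVec_sub]
      exact norm_sub_sq_le_of_fit_of_small (horth δ) (horth L) hfit hK hω.le hω1 hσ0.le hMLK
        hx1 hx2 hy1 hy2
    have h6 := pow_le_pow_left₀ (by positivity) (hgrad (L - δ)) 2
    rw [norm_sub_rev]
    refine le_of_sq_le_sq ?_ hΔ.le
    have h7 : c ^ 2 * (r * ‖L - δ‖) ^ 2 * σ ^ 2 ≤ (16 * K + 12) * ω * σ ^ 2 := by
      refine le_trans (le_of_eq ?_) (h6.trans h5)
      rw [hσ]
      field_simp
    have h8 := le_of_mul_le_mul_right h7 (by positivity)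
    have h9 : ω ≤ c ^ 2 * Δ ^ 2 / (16 * K + 12) := min_le_right _ _
    rw [le_div_iff₀ (by positivity)] at h9
    refine le_of_mul_le_mul_left (h8.trans ?_) (show 0 < c ^ 2 by positivity)
    linarith

end Expansion

/-! ### Projections of the noise onto spaces of piecewise polynomials -/

/-- The space of vectors of values of polynomials of degree less than `D`, extended by zero
outside `A`. -/
noncomputable def polySpace (D N : ℕ) (A : Set (Fin N)) :
    Submodule ℝ (EuclideanSpace ℝ (Fin N)) :=
  (Polynomial.degreeLT ℝ D).map (evalOn N A)

lemma finrank_polySpace_le (D N : ℕ) (A : Set (Fin N)) :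
    Module.finrank ℝ (polySpace D N A) ≤ D := by
  have : FiniteDimensional ℝ (Polynomial.degreeLT ℝ D) :=
    (Polynomial.degreeLTEquiv ℝ D).symm.finiteDimensional
  refine (Submodule.finrank_map_le _ _).trans_eq ?_
  rw [(Polynomial.degreeLTEquiv ℝ D).finrank_eq]
  simp

lemma evalOn_mem_polySpace {D N : ℕ} (A : Set (Fin N)) {f : ℝ[X]}
    (hf : f ∈ Polynomial.degreeLT ℝ D) : evalOn N A f ∈ polySpace D N A :=
  Submodule.mem_map_of_mem hf

lemma abs_inner_le_norm_starProjection_mul {E : Type*} [NormedAddCommGroup E]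
    [InnerProductSpace ℝ E] (V : Submodule ℝ E) [V.HasOrthogonalProjection] (e : E) {u : E}
    (hu : u ∈ V) : |⟪e, u⟫| ≤ ‖V.starProjection e‖ * ‖u‖ := by
  have : ⟪e, u⟫ = ⟪V.starProjection e, u⟫ := by
    have := Submodule.starProjection_inner_eq_zero (K := V) e u hu
    rw [inner_sub_left] at this
    linarith
  rw [this]
  exact abs_real_inner_le_norm _ _

section Moments

variable {Ω : Type*} [MeasurableSpace Ω] {P : Measure Ω} {N : ℕ}
  {e : Ω → EuclideanSpace ℝ (Fin N)}

lemma memLp_inner (he : ∀ t, MemLp (fun ω => e ω t) 2 P) (g : EuclideanSpace ℝ (Fin N)) :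
    MemLp (fun ω => ⟪g, e ω⟫) 2 P := by
  have : (fun ω => ⟪g, e ω⟫) = fun ω => ∑ t, g t * e ω t := by
    funext ω
    rw [PiLp.inner_apply]
    exact Finset.sum_congr rfl fun t _ => by simp [mul_comm]
  rw [this]
  exact memLp_finsetSum _ fun t _ => (he t).const_mul (g t)

lemma norm_starProjection_sq_eq (V : Submodule ℝ (EuclideanSpace ℝ (Fin N)))
    (x : EuclideanSpace ℝ (Fin N)) :
    ‖V.starProjection x‖ ^ 2 =
      ∑ i, ⟪(stdOrthonormalBasis ℝ V i : EuclideanSpace ℝ (Fin N)), x⟫ ^ 2 := by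
  have h1 : ‖V.starProjection x‖ = ‖V.orthogonalProjectionOnto x‖ := by
    rw [Submodule.starProjection_apply, Submodule.coe_norm]
  rw [h1, ← (stdOrthonormalBasis ℝ V).sum_sq_norm_inner_right]
  refine Finset.sum_congr rfl fun i _ => ?_
  rw [Real.norm_eq_abs, sq_abs, Submodule.inner_orthogonalProjectionOnto_eq_of_mem_left]

lemma integrable_norm_starProjection_sq (he : ∀ t, MemLp (fun ω => e ω t) 2 P)
    (V : Submodule ℝ (EuclideanSpace ℝ (Fin N))) :
    Integrable (fun ω => ‖V.starProjection (e ω)‖ ^ 2) P := by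
  simp only [norm_starProjection_sq_eq]
  exact integrable_finsetSum _ fun i _ => (memLp_inner he _).integrable_sq

/-- The mean square of a projection of the noise is at most proportional to the dimension. -/
lemma integral_norm_starProjection_sq_le (he : ∀ t, MemLp (fun ω => e ω t) 2 P) {B : ℝ}
    (hB : ∀ g : EuclideanSpace ℝ (Fin N), ∫ ω, ⟪g, e ω⟫ ^ 2 ∂P ≤ B * ‖g‖ ^ 2)
    (V : Submodule ℝ (EuclideanSpace ℝ (Fin N))) :
    ∫ ω, ‖V.starProjection (e ω)‖ ^ 2 ∂P ≤ Module.finrank ℝ V * B := by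
  simp only [norm_starProjection_sq_eq]
  rw [integral_finsetSum _ fun i _ => (memLp_inner he _).integrable_sq]
  calc _ ≤ ∑ _i : Fin (Module.finrank ℝ V), B := Finset.sum_le_sum fun i _ => by
        refine (hB _).trans_eq ?_
        have := (stdOrthonormalBasis ℝ V).norm_eq_one i
        rw [Submodule.coe_norm] at this
        rw [this]
        ring
    _ = _ := by simp

/-- Markov's inequality for a real function. -/
lemma measure_lt_le_ofReal {f : Ω → ℝ} [IsFiniteMeasure P] (hf : Integrable f P)
    (hf0 : ∀ ω, 0 ≤ f ω) {I a : ℝ} (ha : 0 < a) (hI : ∫ ω, f ω ∂P ≤ I) :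
    P {ω | a < f ω} ≤ ENNReal.ofReal (I / a) := by
  have h1 := mul_meas_ge_le_integral_of_nonneg (ae_of_all P hf0) hf a
  have h2 : P.real {ω | a ≤ f ω} ≤ I / a := by
    rw [le_div_iff₀ ha]; linarith
  calc P {ω | a < f ω} ≤ P {ω | a ≤ f ω} := measure_mono fun ω (h : a < f ω) => h.le
    _ = ENNReal.ofReal (P.real {ω | a ≤ f ω}) := (ofReal_measureReal).symm
    _ ≤ _ := ENNReal.ofReal_le_ofReal h2

/-! ### Restriction of a vector to a set of indices -/

/-- The vector `v` with the coordinates outside `S` replaced by zero. -/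
noncomputable def restrictTo (S : Set (Fin N)) (v : EuclideanSpace ℝ (Fin N)) :
    EuclideanSpace ℝ (Fin N) :=
  WithLp.toLp 2 (S.indicator v)

lemma restrictTo_apply (S : Set (Fin N)) (v : EuclideanSpace ℝ (Fin N)) (t : Fin N) :
    restrictTo S v t = S.indicator v t := rfl

lemma restrictTo_add (S : Set (Fin N)) (v w : EuclideanSpace ℝ (Fin N)) :
    restrictTo S (v + w) = restrictTo S v + restrictTo S w := by
  ext t
  by_cases h : t ∈ S <;> simp [restrictTo_apply, h]

lemma restrictTo_add_compl (S : Set (Fin N)) (v : EuclideanSpace ℝ (Fin N)) :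
    restrictTo S v + restrictTo Sᶜ v = v := by
  ext t
  by_cases h : t ∈ S <;> simp [restrictTo_apply, h]

lemma norm_restrictTo_sq (S : Finset (Fin N)) (v : EuclideanSpace ℝ (Fin N)) :
    ‖restrictTo (S : Set (Fin N)) v‖ ^ 2 = ∑ t ∈ S, v t ^ 2 := by
  rw [EuclideanSpace.real_norm_sq_eq, ← Finset.sum_subset (Finset.subset_univ S)]
  · exact Finset.sum_congr rfl fun t ht => by
      rw [restrictTo_apply, Set.indicator_of_mem (Finset.mem_coe.2 ht)]
  · intro t _ ht
    rw [restrictTo_apply, Set.indicator_of_notMem (fun h => ht (Finset.mem_coe.1 h))]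
    simp

lemma norm_restrictTo_le (S : Set (Fin N)) (v : EuclideanSpace ℝ (Fin N)) :
    ‖restrictTo S v‖ ≤ ‖v‖ := by
  refine le_of_sq_le_sq ?_ (norm_nonneg _)
  rw [EuclideanSpace.real_norm_sq_eq, EuclideanSpace.real_norm_sq_eq]
  refine Finset.sum_le_sum fun t _ => ?_
  by_cases h : t ∈ S <;> simp [restrictTo_apply, h, sq_nonneg]

lemma inner_restrictTo {S S' : Set (Fin N)} (h : S ⊆ S') (v w : EuclideanSpace ℝ (Fin N)) :
    ⟪v, restrictTo S w⟫ = ⟪restrictTo S' v, restrictTo S w⟫ := by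
  rw [PiLp.inner_apply, PiLp.inner_apply]
  refine Finset.sum_congr rfl fun t _ => ?_
  by_cases ht : t ∈ S
  · simp [restrictTo_apply, ht, h ht]
  · simp [restrictTo_apply, ht]

lemma restrictTo_evalOn (S A : Set (Fin N)) (f : ℝ[X]) :
    restrictTo S (evalOn N A f) = evalOn N (S ∩ A) f := by
  ext t
  rw [restrictTo_apply, evalOn_apply, ← Set.indicator_indicator]
  rfl

lemma norm_sq_evalOn_le (S : Finset (Fin N)) (f : ℝ[X]) {U : ℝ}
    (hU : ∀ t ∈ S, |f.eval (designPoint N t)| ≤ U) :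
    ‖evalOn N (S : Set (Fin N)) f‖ ^ 2 ≤ S.card * U ^ 2 := by
  refine norm_sq_le_card_mul S _ (fun t ht => ?_) fun t ht => ?_
  · rw [evalOn_apply, Set.indicator_of_notMem (fun h => ht (Finset.mem_coe.1 h))]
  · rw [evalOn_apply, Set.indicator_of_mem (Finset.mem_coe.2 ht)]
    exact hU t ht

/-! ### Increasing families of windows -/

/-- The weighted sum of squares that controls the inner products of the noise with polynomials on
an increasing family of windows `A 0 ⊆ A 1 ⊆ …`. The grid points `l j²`, at increasing distances,
balance the two contributions: the projections onto polynomials on the windows `A (l j²)`, and the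
parts of the noise between consecutive grid points. -/
noncomputable def chainNorm (D : ℕ) (A : ℕ → Finset (Fin N)) (l : ℕ) (n₀ : ℝ)
    (v : EuclideanSpace ℝ (Fin N)) : ℝ :=
  ∑ j ∈ Finset.range (N + 1),
    (l * (j : ℝ) ^ 2 * ‖(polySpace D N (A (l * j ^ 2) : Set (Fin N))).starProjection v‖ ^ 2 +
      l * (2 * (j : ℝ) + 1) *
        ‖restrictTo (A (l * (j + 1) ^ 2) \ A (l * j ^ 2) : Finset (Fin N)) v‖ ^ 2) /
      (l * (j : ℝ) ^ 2 + n₀) ^ 2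

lemma chainNorm_nonneg (D : ℕ) (A : ℕ → Finset (Fin N)) (l : ℕ) (n₀ : ℝ)
    (v : EuclideanSpace ℝ (Fin N)) : 0 ≤ chainNorm D A l n₀ v :=
  Finset.sum_nonneg fun j _ => by positivity

/-- The window `A x` is split at the last grid point `l j² ≤ x`: up to the grid point the inner
product is bounded by a projection, beyond it by the norm of the noise up to the next grid point. -/
lemma inner_evalOn_sq_le_chainNorm {D : ℕ} {A : ℕ → Finset (Fin N)} (hA0 : A 0 = ∅)
    (hmono : Monotone A) (hcard : ∀ x y, x ≤ y → (A y \ A x).card ≤ y - x) {l : ℕ} (hl : 1 ≤ l)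
    {n₀ : ℝ} (hn₀ : 0 < n₀) (v : EuclideanSpace ℝ (Fin N)) {x : ℕ} (hx : x ≤ N) {f : ℝ[X]}
    (hf : f ∈ Polynomial.degreeLT ℝ D) {U : ℝ}
    (hU : ∀ t ∈ A x, |f.eval (designPoint N t)| ≤ U) :
    ⟪v, evalOn N (A x : Set (Fin N)) f⟫ ^ 2 ≤ 4 * U ^ 2 * chainNorm D A l n₀ v * (x + n₀) ^ 2 := by
  classical
  set Q := chainNorm D A l n₀ v with hQ
  set j := Nat.sqrt (x / l) with hj
  have hjx : l * j ^ 2 ≤ x := by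
    have := Nat.sqrt_le' (x / l)
    calc l * j ^ 2 ≤ l * (x / l) := Nat.mul_le_mul_left _ this
      _ ≤ x := Nat.mul_div_le _ _
  have hxj : x < l * (j + 1) ^ 2 := by
    have := Nat.lt_succ_sqrt' (x / l)
    exact (Nat.mul_comm _ _).symm ▸ (Nat.div_lt_iff_lt_mul (by omega)).1 this
  have hjN : j ≤ N := (Nat.sqrt_le_self _).trans ((Nat.div_le_self _ _).trans hx)
  have hterm : (l * (j : ℝ) ^ 2 *
      ‖(polySpace D N (A (l * j ^ 2) : Set (Fin N))).starProjection v‖ ^ 2 +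
      l * (2 * (j : ℝ) + 1) *
        ‖restrictTo (A (l * (j + 1) ^ 2) \ A (l * j ^ 2) : Finset (Fin N)) v‖ ^ 2) /
      (l * (j : ℝ) ^ 2 + n₀) ^ 2 ≤ Q :=
    Finset.single_le_sum (f := fun j : ℕ => (l * (j : ℝ) ^ 2 *
      ‖(polySpace D N (A (l * j ^ 2) : Set (Fin N))).starProjection v‖ ^ 2 +
      l * (2 * (j : ℝ) + 1) *
        ‖restrictTo (A (l * (j + 1) ^ 2) \ A (l * j ^ 2) : Finset (Fin N)) v‖ ^ 2) /
      (l * (j : ℝ) ^ 2 + n₀) ^ 2) (fun i _ => by positivity)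
      (Finset.mem_range.2 (Nat.lt_succ_of_le hjN))
  have hl0 : (0 : ℝ) < l := by exact_mod_cast hl
  set w := (l : ℝ) * (j : ℝ) ^ 2 + n₀ with hw
  have hw0 : 0 < w := by positivity
  rw [div_le_iff₀ (by positivity)] at hterm
  have hwx : w ≤ x + n₀ := by
    have : ((l * j ^ 2 : ℕ) : ℝ) ≤ x := by exact_mod_cast hjx
    push_cast at this
    linarith
  set a := ‖(polySpace D N (A (l * j ^ 2) : Set (Fin N))).starProjection v‖ with ha
  set b := ‖restrictTo (A (l * (j + 1) ^ 2) \ A (l * j ^ 2) : Finset (Fin N)) v‖ with hb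
  have hsub : A (l * j ^ 2) ⊆ A x := hmono hjx
  have hsub' : A x \ A (l * j ^ 2) ⊆ A (l * (j + 1) ^ 2) \ A (l * j ^ 2) :=
    Finset.sdiff_subset_sdiff (hmono hxj.le) le_rfl
  have hsplit : evalOn N (A x : Set (Fin N)) f = evalOn N (A (l * j ^ 2) : Set (Fin N)) f +
      evalOn N (A x \ A (l * j ^ 2) : Finset (Fin N)) f := by
    ext t
    rw [PiLp.add_apply, evalOn_apply, evalOn_apply, evalOn_apply]
    simp only [Set.indicator_apply, Finset.mem_coe, Finset.mem_sdiff]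
    have := @hsub t
    by_cases h1 : t ∈ A x <;> by_cases h2 : t ∈ A (l * j ^ 2) <;> simp_all
  have h1 : ⟪v, evalOn N (A (l * j ^ 2) : Set (Fin N)) f⟫ ^ 2 ≤ U ^ 2 * (Q * w ^ 2) := by
    have h2 := abs_inner_le_norm_starProjection_mul _ v
      (evalOn_mem_polySpace (A (l * j ^ 2) : Set (Fin N)) hf)
    have h3 := norm_sq_evalOn_le (A (l * j ^ 2)) f fun t ht => hU t (hsub ht)
    have h4 : ((A (l * j ^ 2)).card : ℝ) ≤ l * (j : ℝ) ^ 2 := by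
      have := hcard 0 (l * j ^ 2) (Nat.zero_le _)
      rw [hA0, Finset.sdiff_empty, Nat.sub_zero] at this
      exact_mod_cast this
    rw [← sq_abs]
    calc _ ≤ (a * ‖evalOn N (A (l * j ^ 2) : Set (Fin N)) f‖) ^ 2 :=
          pow_le_pow_left₀ (abs_nonneg _) h2 2
      _ = a ^ 2 * ‖evalOn N (A (l * j ^ 2) : Set (Fin N)) f‖ ^ 2 := mul_pow _ _ _
      _ ≤ a ^ 2 * (l * (j : ℝ) ^ 2 * U ^ 2) := by
        refine mul_le_mul_of_nonneg_left (h3.trans ?_) (sq_nonneg _)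
        exact mul_le_mul_of_nonneg_right h4 (sq_nonneg _)
      _ = U ^ 2 * (l * (j : ℝ) ^ 2 * a ^ 2) := by ring
      _ ≤ _ := by
        refine mul_le_mul_of_nonneg_left (le_trans ?_ hterm) (sq_nonneg _)
        exact le_add_of_nonneg_right (by positivity)
  have h2 : ⟪v, evalOn N (A x \ A (l * j ^ 2) : Finset (Fin N)) f⟫ ^ 2 ≤ U ^ 2 * (Q * w ^ 2) := by
    have h3 := norm_sq_evalOn_le (A x \ A (l * j ^ 2)) f
      fun t ht => hU t (Finset.mem_sdiff.1 ht).1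
    have h4 : ((A x \ A (l * j ^ 2)).card : ℝ) ≤ l * (2 * (j : ℝ) + 1) := by
      have h5 : (A x \ A (l * j ^ 2)).card ≤ l * (2 * j + 1) := by
        refine (hcard _ _ hjx).trans ?_
        have : l * (j + 1) ^ 2 = l * j ^ 2 + l * (2 * j + 1) := by ring
        omega
      exact_mod_cast h5
    have h6 : evalOn N (A x \ A (l * j ^ 2) : Finset (Fin N)) f =
        restrictTo (A x \ A (l * j ^ 2) : Finset (Fin N))
          (evalOn N (A x \ A (l * j ^ 2) : Finset (Fin N)) f) := by
      rw [restrictTo_evalOn, Set.inter_self]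
    have h7 : |⟪v, evalOn N (A x \ A (l * j ^ 2) : Finset (Fin N)) f⟫| ≤
        b * ‖evalOn N (A x \ A (l * j ^ 2) : Finset (Fin N)) f‖ := by
      rw [h6, inner_restrictTo (Finset.coe_subset.2 hsub'), ← h6]
      exact abs_real_inner_le_norm _ _
    rw [← sq_abs]
    calc _ ≤ (b * ‖evalOn N (A x \ A (l * j ^ 2) : Finset (Fin N)) f‖) ^ 2 :=
          pow_le_pow_left₀ (abs_nonneg _) h7 2
      _ = b ^ 2 * ‖evalOn N (A x \ A (l * j ^ 2) : Finset (Fin N)) f‖ ^ 2 := mul_pow _ _ _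
      _ ≤ b ^ 2 * (l * (2 * (j : ℝ) + 1) * U ^ 2) := by
        refine mul_le_mul_of_nonneg_left (h3.trans ?_) (sq_nonneg _)
        exact mul_le_mul_of_nonneg_right h4 (sq_nonneg _)
      _ = U ^ 2 * (l * (2 * (j : ℝ) + 1) * b ^ 2) := by ring
      _ ≤ _ := by
        refine mul_le_mul_of_nonneg_left (le_trans ?_ hterm) (sq_nonneg _)
        exact le_add_of_nonneg_left (by positivity)
  rw [hsplit, inner_add_right]
  have h3 : Q * w ^ 2 ≤ Q * (x + n₀) ^ 2 :=
    mul_le_mul_of_nonneg_left (pow_le_pow_left₀ hw0.le hwx 2) (chainNorm_nonneg _ _ _ _ _)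
  have h4 := mul_le_mul_of_nonneg_left h3 (sq_nonneg U)
  have h5 := add_sq_le (a := ⟪v, evalOn N (A (l * j ^ 2) : Set (Fin N)) f⟫)
    (b := ⟪v, evalOn N (A x \ A (l * j ^ 2) : Finset (Fin N)) f⟫)
  linarith

lemma integrable_norm_restrictTo_sq (he : ∀ t, MemLp (fun ω => e ω t) 2 P) (S : Finset (Fin N)) :
    Integrable (fun ω => ‖restrictTo (S : Set (Fin N)) (e ω)‖ ^ 2) P := by
  simp only [norm_restrictTo_sq]
  exact integrable_finsetSum _ fun t _ => (he t).integrable_sq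

lemma integral_norm_restrictTo_sq_le (he : ∀ t, MemLp (fun ω => e ω t) 2 P) {C₀ : ℝ}
    (hC₀ : ∀ t, ∫ ω, e ω t ^ 2 ∂P ≤ C₀) (S : Finset (Fin N)) :
    ∫ ω, ‖restrictTo (S : Set (Fin N)) (e ω)‖ ^ 2 ∂P ≤ S.card * C₀ := by
  simp only [norm_restrictTo_sq]
  rw [integral_finsetSum _ fun t _ => (he t).integrable_sq]
  calc _ ≤ ∑ _t ∈ S, C₀ := Finset.sum_le_sum fun t _ => hC₀ t
    _ = _ := by simp

lemma integrable_chainNorm (he : ∀ t, MemLp (fun ω => e ω t) 2 P) (D : ℕ)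
    (A : ℕ → Finset (Fin N)) (l : ℕ) (n₀ : ℝ) :
    Integrable (fun ω => chainNorm D A l n₀ (e ω)) P :=
  integrable_finsetSum _ fun _ _ => (((integrable_norm_starProjection_sq he _).const_mul _).add
    ((integrable_norm_restrictTo_sq he _).const_mul _)).div_const _

lemma summable_one_div_sq_add {a : ℝ} (ha : 0 < a) :
    Summable fun j : ℕ => 1 / ((j : ℝ) ^ 2 + a) := by
  refine Summable.of_norm_bounded_eventually_nat (g := fun j : ℕ => 1 / (j : ℝ) ^ 2)
    (Real.summable_one_div_nat_pow.2 one_lt_two) ?_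
  filter_upwards [eventually_gt_atTop 0] with j hj
  have : (0 : ℝ) < j := by exact_mod_cast hj
  rw [Real.norm_of_nonneg (by positivity)]
  exact one_div_le_one_div_of_le (by positivity) (by linarith)

/-- The mean of `chainNorm` is small when `n₀ / l` is large: both contributions to the `j`-th term
have mean of order `l² j²`, against a weight of order `l² (j² + a)²`. -/
lemma integral_chainNorm_le (he : ∀ t, MemLp (fun ω => e ω t) 2 P) {B C₀ : ℝ} (hB0 : 0 ≤ B)
    (hC₀0 : 0 ≤ C₀)
    {l : ℕ} (hl : 1 ≤ l)
    (hB : ∀ g : EuclideanSpace ℝ (Fin N), ∫ ω, ⟪g, e ω⟫ ^ 2 ∂P ≤ B * l * ‖g‖ ^ 2)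
    (hC₀ : ∀ t, ∫ ω, e ω t ^ 2 ∂P ≤ C₀) (D : ℕ) {A : ℕ → Finset (Fin N)}
    (hcard : ∀ x y, x ≤ y → (A y \ A x).card ≤ y - x) {n₀ a : ℝ} (ha : 1 ≤ a) (han : l * a ≤ n₀) :
    ∫ ω, chainNorm D A l n₀ (e ω) ∂P ≤ (D * B + 8 * C₀) * ∑' j : ℕ, 1 / ((j : ℝ) ^ 2 + a) := by
  have hl0 : (0 : ℝ) < l := by exact_mod_cast hl
  have hsum := summable_one_div_sq_add (zero_lt_one.trans_le ha)
  have hi1 := fun j : ℕ => integrable_norm_starProjection_sq he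
    (polySpace D N (A (l * j ^ 2) : Set (Fin N)))
  have hi2 := fun j : ℕ => integrable_norm_restrictTo_sq he (A (l * (j + 1) ^ 2) \ A (l * j ^ 2))
  unfold chainNorm
  rw [integral_finsetSum]
  swap
  · exact fun j _ => (((hi1 j).const_mul _).add ((hi2 j).const_mul _)).div_const _
  refine le_trans (Finset.sum_le_sum fun j _ => ?_) (le_trans (le_of_eq
    (Finset.mul_sum (Finset.range (N + 1)) (fun j : ℕ => 1 / ((j : ℝ) ^ 2 + a))
      (D * B + 8 * C₀)).symm)
    (mul_le_mul_of_nonneg_left (hsum.sum_le_tsum _ fun j _ => by positivity) (by positivity)))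
  rw [integral_div, integral_add ((hi1 j).const_mul _) ((hi2 j).const_mul _),
    integral_const_mul, integral_const_mul]
  have h1 : ∫ ω, ‖(polySpace D N (A (l * j ^ 2) : Set (Fin N))).starProjection (e ω)‖ ^ 2 ∂P ≤
      D * (B * l) :=
    (integral_norm_starProjection_sq_le he hB _).trans (mul_le_mul_of_nonneg_right
      (by exact_mod_cast finrank_polySpace_le D N _) (by positivity))
  have h2 : ∫ ω, ‖restrictTo (A (l * (j + 1) ^ 2) \ A (l * j ^ 2) : Finset (Fin N)) (e ω)‖ ^ 2 ∂P ≤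
      l * (2 * (j : ℝ) + 1) * C₀ := by
    refine (integral_norm_restrictTo_sq_le he hC₀ _).trans (mul_le_mul_of_nonneg_right ?_ hC₀0)
    have h5 : (A (l * (j + 1) ^ 2) \ A (l * j ^ 2)).card ≤ l * (2 * j + 1) := by
      refine (hcard _ _
        (Nat.mul_le_mul_left _ (Nat.pow_le_pow_left (Nat.le_add_right j 1) 2))).trans ?_
      have : l * (j + 1) ^ 2 = l * j ^ 2 + l * (2 * j + 1) := by ring
      omega
    exact_mod_cast h5
  have hj0 : (0 : ℝ) ≤ j := Nat.cast_nonneg j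
  have h3 : l * (j : ℝ) ^ 2 * (∫ ω, ‖(polySpace D N (A (l * j ^ 2) : Set (Fin N))).starProjection
        (e ω)‖ ^ 2 ∂P) + l * (2 * (j : ℝ) + 1) *
        (∫ ω, ‖restrictTo (A (l * (j + 1) ^ 2) \ A (l * j ^ 2) : Finset (Fin N)) (e ω)‖ ^ 2 ∂P) ≤
      (l : ℝ) ^ 2 * ((D * B + 8 * C₀) * ((j : ℝ) ^ 2 + a)) := by
    have h4 := mul_le_mul_of_nonneg_left h1 (show 0 ≤ l * (j : ℝ) ^ 2 by positivity)
    have h5 := mul_le_mul_of_nonneg_left h2 (show 0 ≤ l * (2 * (j : ℝ) + 1) by positivity)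
    have h6 : (2 * (j : ℝ) + 1) ^ 2 * C₀ ≤ 8 * ((j : ℝ) ^ 2 + a) * C₀ := by
      refine mul_le_mul_of_nonneg_right ?_ hC₀0
      nlinarith [sq_nonneg ((j : ℝ) - 1)]
    have h7 : (j : ℝ) ^ 2 * (D * B) ≤ ((j : ℝ) ^ 2 + a) * (D * B) :=
      mul_le_mul_of_nonneg_right (by linarith) (by positivity)
    calc _ ≤ _ := add_le_add h4 h5
      _ = (l : ℝ) ^ 2 * ((j : ℝ) ^ 2 * (D * B) + (2 * (j : ℝ) + 1) ^ 2 * C₀) := by ring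
      _ ≤ (l : ℝ) ^ 2 * (((j : ℝ) ^ 2 + a) * (D * B) + 8 * ((j : ℝ) ^ 2 + a) * C₀) := by gcongr
      _ = _ := by ring
  have hpos : 0 < (j : ℝ) ^ 2 + a := by positivity
  calc _ ≤ (l : ℝ) ^ 2 * ((D * B + 8 * C₀) * ((j : ℝ) ^ 2 + a)) / (l * (j : ℝ) ^ 2 + n₀) ^ 2 :=
        div_le_div_of_nonneg_right h3 (sq_nonneg _)
    _ ≤ (l : ℝ) ^ 2 * ((D * B + 8 * C₀) * ((j : ℝ) ^ 2 + a)) / (l * ((j : ℝ) ^ 2 + a)) ^ 2 := by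
        refine div_le_div_of_nonneg_left (by positivity) (by positivity)
          (pow_le_pow_left₀ (by positivity) ?_ 2)
        linarith
    _ = _ := by field_simp

lemma tendsto_tsum_one_div_sq_add :
    Tendsto (fun a : ℝ => ∑' j : ℕ, 1 / ((j : ℝ) ^ 2 + a)) atTop (𝓝 0) := by
  have h : Tendsto (fun a : ℝ => ∑' j : ℕ, 1 / ((j : ℝ) ^ 2 + a)) atTop
      (𝓝 (∑' _j : ℕ, (0 : ℝ))) := by
    have hsum := summable_one_div_sq_add one_pos
    refine tendsto_tsum_of_dominated_convergence hsum (fun j => ?_) ?_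
    · simp only [one_div]
      exact tendsto_inv_atTop_zero.comp (tendsto_atTop_add_const_left _ _ tendsto_id)
    · filter_upwards [eventually_ge_atTop 1] with a ha j
      rw [Real.norm_of_nonneg (by positivity)]
      exact one_div_le_one_div_of_le (by positivity) (by linarith)
  simpa using h

end Moments

/-! ### Windows next to a fixed knot -/

/-- The indices of the `x` design points just after position `m`. -/
def rightChain (N m x : ℕ) : Finset (Fin N) :=
  Finset.univ.filter fun t => m ≤ (t : ℕ) ∧ (t : ℕ) < m + x

/-- The indices of the `x` design points just before position `m`. -/
def leftChain (N m x : ℕ) : Finset (Fin N) :=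
  Finset.univ.filter fun t => m ≤ (t : ℕ) + x ∧ (t : ℕ) < m

lemma rightChain_zero (N m : ℕ) : rightChain N m 0 = ∅ := by
  ext t; simp [rightChain]

lemma leftChain_zero (N m : ℕ) : leftChain N m 0 = ∅ := by
  ext t; simp [leftChain]

lemma monotone_rightChain (N m : ℕ) : Monotone (rightChain N m) := by
  intro x y hxy t
  simp only [rightChain, Finset.mem_filter, Finset.mem_univ, true_and]
  omega

lemma monotone_leftChain (N m : ℕ) : Monotone (leftChain N m) := by
  intro x y hxy t
  simp only [leftChain, Finset.mem_filter, Finset.mem_univ, true_and]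
  omega

lemma card_rightChain_sdiff_le (N m x y : ℕ) (hxy : x ≤ y) :
    (rightChain N m y \ rightChain N m x).card ≤ y - x := by
  have : (rightChain N m y \ rightChain N m x).card ≤ (Finset.Ico (m + x) (m + y)).card := by
    refine Finset.card_le_card_of_injOn (fun t : Fin N => (t : ℕ)) (fun t ht => ?_)
      (fun i _ j _ h => Fin.ext h)
    simp only [rightChain, Finset.coe_sdiff, Finset.coe_filter, Finset.mem_univ, true_and,
      Set.mem_sdiff, Set.mem_ofPred_eq] at ht
    simp only [Finset.coe_Ico, Set.mem_Ico]
    omega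
  rw [Nat.card_Ico] at this
  omega

lemma card_leftChain_sdiff_le (N m x y : ℕ) (hxy : x ≤ y) :
    (leftChain N m y \ leftChain N m x).card ≤ y - x := by
  have : (leftChain N m y \ leftChain N m x).card ≤ (Finset.Ico (m - y) (m - x)).card := by
    refine Finset.card_le_card_of_injOn (fun t : Fin N => (t : ℕ)) (fun t ht => ?_)
      (fun i _ j _ h => Fin.ext h)
    simp only [leftChain, Finset.coe_sdiff, Finset.coe_filter, Finset.mem_univ, true_and,
      Set.mem_sdiff, Set.mem_ofPred_eq] at ht
    simp only [Finset.coe_Ico, Set.mem_Ico]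
    omega
  rw [Nat.card_Ico] at this
  omega

lemma window_eq_rightChain {N : ℕ} {x y : ℝ} (hx : 0 ≤ x) (hxy : x ≤ y) :
    window N x y =
      (rightChain N ⌊(N : ℝ) * x⌋₊ (⌊(N : ℝ) * y⌋₊ - ⌊(N : ℝ) * x⌋₊) : Set (Fin N)) := by
  have h3 : ⌊(N : ℝ) * x⌋₊ ≤ ⌊(N : ℝ) * y⌋₊ := Nat.floor_le_floor (by gcongr)
  ext t
  have h1 := lt_designPoint_iff t hx
  have h2 := lt_designPoint_iff t (hx.trans hxy)
  rw [← not_le, ← not_iff_not, not_not] at h2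
  simp only [window, Set.mem_ofPred_eq, Set.uIoc_of_le hxy, Set.mem_Ioc, rightChain,
    Finset.coe_filter, Finset.mem_univ, true_and, h1, h2]
  omega

lemma window_eq_leftChain {N : ℕ} {x y : ℝ} (hy : 0 ≤ y) (hxy : y ≤ x) :
    window N x y =
      (leftChain N ⌊(N : ℝ) * x⌋₊ (⌊(N : ℝ) * x⌋₊ - ⌊(N : ℝ) * y⌋₊) : Set (Fin N)) := by
  have h3 : ⌊(N : ℝ) * y⌋₊ ≤ ⌊(N : ℝ) * x⌋₊ := Nat.floor_le_floor (by gcongr)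
  ext t
  have h1 := lt_designPoint_iff t hy
  have h2 := lt_designPoint_iff t (hy.trans hxy)
  rw [← not_le, ← not_iff_not, not_not] at h2
  simp only [window, Set.mem_ofPred_eq, Set.uIoc_of_ge hxy, Set.mem_Ioc, leftChain,
    Finset.coe_filter, Finset.mem_univ, true_and, h1, h2]
  omega

lemma floor_sub_floor_le {N : ℕ} {x y : ℝ} (hx : 0 ≤ x) (hxy : x ≤ y) :
    ((⌊(N : ℝ) * y⌋₊ - ⌊(N : ℝ) * x⌋₊ : ℕ) : ℝ) ≤ N * (y - x) + 1 := by
  have h1 : ((⌊(N : ℝ) * y⌋₊ : ℕ) : ℝ) ≤ N * y :=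
    Nat.floor_le (mul_nonneg N.cast_nonneg (hx.trans hxy))
  have h2 : (N : ℝ) * x < (⌊(N : ℝ) * x⌋₊ : ℕ) + 1 := Nat.lt_floor_add_one _
  have h3 : ⌊(N : ℝ) * x⌋₊ ≤ ⌊(N : ℝ) * y⌋₊ := Nat.floor_le_floor (by gcongr)
  rw [Nat.cast_sub h3]
  linarith

lemma floor_mul_le {N : ℕ} {x : ℝ} (hx : x ≤ 1) : ⌊(N : ℝ) * x⌋₊ ≤ N :=
  Nat.floor_le_of_le (mul_le_of_le_one_right N.cast_nonneg hx)

lemma windowBound_of_chainNorm_le {D N : ℕ} {x : ℝ} (hx : x ∈ Set.Ioo (0 : ℝ) 1) {l : ℕ}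
    (hl : 1 ≤ l) {n₀ : ℝ} (hn₀ : 1 ≤ n₀) {ε : ℝ} (hε : 0 ≤ ε) (v : EuclideanSpace ℝ (Fin N))
    (h1 : chainNorm D (rightChain N ⌊(N : ℝ) * x⌋₊) l n₀ v ≤ ε ^ 2 / 16)
    (h2 : chainNorm D (leftChain N ⌊(N : ℝ) * x⌋₊) l n₀ v ≤ ε ^ 2 / 16) :
    WindowBound D x v ε n₀ := by
  intro y hy f hf U hU0 hU
  have hN0 : (0 : ℝ) ≤ N := N.cast_nonneg
  have hn0 : 0 < n₀ := by linarith
  -- It suffices to treat a window that belongs to one of the two families.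
  have key : ∀ (A : ℕ → Finset (Fin N)) (k : ℕ), A 0 = ∅ → Monotone A →
      (∀ x y, x ≤ y → (A y \ A x).card ≤ y - x) → chainNorm D A l n₀ v ≤ ε ^ 2 / 16 → k ≤ N →
      (k : ℝ) ≤ N * |y - x| + 1 → window N x y = (A k : Set (Fin N)) →
      |⟪v, evalOn N (window N x y) f⟫| ≤ ε * U * (N * |y - x| + n₀) := by
    intro A k hA0 hmono hcard hQ hk hk' hA
    have h := inner_evalOn_sq_le_chainNorm hA0 hmono hcard hl hn0 v hk hf
      (fun t ht => hU t (by rw [hA]; exact Finset.mem_coe.2 ht))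
    rw [hA]
    refine abs_le_of_sq_le_sq (h.trans ?_) (by positivity)
    have h3 : (k : ℝ) + n₀ ≤ 2 * (N * |y - x| + n₀) := by
      have : 0 ≤ N * |y - x| := by positivity
      linarith
    calc 4 * U ^ 2 * chainNorm D A l n₀ v * (k + n₀) ^ 2
        ≤ 4 * U ^ 2 * (ε ^ 2 / 16) * (2 * (N * |y - x| + n₀)) ^ 2 := by gcongr
      _ = _ := by ring
  rcases le_total x y with hxy | hxy
  · refine key _ _ (rightChain_zero N _) (monotone_rightChain N _)
      (card_rightChain_sdiff_le N _) h1 ((Nat.sub_le _ _).trans (floor_mul_le hy.2.le)) ?_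
      (window_eq_rightChain hx.1.le hxy)
    rw [abs_of_nonneg (sub_nonneg.2 hxy)]
    exact floor_sub_floor_le hx.1.le hxy
  · refine key _ _ (leftChain_zero N _) (monotone_leftChain N _)
      (card_leftChain_sdiff_le N _) h2 ((Nat.sub_le _ _).trans (floor_mul_le hx.2.le)) ?_
      (window_eq_leftChain hy.1.le hxy)
    rw [abs_sub_comm, abs_of_nonneg (sub_nonneg.2 hxy)]
    exact floor_sub_floor_le hy.1.le hxy

/-! ### Splines with an arbitrary knot -/

/-- The `j`-th block of `h` consecutive indices. -/
def block (N h j : ℕ) : Finset (Fin N) :=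
  Finset.univ.filter fun t => j * h ≤ (t : ℕ) ∧ (t : ℕ) < (j + 1) * h

lemma card_block_le (N h j : ℕ) : (block N h j).card ≤ h := by
  have : (block N h j).card ≤ (Finset.Ico (j * h) ((j + 1) * h)).card := by
    refine Finset.card_le_card_of_injOn (fun t : Fin N => (t : ℕ)) (fun t ht => ?_)
      (fun i _ j _ h => Fin.ext h)
    simpa [block] using ht
  rw [Nat.card_Ico, add_mul, one_mul, Nat.add_sub_cancel_left] at this
  exact this

/-- The piecewise polynomials with breaks at `x` and at the left end of the `j`-th block, set to
zero on that block. -/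
noncomputable def blockSpace (D N : ℕ) (x : ℝ) (h j : ℕ) :
    Submodule ℝ (EuclideanSpace ℝ (Fin N)) :=
  polySpace D N ((block N h j : Set (Fin N))ᶜ ∩ Set.univ) ⊔
    polySpace D N ((block N h j : Set (Fin N))ᶜ ∩ above N x) ⊔
    polySpace D N ((block N h j : Set (Fin N))ᶜ ∩ {t | j * h ≤ (t : ℕ)})

lemma finrank_blockSpace_le (D N : ℕ) (x : ℝ) (h j : ℕ) :
    Module.finrank ℝ (blockSpace D N x h j) ≤ 3 * D := by
  have h1 := Submodule.finrank_add_le_finrank_add_finrank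
    (polySpace D N ((block N h j : Set (Fin N))ᶜ ∩ Set.univ) ⊔
      polySpace D N ((block N h j : Set (Fin N))ᶜ ∩ above N x))
    (polySpace D N ((block N h j : Set (Fin N))ᶜ ∩ {t | j * h ≤ (t : ℕ)}))
  have h2 := Submodule.finrank_add_le_finrank_add_finrank
    (polySpace D N ((block N h j : Set (Fin N))ᶜ ∩ Set.univ))
    (polySpace D N ((block N h j : Set (Fin N))ᶜ ∩ above N x))
  have h3 := finrank_polySpace_le D N ((block N h j : Set (Fin N))ᶜ ∩ Set.univ)
  have h4 := finrank_polySpace_le D N ((block N h j : Set (Fin N))ᶜ ∩ above N x)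
  have h5 := finrank_polySpace_le D N
    ((block N h j : Set (Fin N))ᶜ ∩ {t | j * h ≤ (t : ℕ)})
  rw [blockSpace]
  omega

/-- The quantity that controls the inner products of the vector `v` with splines with an arbitrary
second knot: the block of length `h` containing the knot contributes the norm of `v` on the block,
which is bounded by truncation at `κ`, and the remaining indices a projection. -/
noncomputable def gridNorm (D : ℕ) (x : ℝ) (h G : ℕ) (κ : ℝ) {N : ℕ}
    (v : EuclideanSpace ℝ (Fin N)) : ℝ :=
  2 * (∑ j ∈ Finset.range (G + 1), ‖(blockSpace D N x h j).starProjection v‖ ^ 2 +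
    (h * κ + ∑ t, max (v t ^ 2 - κ) 0))

lemma twoKnotBound_of_gridNorm_le {D N h G : ℕ} {x κ B : ℝ} (hh : 1 ≤ h) (hG : N ≤ G * h)
    (hκ : 0 ≤ κ) (hB : 0 ≤ B) (v : EuclideanSpace ℝ (Fin N)) (hv : gridNorm D x h G κ v ≤ B ^ 2) :
    TwoKnotBound D x v B := by
  intro y hy f₁ hf₁ f₂ hf₂ f₃ hf₃
  set u := evalOn N Set.univ f₁ + evalOn N (above N x) f₂ + evalOn N (above N y) f₃ with hu
  set k := ⌊(N : ℝ) * y⌋₊ with hk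
  set j := k / h with hj
  have hjk : j * h ≤ k := Nat.div_mul_le_self k h
  have hkj : k < (j + 1) * h := by
    have := Nat.lt_mul_div_succ k (show 0 < h by omega)
    rwa [mul_comm] at this
  have hjG : j ≤ G := by
    refine Nat.div_le_of_le_mul ?_
    rw [mul_comm]
    exact (floor_mul_le hy.2.le).trans hG
  set S : Set (Fin N) := (block N h j : Set (Fin N)) with hS
  -- Off its block the knot `y` can be moved to the left end of the block, so that only finitely
  -- many spaces of splines occur.
  have hmem : restrictTo Sᶜ u ∈ blockSpace D N x h j := by
    have hset : Sᶜ ∩ above N y = Sᶜ ∩ {t | j * h ≤ (t : ℕ)} := by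
      ext t
      have := lt_designPoint_iff t hy.1.le
      simp only [hS, block, above, Finset.coe_filter, Finset.mem_univ, true_and, Set.mem_inter_iff,
        Set.mem_compl_iff, Set.mem_ofPred_eq, this, ← hk]
      omega
    rw [hu, restrictTo_add, restrictTo_add, restrictTo_evalOn, restrictTo_evalOn,
      restrictTo_evalOn, hset]
    exact Submodule.add_mem_sup (Submodule.add_mem_sup (evalOn_mem_polySpace _ hf₁)
      (evalOn_mem_polySpace _ hf₂)) (evalOn_mem_polySpace _ hf₃)
  set a := ‖(blockSpace D N x h j).starProjection v‖ with ha
  set b := ‖restrictTo S v‖ with hb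
  have h1 : |⟪v, restrictTo Sᶜ u⟫| ≤ a * ‖u‖ :=
    (abs_inner_le_norm_starProjection_mul _ v hmem).trans
      (mul_le_mul_of_nonneg_left (norm_restrictTo_le _ _) (norm_nonneg _))
  have h2 : |⟪v, restrictTo S u⟫| ≤ b * ‖u‖ := by
    rw [inner_restrictTo (le_refl S)]
    exact (abs_real_inner_le_norm _ _).trans
      (mul_le_mul_of_nonneg_left (norm_restrictTo_le _ _) (norm_nonneg _))
  have h3 : b ^ 2 ≤ h * κ + ∑ t, max (v t ^ 2 - κ) 0 := by
    rw [hb, hS, norm_restrictTo_sq]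
    calc ∑ t ∈ block N h j, v t ^ 2 ≤ ∑ t ∈ block N h j, (κ + max (v t ^ 2 - κ) 0) :=
          Finset.sum_le_sum fun t _ => by linarith [le_max_left (v t ^ 2 - κ) 0]
      _ = (block N h j).card * κ + ∑ t ∈ block N h j, max (v t ^ 2 - κ) 0 := by
          rw [Finset.sum_add_distrib]; simp
      _ ≤ _ := add_le_add
          (mul_le_mul_of_nonneg_right (by exact_mod_cast card_block_le N h j) hκ)
          (Finset.sum_le_sum_of_subset_of_nonneg (Finset.subset_univ _)
            fun _ _ _ => le_max_right _ _)
  have h4 : a ^ 2 ≤ ∑ j ∈ Finset.range (G + 1), ‖(blockSpace D N x h j).starProjection v‖ ^ 2 :=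
    Finset.single_le_sum (f := fun j => ‖(blockSpace D N x h j).starProjection v‖ ^ 2)
      (fun _ _ => sq_nonneg _) (Finset.mem_range.2 (Nat.lt_succ_of_le hjG))
  have h5 : a + b ≤ B := by
    refine le_of_sq_le_sq ?_ hB
    rw [gridNorm] at hv
    have := add_sq_le (a := a) (b := b)
    linarith
  have h6 : ⟪v, u⟫ = ⟪v, restrictTo S u⟫ + ⟪v, restrictTo Sᶜ u⟫ := by
    rw [← inner_add_right, restrictTo_add_compl]
  rw [h6]
  calc _ ≤ _ := abs_add_le _ _
    _ ≤ (a + b) * ‖u‖ := by linarith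
    _ ≤ _ := mul_le_mul_of_nonneg_right h5 (norm_nonneg _)

/-! ### Probabilities of the noise bounds -/

section NoiseBounds

variable {Ω : Type*} [MeasurableSpace Ω]

/-- An array of square integrable noise vectors whose linear functionals are of order `√N / r`
relative to the norm, and whose squares are uniformly integrable. The rate `r` tends to infinity
and is at most `√N`, the rate for independent noise. -/
structure IsRegularNoise (P : Measure Ω) (e : ∀ N : ℕ, Ω → EuclideanSpace ℝ (Fin N))
    (r : ℕ → ℝ) : Prop where
  memLp : ∀ N t, MemLp (fun ω => e N ω t) 2 P
  variance_le : ∃ C : ℝ, 0 ≤ C ∧ ∀ᶠ N : ℕ in atTop, ∀ g : EuclideanSpace ℝ (Fin N),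
    ∫ ω, ⟪g, e N ω⟫ ^ 2 ∂P ≤ C * (N / r N ^ 2) * ‖g‖ ^ 2
  unifIntegrable : ∀ ε : ℝ, 0 < ε → ∃ κ : ℝ, 0 ≤ κ ∧ ∀ N t,
    ∫ ω, max (e N ω t ^ 2 - κ) 0 ∂P ≤ ε
  tendsto_rate : Tendsto r atTop atTop
  rate_le : ∀ᶠ N : ℕ in atTop, r N ≤ √N

variable {P : Measure Ω} {e : ∀ N : ℕ, Ω → EuclideanSpace ℝ (Fin N)} {r : ℕ → ℝ}

lemma IsRegularNoise.integrable_excess [IsFiniteMeasure P] (he : IsRegularNoise P e r) (κ : ℝ)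
    (N : ℕ) (t : Fin N) :
    Integrable (fun ω => max (e N ω t ^ 2 - κ) 0) P :=
  ((he.memLp N t).integrable_sq.sub (integrable_const κ)).sup (integrable_const 0)

variable [IsProbabilityMeasure P]

lemma IsRegularNoise.exists_second_moment_le (he : IsRegularNoise P e r) :
    ∃ C₀ : ℝ, 0 ≤ C₀ ∧ ∀ N t, ∫ ω, e N ω t ^ 2 ∂P ≤ C₀ := by
  obtain ⟨κ, hκ, h⟩ := he.unifIntegrable 1 one_pos
  refine ⟨κ + 1, by linarith, fun N t => ?_⟩
  calc ∫ ω, e N ω t ^ 2 ∂P ≤ ∫ ω, (κ + max (e N ω t ^ 2 - κ) 0) ∂P := by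
        refine integral_mono (he.memLp N t).integrable_sq
          ((integrable_const κ).add (he.integrable_excess κ N t)) fun ω => ?_
        have := le_max_left (e N ω t ^ 2 - κ) 0
        simp only
        linarith
    _ = κ + ∫ ω, max (e N ω t ^ 2 - κ) 0 ∂P := by
        rw [integral_add (integrable_const κ) (he.integrable_excess κ N t)]; simp
    _ ≤ _ := by linarith [h N t]

/-- Chebyshev's inequality for the projection of the noise onto a space of dimension at most
`2 D`. -/
lemma IsRegularNoise.oneKnotBound (he : IsRegularNoise P e r) (D : ℕ) (x : ℝ) {ξ : ℝ}
    (hξ : 0 < ξ) :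
    ∃ K : ℝ, 0 ≤ K ∧ ∀ᶠ N : ℕ in atTop,
      P {ω | ¬ OneKnotBound D x (e N ω) (K * (√N / r N))} ≤ ENNReal.ofReal ξ := by
  obtain ⟨C, hC, hvar⟩ := he.variance_le
  set K := √(2 * D * C / ξ) + 1 with hK
  have hK1 : 1 ≤ K := by rw [hK]; linarith [Real.sqrt_nonneg (2 * D * C / ξ)]
  have hK2 : 2 * D * C / ξ ≤ K ^ 2 := by
    rw [← Real.sq_sqrt (show 0 ≤ 2 * D * C / ξ by positivity)]
    exact pow_le_pow_left₀ (Real.sqrt_nonneg _) (by rw [hK]; linarith) 2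
  refine ⟨K, by linarith, ?_⟩
  filter_upwards [hvar, he.tendsto_rate.eventually_gt_atTop 0, eventually_gt_atTop 0]
    with N hN hr hN0
  have hN0' : (0 : ℝ) < N := by exact_mod_cast hN0
  set V := polySpace D N Set.univ ⊔ polySpace D N (above N x) with hV
  have hdim : (Module.finrank ℝ V : ℝ) ≤ 2 * D := by
    have h1 := Submodule.finrank_add_le_finrank_add_finrank
      (polySpace D N Set.univ) (polySpace D N (above N x))
    have h2 := finrank_polySpace_le D N Set.univ
    have h3 := finrank_polySpace_le D N (above N x)
    have h4 : Module.finrank ℝ V ≤ 2 * D := by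
      rw [hV]
      omega
    exact_mod_cast h4
  have hint := integral_norm_starProjection_sq_le (he.memLp N) hN V
  have hpos : 0 < (K * (√N / r N)) ^ 2 := by positivity
  have hsub : {ω | ¬ OneKnotBound D x (e N ω) (K * (√N / r N))} ⊆
      {ω | (K * (√N / r N)) ^ 2 < ‖V.starProjection (e N ω)‖ ^ 2} := by
    intro ω hω
    by_contra hle
    rw [Set.mem_ofPred_eq, not_lt] at hle
    refine hω fun f hf g hg => ?_
    have h1 := le_of_sq_le_sq hle (by positivity)
    exact (abs_inner_le_norm_starProjection_mul V _ (Submodule.add_mem_sup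
      (evalOn_mem_polySpace _ hf) (evalOn_mem_polySpace _ hg))).trans
      (mul_le_mul_of_nonneg_right h1 (norm_nonneg _))
  refine (measure_mono hsub).trans ((measure_lt_le_ofReal
    (integrable_norm_starProjection_sq (he.memLp N) V) (fun ω => sq_nonneg _) hpos hint).trans
    (ENNReal.ofReal_le_ofReal ?_))
  rw [div_le_iff₀ hpos, mul_pow, div_pow, Real.sq_sqrt hN0'.le]
  rw [div_le_iff₀ hξ] at hK2
  calc (Module.finrank ℝ V : ℝ) * (C * (N / r N ^ 2)) ≤ 2 * D * (C * (N / r N ^ 2)) := by gcongr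
    _ = 2 * D * C * (N / r N ^ 2) := by ring
    _ ≤ K ^ 2 * ξ * (N / r N ^ 2) := by gcongr
    _ = _ := by ring

/-- The windows on either side of `x` form two chains, both controlled by `chainNorm`. -/
lemma IsRegularNoise.windowBound (he : IsRegularNoise P e r) (D : ℕ) {x : ℝ}
    (hx : x ∈ Set.Ioo (0 : ℝ) 1) {ε : ℝ} (hε : 0 < ε) :
    Tendsto (fun N : ℕ => P {ω | ¬ WindowBound D x (e N ω) ε (N / r N)}) atTop (𝓝 0) := by
  obtain ⟨C, hC, hvar⟩ := he.variance_le
  obtain ⟨C₀, hC₀, hmom⟩ := he.exists_second_moment_le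
  set H : ℝ → ℝ := fun a => ∑' j : ℕ, 1 / ((j : ℝ) ^ 2 + a) with hH
  have hlim : Tendsto (fun N : ℕ => ENNReal.ofReal
      (2 * ((D * C + 8 * C₀) * H (r N / 2)) / (ε ^ 2 / 16))) atTop (𝓝 0) := by
    have h1 : Tendsto (fun N : ℕ => H (r N / 2)) atTop (𝓝 0) :=
      tendsto_tsum_one_div_sq_add.comp (he.tendsto_rate.atTop_div_const two_pos)
    have h2 := ((h1.const_mul (D * C + 8 * C₀)).const_mul 2).div_const (ε ^ 2 / 16)
    simpa using ENNReal.tendsto_ofReal h2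
  refine tendsto_of_tendsto_of_tendsto_of_le_of_le' tendsto_const_nhds hlim
    (Eventually.of_forall fun _ => zero_le) ?_
  filter_upwards [hvar, he.tendsto_rate.eventually_ge_atTop 2, he.rate_le, eventually_gt_atTop 0]
    with N hN hr hrN hN0
  have hN0' : (0 : ℝ) < N := by exact_mod_cast hN0
  have hr0 : 0 < r N := by linarith
  have hr2 : r N ^ 2 ≤ N := by
    rw [← Real.sq_sqrt hN0'.le]
    exact pow_le_pow_left₀ hr0.le hrN 2
  have hq : 1 ≤ (N : ℝ) / r N ^ 2 := (one_le_div (by positivity)).2 hr2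
  -- `N / r²` is the number of indices over which the variance bound is no better than the
  -- Cauchy-Schwarz inequality; it is the unit of the grid.
  set l := ⌈(N : ℝ) / r N ^ 2⌉₊ with hl
  have hl1 : (N : ℝ) / r N ^ 2 ≤ l := Nat.le_ceil _
  have hl2 : (l : ℝ) ≤ 2 * (N / r N ^ 2) := by
    have := (Nat.ceil_lt_add_one (show 0 ≤ (N : ℝ) / r N ^ 2 by positivity)).le
    linarith
  have hl3 : 1 ≤ l := by exact_mod_cast hq.trans hl1
  have hn₀ : 1 ≤ (N : ℝ) / r N := by
    rw [one_le_div hr0]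
    nlinarith
  have han : l * (r N / 2) ≤ N / r N := by
    calc l * (r N / 2) ≤ 2 * (N / r N ^ 2) * (r N / 2) := by gcongr
      _ = _ := by field_simp
  have hB : ∀ g : EuclideanSpace ℝ (Fin N), ∫ ω, ⟪g, e N ω⟫ ^ 2 ∂P ≤ C * l * ‖g‖ ^ 2 := fun g =>
    (hN g).trans (by gcongr)
  set m := ⌊(N : ℝ) * x⌋₊ with hm
  have hi1 := integral_chainNorm_le (he.memLp N) hC hC₀ hl3 hB (hmom N) D
    (card_rightChain_sdiff_le N m) (show 1 ≤ r N / 2 by linarith) han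
  have hi2 := integral_chainNorm_le (he.memLp N) hC hC₀ hl3 hB (hmom N) D
    (card_leftChain_sdiff_le N m) (show 1 ≤ r N / 2 by linarith) han
  have hI1 := integrable_chainNorm (he.memLp N) D (rightChain N m) l (N / r N)
  have hI2 := integrable_chainNorm (he.memLp N) D (leftChain N m) l (N / r N)
  have hsub : {ω | ¬ WindowBound D x (e N ω) ε (N / r N)} ⊆
      {ω | ε ^ 2 / 16 < chainNorm D (rightChain N m) l (N / r N) (e N ω) +
        chainNorm D (leftChain N m) l (N / r N) (e N ω)} := by
    intro ω hω
    by_contra hle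
    rw [Set.mem_ofPred_eq, not_lt] at hle
    have h1 := chainNorm_nonneg D (rightChain N m) l (N / r N) (e N ω)
    have h2 := chainNorm_nonneg D (leftChain N m) l (N / r N) (e N ω)
    exact hω (windowBound_of_chainNorm_le hx hl3 hn₀ hε.le _ (by linarith) (by linarith))
  refine (measure_mono hsub).trans (measure_lt_le_ofReal (hI1.add hI2) (fun ω => add_nonneg
    (chainNorm_nonneg _ _ _ _ _) (chainNorm_nonneg _ _ _ _ _)) (by positivity) ?_)
  rw [integral_add' hI1 hI2]
  linarith

/-- A fixed number of blocks suffices: the truncated noise on a block of length `N / G` has squared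
norm at most `κ N / G`, and the remaining excess is small by uniform integrability. -/
lemma IsRegularNoise.twoKnotBound (he : IsRegularNoise P e r) (D : ℕ) (x : ℝ) {ε : ℝ}
    (hε : 0 < ε) :
    Tendsto (fun N : ℕ => P {ω | ¬ TwoKnotBound D x (e N ω) (ε * √N)}) atTop (𝓝 0) := by
  obtain ⟨C, hC, hvar⟩ := he.variance_le
  rw [ENNReal.tendsto_nhds_zero]
  intro ξ hξ
  obtain ⟨ξ', hξ'0, hξ'⟩ := ENNReal.lt_iff_exists_real_btwn.1 hξ
  have hξ'' : 0 < ξ' := ENNReal.ofReal_pos.1 hξ'.1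
  set ε₀ := ξ' * ε ^ 2 / 8 with hε₀
  have hε₀0 : 0 < ε₀ := by positivity
  obtain ⟨κ, hκ, hexc⟩ := he.unifIntegrable ε₀ hε₀0
  obtain ⟨G, hG⟩ := exists_nat_gt (κ / ε₀)
  have hG0 : (0 : ℝ) < G := lt_of_le_of_lt (by positivity) hG
  have hGκ : κ / G ≤ ε₀ := by
    rw [div_lt_iff₀ hε₀0] at hG
    rw [div_le_iff₀ hG0]
    linarith
  have hlim : Tendsto (fun N : ℕ => (G + 1) * (3 * D * C) / r N ^ 2 + κ / N) atTop (𝓝 0) := by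
    have h1 : Tendsto (fun N : ℕ => (G + 1) * (3 * D * C) / r N ^ 2) atTop (𝓝 0) :=
      ((tendsto_pow_atTop two_ne_zero).comp he.tendsto_rate).const_div_atTop _
    have h2 : Tendsto (fun N : ℕ => κ / (N : ℝ)) atTop (𝓝 0) :=
      tendsto_natCast_atTop_atTop.const_div_atTop _
    simpa using h1.add h2
  filter_upwards [hvar, he.tendsto_rate.eventually_gt_atTop 0, eventually_gt_atTop 0,
    hlim.eventually (gt_mem_nhds hε₀0)] with N hN hr hN0 hsmall
  have hN0' : (0 : ℝ) < N := by exact_mod_cast hN0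
  set h := ⌈(N : ℝ) / G⌉₊ with hh
  have hh1 : (N : ℝ) / G ≤ h := Nat.le_ceil _
  have hh2 : (h : ℝ) ≤ N / G + 1 := (Nat.ceil_lt_add_one (by positivity)).le
  have hh3 : 1 ≤ h := Nat.ceil_pos.2 (by positivity)
  have hGh : N ≤ G * h := by
    rw [div_le_iff₀ hG0] at hh1
    rw [mul_comm]
    exact_mod_cast hh1
  have hproj := fun j => integrable_norm_starProjection_sq (he.memLp N) (blockSpace D N x h j)
  have hex := he.integrable_excess κ N
  have hsum1 := integrable_finsetSum (Finset.range (G + 1)) fun j _ => hproj j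
  have hsum2 := integrable_finsetSum Finset.univ fun t _ => hex t
  have hsum3 : Integrable (fun ω => (h : ℝ) * κ + ∑ t, max (e N ω t ^ 2 - κ) 0) P :=
    (integrable_const _).add hsum2
  have hint : Integrable (fun ω => gridNorm D x h G κ (e N ω)) P :=
    (hsum1.add hsum3).const_mul 2
  have hnn : ∀ v : EuclideanSpace ℝ (Fin N), 0 ≤ gridNorm D x h G κ v := fun v => by
    have : 0 ≤ ∑ t, max (v t ^ 2 - κ) 0 := Finset.sum_nonneg fun t _ => le_max_right _ _
    unfold gridNorm
    positivity
  have hval : ∫ ω, gridNorm D x h G κ (e N ω) ∂P ≤ N * (6 * ε₀) := by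
    have h1 : ∫ ω, ∑ j ∈ Finset.range (G + 1),
        ‖(blockSpace D N x h j).starProjection (e N ω)‖ ^ 2 ∂P ≤
        (G + 1) * (3 * D * (C * (N / r N ^ 2))) := by
      rw [integral_finsetSum _ fun j _ => hproj j]
      calc _ ≤ ∑ _j ∈ Finset.range (G + 1), 3 * D * (C * (N / r N ^ 2)) := by
            refine Finset.sum_le_sum fun j _ =>
              (integral_norm_starProjection_sq_le (he.memLp N) hN _).trans
                (mul_le_mul_of_nonneg_right ?_ (by positivity))
            exact_mod_cast finrank_blockSpace_le D N x h j
        _ = _ := by simp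
    have h2 : ∫ ω, ∑ t, max (e N ω t ^ 2 - κ) 0 ∂P ≤ N * ε₀ := by
      rw [integral_finsetSum _ fun t _ => hex t]
      calc _ ≤ ∑ _t : Fin N, ε₀ := Finset.sum_le_sum fun t _ => hexc N t
        _ = _ := by simp
    have h3 : (h : ℝ) * κ ≤ N * (κ / G + κ / N) := by
      calc (h : ℝ) * κ ≤ (N / G + 1) * κ := by gcongr
        _ = _ := by field_simp
    unfold gridNorm
    rw [integral_const_mul, integral_add hsum1 hsum3,
      integral_add (integrable_const _) hsum2, integral_const, probReal_univ, one_smul]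
    have h4 : (G + 1) * (3 * D * (C * (N / r N ^ 2))) = N * ((G + 1) * (3 * D * C) / r N ^ 2) := by
      ring
    have h5 := mul_le_mul_of_nonneg_left hsmall.le hN0'.le
    have h6 := mul_le_mul_of_nonneg_left hGκ hN0'.le
    linarith
  have hsub : {ω | ¬ TwoKnotBound D x (e N ω) (ε * √N)} ⊆
      {ω | (ε * √N) ^ 2 < gridNorm D x h G κ (e N ω)} := by
    intro ω hω
    by_contra hle
    rw [Set.mem_ofPred_eq, not_lt] at hle
    exact hω (twoKnotBound_of_gridNorm_le hh3 hGh hκ (by positivity) _ hle)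
  refine (measure_mono hsub).trans ((measure_lt_le_ofReal hint (fun ω => hnn _)
    (by positivity) hval).trans (le_trans (ENNReal.ofReal_le_ofReal ?_) hξ'.2.le))
  rw [div_le_iff₀ (by positivity), mul_pow, Real.sq_sqrt hN0'.le, hε₀]
  have : 0 ≤ N * (ξ' * ε ^ 2) := by positivity
  linarith

end NoiseBounds

/-! ### Linear combinations of orthonormal vectors -/

lemma norm_sum_smul_orthonormal {H ι : Type*} [NormedAddCommGroup H] [InnerProductSpace ℝ H]
    {v : ι → H} (hv : Orthonormal ℝ v) (s : Finset ι) (c : ι → ℝ) :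
    ‖∑ i ∈ s, c i • v i‖ = √(∑ i ∈ s, c i ^ 2) := by
  rw [eq_comm, Real.sqrt_eq_iff_mul_self_eq (Finset.sum_nonneg fun _ _ => sq_nonneg _)
    (norm_nonneg _), ← real_inner_self_eq_norm_mul_norm, hv.inner_sum]
  exact Finset.sum_congr rfl fun i _ => by simp [sq]

/-- Linear functionals of a filtered orthonormal sequence. The filter is split into a part
measured in `ℓ¹`, for which all shifts contribute orthogonally, and a part measured in `ℓ²`. -/
lemma norm_sum_filter_le {H : Type*} [NormedAddCommGroup H] [InnerProductSpace ℝ H]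
    {v : ℤ → H} (hv : Orthonormal ℝ v) {N : ℕ} (g : EuclideanSpace ℝ (Fin N)) {i : Fin N → ℤ}
    (hi : Function.Injective i) (a a₁ a₂ : ℕ → ℝ) (ha : ∀ k, a k = a₁ k + a₂ k) (n : ℕ) :
    ‖∑ t, g t • ∑ k ∈ Finset.range n, a k • v (i t - k)‖ ≤
      (∑ k ∈ Finset.range n, |a₁ k| + √N * √(∑ k ∈ Finset.range n, a₂ k ^ 2)) * ‖g‖ := by
  have hg : ‖g‖ = √(∑ t, g t ^ 2) := by
    rw [EuclideanSpace.norm_eq]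
    simp
  have hsplit : ∑ t, g t • ∑ k ∈ Finset.range n, a k • v (i t - k) =
      (∑ k ∈ Finset.range n, a₁ k • ∑ t, g t • v (i t - k)) +
      ∑ t, g t • ∑ k ∈ Finset.range n, a₂ k • v (i t - k) := by
    have : ∑ k ∈ Finset.range n, a₁ k • ∑ t, g t • v (i t - k) =
        ∑ t, g t • ∑ k ∈ Finset.range n, a₁ k • v (i t - k) := by
      simp only [Finset.smul_sum]
      rw [Finset.sum_comm]
      exact Finset.sum_congr rfl fun t _ => Finset.sum_congr rfl fun k _ => smul_comm _ _ _
    rw [this, ← Finset.sum_add_distrib]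
    refine Finset.sum_congr rfl fun t _ => ?_
    rw [← smul_add, ← Finset.sum_add_distrib]
    simp only [ha, add_smul]
  rw [hsplit, add_mul]
  refine (norm_add_le _ _).trans (add_le_add ?_ ?_)
  · rw [Finset.sum_mul]
    refine (norm_sum_le _ _).trans (Finset.sum_le_sum fun k _ => ?_)
    have hinj : Function.Injective fun t => i t - (k : ℤ) := fun s t hst => hi (by simpa using hst)
    have h := norm_sum_smul_orthonormal (hv.comp _ hinj) Finset.univ fun t => g t
    rw [norm_smul, hg, Real.norm_eq_abs]
    exact (congrArg (|a₁ k| * ·) h).le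
  · calc _ ≤ ∑ t, ‖g t • ∑ k ∈ Finset.range n, a₂ k • v (i t - k)‖ := norm_sum_le _ _
      _ = ∑ t, |g t| * √(∑ k ∈ Finset.range n, a₂ k ^ 2) := by
        refine Finset.sum_congr rfl fun t _ => ?_
        have hinj : Function.Injective fun k : ℕ => i t - (k : ℤ) := fun s t hst => by
          simpa using hst
        rw [norm_smul, Real.norm_eq_abs]
        congr 1
        exact norm_sum_smul_orthonormal (hv.comp _ hinj) (Finset.range n) a₂
      _ = (∑ t, |g t|) * √(∑ k ∈ Finset.range n, a₂ k ^ 2) := (Finset.sum_mul _ _ _).symm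
      _ ≤ (√N * ‖g‖) * √(∑ k ∈ Finset.range n, a₂ k ^ 2) := by
        refine mul_le_mul_of_nonneg_right ?_ (Real.sqrt_nonneg _)
        rw [hg, ← Real.sqrt_mul N.cast_nonneg]
        refine Real.le_sqrt_of_sq_le ?_
        have := sq_sum_le_card_mul_sum_sq (s := Finset.univ) (f := fun t => |g t|)
        simpa using this
      _ = _ := by ring

/-! ### Filtered innovations -/

section Innovations

variable {Ω : Type*} [MeasurableSpace Ω] {P : Measure Ω} {ζ : ℤ → Ω → ℝ}

lemma norm_sq_toLp {f : Ω → ℝ} (hf : MemLp f 2 P) : ‖hf.toLp f‖ ^ 2 = ∫ ω, f ω ^ 2 ∂P := by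
  rw [← real_inner_self_eq_norm_sq, L2.inner_def]
  refine integral_congr_ae ?_
  filter_upwards [hf.coeFn_toLp] with ω hω
  rw [hω]
  simp [sq]

lemma IsIIDInnovation.integral_sq (hζ : IsIIDInnovation P ζ) (j : ℤ) :
    ∫ ω, ζ j ω ^ 2 ∂P = 1 := by
  rw [← variance_of_integral_eq_zero (hζ.measurable j).aemeasurable (hζ.mean j), hζ.variance j]

/-- The innovations are orthonormal in `L²`. -/
lemma IsIIDInnovation.orthonormal (hζ : IsIIDInnovation P ζ) :
    Orthonormal ℝ fun j => (hζ.memLp j).toLp (ζ j) := by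
  constructor
  · intro j
    have h := norm_sq_toLp (hζ.memLp j)
    rw [hζ.integral_sq j] at h
    exact (pow_eq_one_iff_of_nonneg (norm_nonneg _) two_ne_zero).1 h
  · intro i j hij
    rw [L2.inner_def]
    have h1 : ∫ ω, ⟪(hζ.memLp i).toLp (ζ i) ω, (hζ.memLp j).toLp (ζ j) ω⟫ ∂P =
        ∫ ω, (ζ i * ζ j) ω ∂P := by
      refine integral_congr_ae ?_
      filter_upwards [(hζ.memLp i).coeFn_toLp, (hζ.memLp j).coeFn_toLp] with ω h1 h2
      rw [h1, h2]
      simp [mul_comm]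
    rw [h1, (hζ.indep.indepFun hij).integral_mul_eq_mul_integral
      (hζ.measurable i).aestronglyMeasurable (hζ.measurable j).aestronglyMeasurable, hζ.mean i,
      zero_mul]

lemma IsIIDInnovation.eLpNorm_eq_one (hζ : IsIIDInnovation P ζ) (j : ℤ) :
    eLpNorm (ζ j) 2 P = 1 := by
  have h := hζ.orthonormal.1 j
  rw [Lp.norm_toLp] at h
  rw [← ENNReal.toReal_eq_one_iff]
  exact h

/-- The linear process with coefficients `a` driven by the innovations `ζ`. -/
noncomputable def linearProcess (a : ℕ → ℝ) (ζ : ℤ → Ω → ℝ) (j : ℤ) (ω : Ω) : ℝ :=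
  ∑' k : ℕ, a k * ζ (j - k) ω

lemma measurable_linearProcess (hζ : IsIIDInnovation P ζ) (a : ℕ → ℝ) (j : ℤ) :
    Measurable (linearProcess a ζ j) :=
  Measurable.tsum fun k => (hζ.measurable (j - k)).const_mul (a k)

/-- An absolutely summable filter converges almost surely, since it converges in `L²` norm. -/
lemma IsIIDInnovation.ae_summable (hζ : IsIIDInnovation P ζ) {a : ℕ → ℝ}
    (ha : Summable fun k => |a k|) (j : ℤ) :
    ∀ᵐ ω ∂P, Summable fun k : ℕ => a k * ζ (j - k) ω := by
  have h := summable_norm_of_tsum_eLpNorm_ne_top (μ := P) (p := 2)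
    (f := fun (k : ℕ) ω => a k * ζ (j - k) ω) one_le_two
    (fun k => ((hζ.measurable (j - k)).const_mul (a k)).aestronglyMeasurable) ?_
  · filter_upwards [h] with ω hω using hω.of_norm
  · have : ∀ k : ℕ, eLpNorm (fun ω => a k * ζ (j - k) ω) 2 P = ‖a k‖ₑ := fun k => by
      have := eLpNorm_const_smul (a k) (ζ (j - k)) 2 P
      rw [hζ.eLpNorm_eq_one, mul_one] at this
      exact this
    simp only [this]
    exact tsum_enorm_ne_top_iff_summable_norm.2 ha

lemma sum_smul_toLp {ι : Type*} (s : Finset ι) (c : ι → ℝ) {f : ι → Ω → ℝ}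
    (hf : ∀ i, MemLp (f i) 2 P) :
    ∑ i ∈ s, c i • (hf i).toLp (f i) =
      (memLp_finsetSum s fun i _ => (hf i).const_mul (c i)).toLp
        (fun ω => ∑ i ∈ s, c i * f i ω) := by
  classical
  induction s using Finset.induction_on with
  | empty => exact (MemLp.toLp_zero _).symm
  | insert i s hi ih =>
    rw [Finset.sum_insert hi, ih, ← MemLp.toLp_const_smul, ← MemLp.toLp_add]
    refine MemLp.toLp_congr _ _ (Eventually.of_forall fun ω => ?_)
    simp [Finset.sum_insert hi]

lemma IsIIDInnovation.eLpNorm_partialSum_le (hζ : IsIIDInnovation P ζ) {a : ℕ → ℝ} {N : ℕ}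
    (g : EuclideanSpace ℝ (Fin N)) {i : Fin N → ℤ}
    (hi : Function.Injective i) (a₁ a₂ : ℕ → ℝ) (haa : ∀ k, a k = a₁ k + a₂ k) {M : ℝ} (n : ℕ)
    (hM : ∑ k ∈ Finset.range n, |a₁ k| + √N * √(∑ k ∈ Finset.range n, a₂ k ^ 2) ≤ M) :
    eLpNorm (fun ω => ∑ t, g t * ∑ k ∈ Finset.range n, a k * ζ (i t - k) ω) 2 P ≤
      ENNReal.ofReal (M * ‖g‖) := by
  have hmem : ∀ t, MemLp (fun ω => ∑ k ∈ Finset.range n, a k * ζ (i t - k) ω) 2 P := fun t =>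
    memLp_finsetSum _ fun k _ => (hζ.memLp (i t - k)).const_mul (a k)
  have hmem' : MemLp (fun ω => ∑ t, g t * ∑ k ∈ Finset.range n, a k * ζ (i t - k) ω) 2 P :=
    memLp_finsetSum _ fun t _ => (hmem t).const_mul (g t)
  have h2 : ∀ t, ∑ k ∈ Finset.range n, a k • (hζ.memLp (i t - k)).toLp (ζ (i t - k)) =
      (hmem t).toLp (fun ω => ∑ k ∈ Finset.range n, a k * ζ (i t - k) ω) := fun t =>
    sum_smul_toLp (Finset.range n) a (f := fun k : ℕ => ζ (i t - k)) fun k => hζ.memLp (i t - k)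
  have h3 : ∑ t, g t • (hmem t).toLp (fun ω => ∑ k ∈ Finset.range n, a k * ζ (i t - k) ω) =
      hmem'.toLp (fun ω => ∑ t, g t * ∑ k ∈ Finset.range n, a k * ζ (i t - k) ω) :=
    sum_smul_toLp Finset.univ (fun t => g t)
      (f := fun t ω => ∑ k ∈ Finset.range n, a k * ζ (i t - k) ω) hmem
  have h4 : ∑ t, g t • ∑ k ∈ Finset.range n, a k • (hζ.memLp (i t - k)).toLp (ζ (i t - k)) =
      hmem'.toLp (fun ω => ∑ t, g t * ∑ k ∈ Finset.range n, a k * ζ (i t - k) ω) := by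
    rw [← h3]
    exact Finset.sum_congr rfl fun t _ => by rw [h2 t]
  have h1 : ‖∑ t, g t • ∑ k ∈ Finset.range n, a k • (hζ.memLp (i t - k)).toLp (ζ (i t - k))‖ ≤
      M * ‖g‖ := (norm_sum_filter_le hζ.orthonormal g hi a a₁ a₂ haa n).trans
    (mul_le_mul_of_nonneg_right hM (norm_nonneg _))
  rw [h4, Lp.norm_toLp] at h1
  exact (ENNReal.le_ofReal_iff_toReal_le hmem'.eLpNorm_ne_top
    (ENNReal.toReal_nonneg.trans h1)).2 h1

/-- Fatou's lemma for square integrable functions. -/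
lemma memLp_and_integral_sq_le_of_tendsto {S : ℕ → Ω → ℝ} {L : Ω → ℝ} {M : ℝ}
    (hS : ∀ n, MemLp (S n) 2 P) (hL : Measurable L)
    (hlim : ∀ᵐ ω ∂P, Tendsto (fun n => S n ω) atTop (𝓝 (L ω)))
    (hM : ∀ n, eLpNorm (S n) 2 P ≤ ENNReal.ofReal M) :
    MemLp L 2 P ∧ ∫ ω, L ω ^ 2 ∂P ≤ M ^ 2 := by
  have hLnorm : eLpNorm L 2 P ≤ ENNReal.ofReal M :=
    (Lp.eLpNorm_lim_le_liminf_eLpNorm (fun n => (hS n).aestronglyMeasurable) L hlim).trans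
      (liminf_le_of_le (by isBoundedDefault) fun b hb => by
        obtain ⟨n, hn⟩ := hb.exists
        exact hn.trans (hM n))
  have hmem : MemLp L 2 P := ⟨hL.aestronglyMeasurable, hLnorm.trans_lt ENNReal.ofReal_lt_top⟩
  refine ⟨hmem, ?_⟩
  rw [← norm_sq_toLp hmem, Lp.norm_toLp]
  rcases le_total 0 M with h0 | h0
  · exact pow_le_pow_left₀ ENNReal.toReal_nonneg (ENNReal.toReal_le_of_le_ofReal h0 hLnorm) 2
  · rw [ENNReal.ofReal_of_nonpos h0, nonpos_iff_eq_zero] at hLnorm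
    rw [hLnorm]
    simpa using sq_nonneg M

/-- Linear functionals of a linear process are bounded in mean square, when the coefficients are
split into a part measured in `ℓ¹` and a part measured in `ℓ²`. -/
lemma IsIIDInnovation.linearProcess_bound (hζ : IsIIDInnovation P ζ) {a : ℕ → ℝ}
    (ha : Summable fun k => |a k|) {N : ℕ} (g : EuclideanSpace ℝ (Fin N)) {i : Fin N → ℤ}
    (hi : Function.Injective i) (a₁ a₂ : ℕ → ℝ) (haa : ∀ k, a k = a₁ k + a₂ k) {M : ℝ}
    (hM : ∀ n, ∑ k ∈ Finset.range n, |a₁ k| + √N * √(∑ k ∈ Finset.range n, a₂ k ^ 2) ≤ M) :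
    MemLp (fun ω => ∑ t, g t * linearProcess a ζ (i t) ω) 2 P ∧
      ∫ ω, (∑ t, g t * linearProcess a ζ (i t) ω) ^ 2 ∂P ≤ (M * ‖g‖) ^ 2 := by
  have hSmem : ∀ n, MemLp (fun ω => ∑ t, g t * ∑ k ∈ Finset.range n, a k * ζ (i t - k) ω) 2 P :=
    fun n => by
      have hmem : ∀ t, MemLp (fun ω => ∑ k ∈ Finset.range n, a k * ζ (i t - k) ω) 2 P := fun t =>
        memLp_finsetSum _ fun k _ => (hζ.memLp (i t - k)).const_mul (a k)
      exact memLp_finsetSum _ fun t _ => (hmem t).const_mul (g t)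
  have hlim : ∀ᵐ ω ∂P, Tendsto
      (fun n => ∑ t, g t * ∑ k ∈ Finset.range n, a k * ζ (i t - k) ω) atTop
      (𝓝 (∑ t, g t * linearProcess a ζ (i t) ω)) := by
    have h1 : ∀ᵐ ω ∂P, ∀ t, Summable fun k : ℕ => a k * ζ (i t - k) ω :=
      ae_all_iff.2 fun t => hζ.ae_summable ha (i t)
    filter_upwards [h1] with ω hω
    exact tendsto_finsetSum _ fun t _ => ((hω t).hasSum.tendsto_sum_nat).const_mul (g t)
  exact memLp_and_integral_sq_le_of_tendsto hSmem
    (Finset.measurable_fun_sum _ fun t _ => (measurable_linearProcess hζ a (i t)).const_mul (g t))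
    hlim fun n => hζ.eLpNorm_partialSum_le g hi a₁ a₂ haa n (hM n)

end Innovations

/-! ### Sums of tempered power coefficients -/

lemma sum_rpow_sub_one_le {d : ℝ} (hd : 0 < d) (hd1 : d < 1) (n : ℕ) :
    ∑ k ∈ Finset.range n, ((k : ℝ) + 1) ^ (d - 1) ≤ (n : ℝ) ^ d / d := by
  induction n with
  | zero => simp [hd.ne']
  | succ n ih =>
    rw [Finset.sum_range_succ, Nat.cast_succ]
    have hx : (0 : ℝ) < n + 1 := by positivity
    have h := rpow_one_add_le_one_add_mul_self (s := -1 / ((n : ℝ) + 1)) (p := d)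
      (by rw [le_div_iff₀ hx]; linarith [n.cast_nonneg (α := ℝ)]) hd.le hd1.le
    have h1 : (n : ℝ) ^ d = ((n : ℝ) + 1) ^ d * (1 + -1 / ((n : ℝ) + 1)) ^ d := by
      have h2 : 1 + -1 / ((n : ℝ) + 1) = n / (n + 1) := by field_simp; ring
      rw [h2, ← Real.mul_rpow hx.le (by positivity), mul_div_cancel₀ _ hx.ne']
    have h2 : ((n : ℝ) + 1) ^ (d - 1) = ((n : ℝ) + 1) ^ d / (n + 1) := by
      rw [Real.rpow_sub hx, Real.rpow_one]
    have h3 : (n : ℝ) ^ d ≤ ((n : ℝ) + 1) ^ d - d * ((n : ℝ) + 1) ^ (d - 1) := by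
      rw [h1, h2]
      calc _ ≤ ((n : ℝ) + 1) ^ d * (1 + d * (-1 / ((n : ℝ) + 1))) := by gcongr
        _ = _ := by ring
    calc _ ≤ (n : ℝ) ^ d / d + ((n : ℝ) + 1) ^ (d - 1) := by gcongr
      _ = ((n : ℝ) ^ d + d * ((n : ℝ) + 1) ^ (d - 1)) / d := by field_simp
      _ ≤ _ := by gcongr; linarith

lemma sum_tail_rpow_le {s : ℝ} (hs : 0 < s) {N : ℕ} (hN : 1 ≤ N) (n : ℕ) :
    ∑ k ∈ Finset.range n, (if k < N then 0 else ((k : ℝ) + 1) ^ (-s - 1)) ≤ (N : ℝ) ^ (-s) / s := by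
  suffices h : ∑ k ∈ Finset.range n, (if k < N then 0 else ((k : ℝ) + 1) ^ (-s - 1)) ≤
      ((N : ℝ) ^ (-s) - ((max n N : ℕ) : ℝ) ^ (-s)) / s by
    refine h.trans ?_
    gcongr
    exact sub_le_self _ (by positivity)
  induction n with
  | zero => simp
  | succ n ih =>
    rw [Finset.sum_range_succ]
    by_cases hn : n < N
    · rw [max_eq_right hn.le] at ih
      rw [if_pos hn, max_eq_right (Nat.succ_le_of_lt hn), add_zero]
      exact ih
    · push Not at hn
      rw [max_eq_left hn] at ih
      rw [if_neg (by omega), max_eq_left (by omega), Nat.cast_succ]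
      have hn0 : (0 : ℝ) < n := by exact_mod_cast (by omega : 0 < n)
      have hx : (0 : ℝ) < n + 1 := by positivity
      have h : 1 + -s * (-1 / ((n : ℝ) + 1)) ≤ (1 + -1 / ((n : ℝ) + 1)) ^ (-s) := by
        have hpos : 0 < 1 + -1 / ((n : ℝ) + 1) := by
          have h4 : 1 + -1 / ((n : ℝ) + 1) = n / (n + 1) := by field_simp; ring
          rw [h4]
          positivity
        rw [Real.rpow_def_of_pos hpos]
        have h5 := Real.log_le_sub_one_of_pos hpos
        have h6 := Real.add_one_le_exp (Real.log (1 + -1 / ((n : ℝ) + 1)) * -s)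
        nlinarith
      have h1 : (n : ℝ) ^ (-s) = ((n : ℝ) + 1) ^ (-s) * (1 + -1 / ((n : ℝ) + 1)) ^ (-s) := by
        have h2 : 1 + -1 / ((n : ℝ) + 1) = n / (n + 1) := by field_simp; ring
        rw [h2, ← Real.mul_rpow hx.le (by positivity), mul_div_cancel₀ _ hx.ne']
      have h2 : ((n : ℝ) + 1) ^ (-s - 1) = ((n : ℝ) + 1) ^ (-s) / (n + 1) := by
        rw [Real.rpow_sub hx, Real.rpow_one]
      have h3 : ((n : ℝ) + 1) ^ (-s) + s * ((n : ℝ) + 1) ^ (-s - 1) ≤ (n : ℝ) ^ (-s) := by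
        rw [h1, h2]
        calc _ = ((n : ℝ) + 1) ^ (-s) * (1 + -s * (-1 / ((n : ℝ) + 1))) := by ring
          _ ≤ _ := by gcongr
      calc _ ≤ ((N : ℝ) ^ (-s) - (n : ℝ) ^ (-s)) / s + ((n : ℝ) + 1) ^ (-s - 1) := by gcongr
        _ = ((N : ℝ) ^ (-s) - (n : ℝ) ^ (-s) + s * ((n : ℝ) + 1) ^ (-s - 1)) / s := by field_simp
        _ ≤ _ := by gcongr; linarith

lemma sum_exp_neg_mul_le {l : ℝ} (hl : 0 < l) (hl1 : l ≤ 1) (n : ℕ) :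
    ∑ k ∈ Finset.range n, Real.exp (-l * k) ≤ 2 / l := by
  have h1 : Real.exp (-l) ≤ 1 - l / 2 := by
    have h2 : Real.exp (-l) * Real.exp l = 1 := by rw [← Real.exp_add]; simp
    nlinarith [Real.add_one_le_exp l, Real.exp_pos (-l), Real.exp_pos l]
  have h3 : ∀ k : ℕ, Real.exp (-l * k) = Real.exp (-l) ^ k := fun k => by
    rw [← Real.exp_nat_mul, mul_comm]
  simp only [h3]
  have h4 : Real.exp (-l) < 1 := by linarith
  refine ((summable_geometric_of_lt_one (Real.exp_pos _).le h4).sum_le_tsum _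
    fun k _ => by positivity).trans ?_
  rw [tsum_geometric_of_lt_one (Real.exp_pos _).le h4, ← one_div, div_le_div_iff₀ (by linarith) hl]
  linarith

/-- Exponential tempering at rate `l` cuts the sum of `(k + 1) ^ (d - 1)` off at scale `1 / l`. -/
lemma sum_exp_mul_rpow_le {d : ℝ} (hd : 0 < d) (hd1 : d < 1) {l : ℝ} (hl : 0 < l) (hl1 : l ≤ 1)
    (n : ℕ) :
    ∑ k ∈ Finset.range n, Real.exp (-l * k) * ((k : ℝ) + 1) ^ (d - 1) ≤
      (2 ^ d / d + 2) * l ^ (-d) := by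
  set M := ⌈1 / l⌉₊ with hMdef
  have hM1 : 1 / l ≤ M := Nat.le_ceil _
  have hM2 : (M : ℝ) ≤ 2 / l := by
    have h1 := (Nat.ceil_lt_add_one (by positivity : 0 ≤ 1 / l)).le
    have h2 : 1 ≤ 1 / l := by rw [le_div_iff₀ hl]; linarith
    calc (M : ℝ) ≤ 1 / l + 1 := h1
      _ ≤ 1 / l + 1 / l := by gcongr
      _ = 2 / l := by ring
  have hterm : ∀ k : ℕ, Real.exp (-l * k) * ((k : ℝ) + 1) ^ (d - 1) ≤
      (if k < M then ((k : ℝ) + 1) ^ (d - 1) else 0) + l ^ (1 - d) * Real.exp (-l * k) := by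
    intro k
    split_ifs with hk
    · have : Real.exp (-l * k) ≤ 1 := Real.exp_le_one_iff.2 (by
        have : 0 ≤ l * k := by positivity
        linarith)
      have h5 : 0 ≤ l ^ (1 - d) * Real.exp (-l * k) := by positivity
      have h6 : Real.exp (-l * k) * ((k : ℝ) + 1) ^ (d - 1) ≤ 1 * ((k : ℝ) + 1) ^ (d - 1) := by
        gcongr
      linarith
    · push Not at hk
      rw [zero_add, mul_comm]
      gcongr
      have h5 : 1 / l ≤ (k : ℝ) + 1 := by
        have : (M : ℝ) ≤ k := by exact_mod_cast hk
        linarith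
      calc ((k : ℝ) + 1) ^ (d - 1) ≤ (1 / l) ^ (d - 1) :=
            Real.rpow_le_rpow_of_nonpos (by positivity) h5 (by linarith)
        _ = l ^ (1 - d) := by
            rw [one_div, Real.inv_rpow hl.le, ← Real.rpow_neg hl.le]
            congr 1; ring
  have hfirst : ∑ k ∈ Finset.range n, (if k < M then ((k : ℝ) + 1) ^ (d - 1) else 0) ≤
      2 ^ d / d * l ^ (-d) := by
    calc _ = ∑ k ∈ (Finset.range n).filter (· < M), ((k : ℝ) + 1) ^ (d - 1) :=
          (Finset.sum_filter _ _).symm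
      _ ≤ ∑ k ∈ Finset.range M, ((k : ℝ) + 1) ^ (d - 1) :=
          Finset.sum_le_sum_of_subset_of_nonneg (fun k hk => by simp_all) fun _ _ _ => by positivity
      _ ≤ (M : ℝ) ^ d / d := sum_rpow_sub_one_le hd hd1 M
      _ ≤ (2 / l) ^ d / d := by gcongr
      _ = _ := by
          rw [Real.div_rpow zero_le_two hl.le, Real.rpow_neg hl.le]
          field_simp
  calc _ ≤ ∑ k ∈ Finset.range n, ((if k < M then ((k : ℝ) + 1) ^ (d - 1) else 0) +
        l ^ (1 - d) * Real.exp (-l * k)) := Finset.sum_le_sum fun k _ => hterm k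
    _ = _ := Finset.sum_add_distrib
    _ ≤ 2 ^ d / d * l ^ (-d) + l ^ (1 - d) * (2 / l) := by
        rw [← Finset.mul_sum]
        gcongr
        exact sum_exp_neg_mul_le hl hl1 n
    _ = _ := by
        have : l ^ (1 - d) = l * l ^ (-d) := by
          rw [sub_eq_add_neg, Real.rpow_add hl, Real.rpow_one]
        rw [this]
        field_simp

lemma IsTemperedCoeff.exists_bound {d : ℝ} (hd1 : d < 1) {b : ℕ → ℝ} (hb : IsTemperedCoeff d b) :
    ∃ C, 0 < C ∧ ∀ k, |b k| ≤ C * ((k : ℝ) + 1) ^ (d - 1) := by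
  obtain ⟨c, -, hbc⟩ := hb
  have h1 : b =O[atTop] fun k : ℕ => ((k : ℝ) + 1) ^ (d - 1) := by
    refine hbc.isBigO.trans ((IsBigO.of_bound (2 ^ (1 - d)) ?_).const_mul_left _)
    filter_upwards [eventually_ge_atTop 1] with k hk
    have hk' : (1 : ℝ) ≤ k := by exact_mod_cast hk
    rw [Real.norm_of_nonneg (by positivity), Real.norm_of_nonneg (by positivity)]
    have h2 : (2 * (k : ℝ)) ^ (d - 1) ≤ ((k : ℝ) + 1) ^ (d - 1) :=
      Real.rpow_le_rpow_of_nonpos (by positivity) (by linarith) (by linarith)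
    have h3 : (2 : ℝ) ^ (1 - d) * 2 ^ (d - 1) = 1 := by
      rw [← Real.rpow_add two_pos]; simp
    calc (k : ℝ) ^ (d - 1) = 2 ^ (1 - d) * (2 * (k : ℝ)) ^ (d - 1) := by
          rw [Real.mul_rpow zero_le_two (by positivity), ← mul_assoc, h3, one_mul]
      _ ≤ _ := by gcongr
  obtain ⟨C, hC, h⟩ := bound_of_isBigO_nat_atTop h1
  refine ⟨C, hC, fun k => ?_⟩
  have hk : (0 : ℝ) < ((k : ℝ) + 1) ^ (d - 1) := by positivity
  simpa [abs_of_pos hk] using h (x := k) hk.ne'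

lemma summable_exp_mul {b : ℕ → ℝ} {B : ℝ} (hb : ∀ k, |b k| ≤ B) {l : ℝ} (hl : 0 < l) :
    Summable fun k : ℕ => |Real.exp (-l * k) * b k| := by
  have h3 : ∀ k : ℕ, Real.exp (-l * k) = Real.exp (-l) ^ k := fun k => by
    rw [← Real.exp_nat_mul, mul_comm]
  refine Summable.of_nonneg_of_le (fun _ => abs_nonneg _) (fun k => ?_)
    ((summable_geometric_of_lt_one (Real.exp_pos (-l)).le
      (by simpa using hl)).mul_right B)
  rw [abs_mul, Real.abs_exp, h3]
  gcongr
  exact hb k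

/-! ### Regularity of tempered linear processes -/

lemma linearProcess_split {Ω : Type*} {ζ : ℤ → Ω → ℝ} {a : ℕ → ℝ} {j : ℤ} {ω : Ω}
    (hs : Summable fun k : ℕ => a k * ζ (j - k) ω) (m : ℕ) :
    linearProcess a ζ j ω = ∑ k ∈ Finset.range m, a k * ζ (j - k) ω +
      linearProcess (fun k => if k < m then 0 else a k) ζ j ω := by
  have h1 : HasSum (fun k : ℕ => if k < m then a k * ζ (j - k) ω else 0)
      (∑ k ∈ Finset.range m, a k * ζ (j - k) ω) := by
    have h : HasSum (fun k : ℕ => if k < m then a k * ζ (j - k) ω else 0)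
        (∑ k ∈ Finset.range m, if k < m then a k * ζ (j - k) ω else 0) :=
      hasSum_sum_of_ne_finset_zero fun k hk => if_neg (by simpa using hk)
    rwa [Finset.sum_congr rfl fun k hk => if_pos (Finset.mem_range.1 hk)] at h
  have h2 := hs.hasSum.sub h1
  have h3 : ∀ k : ℕ, a k * ζ (j - k) ω - (if k < m then a k * ζ (j - k) ω else 0) =
      (if k < m then 0 else a k) * ζ (j - k) ω := fun k => by
    split_ifs <;> ring
  simp only [h3] at h2
  have h4 := h2.tsum_eq
  unfold linearProcess
  linarith

/-- The tails of a convergent series, in terms of finite sums. -/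
lemma sum_tail_le {f : ℕ → ℝ} (hf : Summable f) (hf0 : ∀ k, 0 ≤ f k) {ε : ℝ} (hε : 0 < ε) :
    ∃ m, ∀ n, ∑ k ∈ Finset.range n, (if k < m then 0 else f k) ≤ ε := by
  obtain ⟨m, hm⟩ :=
    (hf.hasSum.tendsto_sum_nat.eventually_const_lt (sub_lt_self _ hε)).exists
  refine ⟨m, fun n => ?_⟩
  have hdisj : Disjoint ((Finset.range n).filter fun k => ¬ k < m) (Finset.range m) := by
    rw [Finset.disjoint_left]
    intro k hk hk'
    exact (Finset.mem_filter.1 hk).2 (Finset.mem_range.1 hk')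
  have h1 := hf.sum_le_tsum (((Finset.range n).filter fun k => ¬ k < m) ∪ Finset.range m)
    fun k _ => hf0 k
  rw [Finset.sum_union hdisj, Finset.sum_filter] at h1
  simp only [ite_not] at h1
  linarith

section Regularity

variable {Ω : Type*} [MeasurableSpace Ω] {P : Measure Ω} {ζ : ℤ → Ω → ℝ}

lemma IsIIDInnovation.exists_integral_excess_le (hζ : IsIIDInnovation P ζ) {ε : ℝ} (hε : 0 < ε) :
    ∃ κ, 0 ≤ κ ∧ ∀ j, ∫ ω, max (ζ j ω ^ 2 - κ) 0 ∂P ≤ ε := by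
  have hlim : Tendsto (fun n : ℕ => ∫ ω, max (ζ 0 ω ^ 2 - n) 0 ∂P) atTop (𝓝 (∫ _, 0 ∂P)) := by
    refine tendsto_integral_of_dominated_convergence (fun ω => ζ 0 ω ^ 2) (fun n => ?_)
      (hζ.memLp 0).integrable_sq (fun n => Eventually.of_forall fun ω => ?_)
      (Eventually.of_forall fun ω => ?_)
    · exact ((((hζ.measurable 0).pow_const 2).sub_const _).max
        measurable_const).aestronglyMeasurable
    · rw [Real.norm_of_nonneg (le_max_right _ _)]
      exact max_le (by linarith [n.cast_nonneg (α := ℝ)]) (sq_nonneg _)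
    · refine tendsto_const_nhds.congr' ?_
      filter_upwards [eventually_ge_atTop ⌈ζ 0 ω ^ 2⌉₊] with n hn
      exact (max_eq_right (by linarith [Nat.ceil_le.1 hn])).symm
  rw [integral_zero] at hlim
  obtain ⟨n, hn⟩ := (hlim.eventually_le_const hε).exists
  refine ⟨n, n.cast_nonneg, fun j => ?_⟩
  have h := ((hζ.identDistrib j 0).comp
    (((measurable_id.pow_const 2).sub_const (n : ℝ)).max measurable_const :
      Measurable fun x : ℝ => max (x ^ 2 - n) 0)).integral_eq
  exact (h.trans_le hn :)

lemma IsIIDInnovation.memLp_linearProcess (hζ : IsIIDInnovation P ζ) {a : ℕ → ℝ}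
    (ha : Summable fun k => |a k|) {T : ℝ} (hT : ∀ n, ∑ k ∈ Finset.range n, a k ^ 2 ≤ T) (j : ℤ) :
    MemLp (linearProcess a ζ j) 2 P ∧ ∫ ω, linearProcess a ζ j ω ^ 2 ∂P ≤ T := by
  have hT0 : 0 ≤ T := by simpa using hT 0
  have h := hζ.linearProcess_bound ha (WithLp.toLp 2 fun _ : Fin 1 => (1 : ℝ))
    (i := fun _ => j) (Function.injective_of_subsingleton _) (fun _ => 0) a
    (fun k => (zero_add _).symm) (M := √T) (fun n => by simpa using Real.sqrt_le_sqrt (hT n))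
  have h1 : ‖WithLp.toLp 2 fun _ : Fin 1 => (1 : ℝ)‖ = 1 := by
    simp [EuclideanSpace.norm_eq]
  rw [h1, mul_one, Real.sq_sqrt hT0] at h
  simpa using h

/-- Linear processes with coefficients dominated by a fixed square summable sequence are uniformly
square integrable. The head of the series is a finite sum of innovations and inherits their
integrability; the tail is small in mean square. -/
lemma IsIIDInnovation.exists_integral_linearProcess_excess_le [IsProbabilityMeasure P]
    (hζ : IsIIDInnovation P ζ) {β : ℕ → ℝ}
    (hβ : Summable fun k => β k ^ 2) {ε : ℝ} (hε : 0 < ε) :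
    ∃ κ, 0 ≤ κ ∧ ∀ a : ℕ → ℝ, (Summable fun k => |a k|) → (∀ k, |a k| ≤ β k) → ∀ j,
      ∫ ω, max (linearProcess a ζ j ω ^ 2 - κ) 0 ∂P ≤ ε := by
  -- The first `m` terms form the head; `A = 2 m T` comes from `(u + v)² ≤ 2 u² + 2 v²` and the
  -- Cauchy-Schwarz inequality for a sum of `m` terms with coefficients at most `√T`.
  obtain ⟨m, hm⟩ := sum_tail_le hβ (fun k => sq_nonneg _) (by positivity : 0 < ε / 4)
  set T := ∑' k, β k ^ 2 with hTdef
  have hT0 : 0 ≤ T := tsum_nonneg fun k => sq_nonneg _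
  set A : ℝ := 2 * m * T with hA
  have hA0 : 0 ≤ A := by positivity
  obtain ⟨κ, hκ0, hκ⟩ := hζ.exists_integral_excess_le (by positivity : 0 < ε / 2 / (A * m + 1))
  refine ⟨A * m * κ, by positivity, fun a ha haβ j => ?_⟩
  set v : Ω → ℝ := linearProcess (fun k => if k < m then 0 else a k) ζ j with hv
  have ha2 : ∀ k, a k ^ 2 ≤ β k ^ 2 := fun k => sq_le_sq' (by linarith [neg_abs_le (a k), haβ k])
    ((le_abs_self _).trans (haβ k))
  have haT : ∀ k, a k ^ 2 ≤ T := fun k => (ha2 k).trans (hβ.le_tsum k fun _ _ => sq_nonneg _)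
  obtain ⟨hvmem, hvint⟩ : MemLp v 2 P ∧ ∫ ω, v ω ^ 2 ∂P ≤ ε / 4 := by
    refine hζ.memLp_linearProcess ?_ (fun n => ?_) j
    · refine Summable.of_nonneg_of_le (fun _ => abs_nonneg _) (fun k => ?_) ha
      split_ifs <;> simp
    · refine (Finset.sum_le_sum fun k _ => ?_).trans (hm n)
      split_ifs
      · simp
      · exact ha2 k
  have hexc : ∀ k : ℤ, Integrable (fun ω => max (ζ k ω ^ 2 - κ) 0) P := fun k =>
    ((hζ.memLp k).integrable_sq.sub (integrable_const κ)).pos_part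
  have hhead : Integrable
      (fun ω => A * ∑ k ∈ Finset.range m, max (ζ (j - k) ω ^ 2 - κ) 0) P :=
    (integrable_finsetSum (Finset.range m) fun k _ => hexc (j - k)).const_mul A
  have hdom : Integrable (fun ω => A * ∑ k ∈ Finset.range m, max (ζ (j - k) ω ^ 2 - κ) 0 +
      2 * v ω ^ 2) P :=
    hhead.add (hvmem.integrable_sq.const_mul 2)
  calc ∫ ω, max (linearProcess a ζ j ω ^ 2 - A * m * κ) 0 ∂P
      ≤ ∫ ω, (A * ∑ k ∈ Finset.range m, max (ζ (j - k) ω ^ 2 - κ) 0 + 2 * v ω ^ 2) ∂P := by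
        refine integral_mono_of_nonneg (Eventually.of_forall fun ω => le_max_right _ _) hdom ?_
        filter_upwards [hζ.ae_summable ha j] with ω hω
        refine max_le ?_ (add_nonneg (mul_nonneg hA0 (Finset.sum_nonneg fun _ _ =>
          le_max_right _ _)) (by positivity))
        rw [linearProcess_split hω m]
        have h1 : (∑ k ∈ Finset.range m, a k * ζ (j - k) ω) ^ 2 ≤
            m * ∑ k ∈ Finset.range m, T * ζ (j - k) ω ^ 2 := by
          have := sq_sum_le_card_mul_sum_sq (s := Finset.range m)
            (f := fun k : ℕ => a k * ζ (j - k) ω)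
          rw [Finset.card_range] at this
          refine this.trans (mul_le_mul_of_nonneg_left (Finset.sum_le_sum fun k _ => ?_)
            m.cast_nonneg)
          rw [mul_pow]
          exact mul_le_mul_of_nonneg_right (haT k) (sq_nonneg _)
        have h2 : A * ∑ k ∈ Finset.range m, (ζ (j - k) ω ^ 2 - κ) ≤
            A * ∑ k ∈ Finset.range m, max (ζ (j - k) ω ^ 2 - κ) 0 := by
          gcongr
          exact le_max_left _ _
        rw [Finset.sum_sub_distrib, Finset.sum_const, Finset.card_range, nsmul_eq_mul] at h2
        rw [← Finset.mul_sum] at h1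
        have h3 := add_sq_le (a := ∑ k ∈ Finset.range m, a k * ζ (j - k) ω) (b := v ω)
        have h4 : A * (∑ k ∈ Finset.range m, ζ (j - k) ω ^ 2 - m * κ) =
            2 * (m * (T * ∑ k ∈ Finset.range m, ζ (j - k) ω ^ 2)) - A * m * κ := by
          rw [hA]; ring
        linarith
    _ = A * ∑ k ∈ Finset.range m, ∫ ω, max (ζ (j - k) ω ^ 2 - κ) 0 ∂P + 2 * ∫ ω, v ω ^ 2 ∂P := by
        rw [integral_add hhead (hvmem.integrable_sq.const_mul 2), integral_const_mul,
          integral_const_mul, integral_finsetSum (Finset.range m) fun k _ => hexc (j - k)]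
    _ ≤ A * ∑ k ∈ Finset.range m, ε / 2 / (A * m + 1) + 2 * (ε / 4) := by
        gcongr
        exact hκ _
    _ = A * m / (A * m + 1) * (ε / 2) + ε / 2 := by
        rw [Finset.sum_const, Finset.card_range, nsmul_eq_mul]
        ring
    _ ≤ 1 * (ε / 2) + ε / 2 := by
        gcongr
        rw [div_le_one (by positivity)]
        linarith
    _ = ε := by ring

/-- An array of linear processes is regular noise at rate `r` when its coefficients are dominated
by a fixed square summable sequence and split into an `ℓ¹` and an `ℓ²` part of the right size. -/
lemma IsIIDInnovation.isRegularNoise [IsProbabilityMeasure P] (hζ : IsIIDInnovation P ζ)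
    {a a₁ a₂ : ℕ → ℕ → ℝ} (ha : ∀ N, Summable fun k => |a N k|) {β : ℕ → ℝ}
    (hβ : Summable fun k => β k ^ 2) (haβ : ∀ N k, |a N k| ≤ β k)
    (haa : ∀ N k, a N k = a₁ N k + a₂ N k) {r : ℕ → ℝ} {C : ℝ}
    (hC : ∀ᶠ N : ℕ in atTop, ∀ n, ∑ k ∈ Finset.range n, |a₁ N k| +
      √N * √(∑ k ∈ Finset.range n, a₂ N k ^ 2) ≤ C * (√N / r N))
    (hr : Tendsto r atTop atTop) (hr' : ∀ᶠ N : ℕ in atTop, r N ≤ √N) :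
    IsRegularNoise P (fun N ω => WithLp.toLp 2 fun t : Fin N =>
      linearProcess (a N) ζ (((t : ℕ) + 1 : ℕ) : ℤ) ω) r where
  memLp N t := by
    refine (hζ.memLp_linearProcess (ha N) (T := ∑' k, β k ^ 2) (fun n => ?_) _).1
    refine le_trans (Finset.sum_le_sum fun k _ => ?_)
      (hβ.sum_le_tsum (Finset.range n) fun _ _ => sq_nonneg _)
    exact sq_le_sq' (by linarith [neg_abs_le (a N k), haβ N k])
      ((le_abs_self _).trans (haβ N k))
  variance_le := by
    refine ⟨C ^ 2, sq_nonneg _, ?_⟩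
    filter_upwards [hC] with N hN g
    have hinj : Function.Injective fun t : Fin N => (((t : ℕ) + 1 : ℕ) : ℤ) := fun s t hst => by
      exact Fin.ext (by simpa using hst)
    have h := (hζ.linearProcess_bound (ha N) g hinj (a₁ N) (a₂ N) (haa N) hN).2
    have h1 : (C * (√N / r N) * ‖g‖) ^ 2 = C ^ 2 * (N / r N ^ 2) * ‖g‖ ^ 2 := by
      rw [mul_pow, mul_pow, div_pow, Real.sq_sqrt N.cast_nonneg]
    rw [h1] at h
    refine le_trans (le_of_eq ?_) h
    congr 1 with ω
    congr 1
    simp [PiLp.inner_apply, mul_comm]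
  unifIntegrable ε hε := by
    obtain ⟨κ, hκ0, hκ⟩ := hζ.exists_integral_linearProcess_excess_le hβ hε
    exact ⟨κ, hκ0, fun N t => hκ (a N) (ha N) (haβ N) _⟩
  tendsto_rate := hr
  rate_le := hr'

end Regularity

lemma summable_rpow_sq {d : ℝ} (hd2 : d < 1 / 2) (C : ℝ) :
    Summable fun k : ℕ => (C * ((k : ℝ) + 1) ^ (d - 1)) ^ 2 := by
  have h : Summable fun k : ℕ => ((k + 1 : ℕ) : ℝ) ^ (2 * (d - 1)) :=
    (summable_nat_add_iff 1).2 (Real.summable_nat_rpow.2 (by linarith))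
  refine (h.mul_left (C ^ 2)).congr fun k => ?_
  have hk : (0 : ℝ) ≤ k + 1 := by positivity
  rw [mul_pow, ← Real.rpow_natCast (((k : ℝ) + 1) ^ (d - 1)) 2, ← Real.rpow_mul hk]
  push_cast
  rw [mul_comm 2 (d - 1)]

lemma abs_tempered_le {d : ℝ} {b : ℕ → ℝ} {C : ℝ} 
    (hb : ∀ k, |b k| ≤ C * ((k : ℝ) + 1) ^ (d - 1)) {l : ℝ} (hl : 0 < l) (k : ℕ) :
    |Real.exp (-l * k) * b k| ≤ C * ((k : ℝ) + 1) ^ (d - 1) := by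
  rw [abs_mul, Real.abs_exp]
  have h1 : Real.exp (-l * k) ≤ 1 := Real.exp_le_one_iff.2 (by
    have : 0 ≤ l * k := by positivity
    linarith)
  exact (mul_le_of_le_one_left (abs_nonneg _) h1).trans (hb k)

lemma summable_tempered {d : ℝ} {b : ℕ → ℝ} (hd1 : d < 1) {C : ℝ} (hC : 0 < C)
    (hb : ∀ k, |b k| ≤ C * ((k : ℝ) + 1) ^ (d - 1)) {l : ℝ} (hl : 0 < l) :
    Summable fun k : ℕ => |Real.exp (-l * k) * b k| := by
  refine summable_exp_mul (B := C) (fun k => (hb k).trans ?_) hl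
  refine mul_le_of_le_one_right hC.le (Real.rpow_le_one_of_one_le_of_nonpos ?_ (by linarith))
  linarith [k.cast_nonneg (α := ℝ)]

/-- The growth conditions of strong tempering force `d < 1/2`. -/
lemma lt_half_of_isLittleO {d : ℝ} {lam : ℕ → ℝ} (hd1 : d < 1)
    (hN : Tendsto (fun N : ℕ => (N : ℝ) * lam N) atTop atTop)
    (ho : lam =o[atTop] (fun N : ℕ => (N : ℝ) ^ (-1 / (2 - 2 * d)))) : d < 1 / 2 := by
  -- Otherwise the exponent `-1 / (2 - 2 d)` is at most `-1`, and `N λ_N` would be bounded.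
  by_contra! hd2
  have h1 := ho.bound one_pos
  obtain ⟨N, hN1, hN2, hN3⟩ :=
    (h1.and ((hN.eventually_gt_atTop 1).and (eventually_ge_atTop 1))).exists
  have hN4 : (1 : ℝ) ≤ N := by exact_mod_cast hN3
  have hN0 : (0 : ℝ) < N := by linarith
  have h2 : (N : ℝ) ^ (-1 / (2 - 2 * d)) ≤ (N : ℝ) ^ (-1 : ℝ) := by
    refine Real.rpow_le_rpow_of_exponent_le hN4 ?_
    rw [div_le_iff₀ (by linarith)]
    linarith
  rw [Real.norm_of_nonneg (by positivity : 0 ≤ (N : ℝ) ^ (-1 / (2 - 2 * d))), one_mul,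
    Real.norm_eq_abs] at hN1
  have h3 : lam N ≤ (N : ℝ)⁻¹ := by
    rw [← Real.rpow_neg_one]
    exact (le_abs_self _).trans (hN1.trans h2)
  have h4 : (N : ℝ) * lam N ≤ N * (N : ℝ)⁻¹ := by gcongr
  rw [mul_inv_cancel₀ hN0.ne'] at h4
  linarith

/-! ### Tempered errors and asymptotic linearity -/

section Linearization

variable {Ω : Type*} [MeasurableSpace Ω] {P : Measure Ω} [IsProbabilityMeasure P]
  {ζ : ℤ → Ω → ℝ} {d : ℝ} {b : ℕ → ℝ} {lam : ℕ → ℝ}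

/-- Strongly tempered errors are regular noise: the whole filter is summed in `ℓ¹`. -/
lemma isRegularNoise_of_strong_tempering (hζ : IsIIDInnovation P ζ) (hd : 0 < d)
    (hd2 : d < 1 / 2) (hb : IsTemperedCoeff d b) (hlam : ∀ N, 0 < lam N)
    (hlam0 : Tendsto lam atTop (𝓝 0))
    (hN : Tendsto (fun N : ℕ => (N : ℝ) * lam N) atTop atTop) :
    IsRegularNoise P (fun N ω => WithLp.toLp 2 (errorVec b ζ (lam N) N ω))
      (fun N => lam N ^ d * √N) := by
  obtain ⟨C, hC, hbC⟩ := hb.exists_bound (by linarith)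
  have hlam1 : ∀ᶠ N in atTop, lam N ≤ 1 := hlam0.eventually_le_const one_pos
  refine hζ.isRegularNoise (a := fun N k => Real.exp (-lam N * k) * b k)
    (a₁ := fun N k => Real.exp (-lam N * k) * b k) (a₂ := fun _ _ => 0)
    (C := C * (2 ^ d / d + 2)) (fun N => summable_tempered (by linarith) hC hbC (hlam N))
    (summable_rpow_sq hd2 C) (fun N k => abs_tempered_le hbC (hlam N) k)
    (fun N k => (add_zero _).symm) ?_ ?_ ?_
  · filter_upwards [hlam1, eventually_ge_atTop 1] with N hN1 hN2 n
    have hsq : (0 : ℝ) < √N := Real.sqrt_pos.2 (by exact_mod_cast hN2)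
    have h1 : √N / (lam N ^ d * √N) = lam N ^ (-d) := by
      rw [Real.rpow_neg (hlam N).le, mul_comm, div_mul_eq_div_div, div_self hsq.ne', one_div]
    rw [h1]
    simp only [ne_eq, OfNat.ofNat_ne_zero, not_false_eq_true, zero_pow, Finset.sum_const_zero,
      Real.sqrt_zero, mul_zero, add_zero]
    calc _ ≤ ∑ k ∈ Finset.range n, C * (Real.exp (-lam N * k) * ((k : ℝ) + 1) ^ (d - 1)) := by
          refine Finset.sum_le_sum fun k _ => ?_
          rw [abs_mul, Real.abs_exp, mul_left_comm]
          gcongr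
          exact hbC k
      _ = C * ∑ k ∈ Finset.range n, Real.exp (-lam N * k) * ((k : ℝ) + 1) ^ (d - 1) :=
          (Finset.mul_sum _ _ _).symm
      _ ≤ C * ((2 ^ d / d + 2) * lam N ^ (-d)) := by
          gcongr
          exact sum_exp_mul_rpow_le hd (by linarith) (hlam N) hN1 n
      _ = _ := by ring
  · have h1 : Tendsto (fun N : ℕ => ((N : ℝ) * lam N) ^ d) atTop atTop :=
      (tendsto_rpow_atTop hd).comp hN
    refine tendsto_atTop_mono' _ ?_ h1
    filter_upwards [eventually_ge_atTop 1] with N hN2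
    have hN2' : (1 : ℝ) ≤ N := by exact_mod_cast hN2
    rw [Real.mul_rpow N.cast_nonneg (hlam N).le, mul_comm, Real.sqrt_eq_rpow]
    have : 0 ≤ lam N ^ d := Real.rpow_nonneg (hlam N).le d
    gcongr
  · filter_upwards [hlam1] with N hN1
    exact mul_le_of_le_one_left (Real.sqrt_nonneg _) (Real.rpow_le_one (hlam N).le hN1 hd.le)

/-- For `d < 1/2` the errors are regular noise at rate `N ^ (1 / 2 - d)`, whatever the tempering: the first `N` coefficients of the filter are summed in `ℓ¹`, the others in `ℓ²`. -/
lemma isRegularNoise_of_long_memory (hζ : IsIIDInnovation P ζ) (hd : 0 < d)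
    (hd2 : d < 1 / 2) (hb : IsTemperedCoeff d b) (hlam : ∀ N, 0 < lam N) :
    IsRegularNoise P (fun N ω => WithLp.toLp 2 (errorVec b ζ (lam N) N ω))
      (fun N : ℕ => (N : ℝ) ^ (1 / 2 - d)) := by
  obtain ⟨C, hC, hbC⟩ := hb.exists_bound (by linarith)
  have hs : 0 < 1 - 2 * d := by linarith
  refine hζ.isRegularNoise (a := fun N k => Real.exp (-lam N * k) * b k)
    (a₁ := fun N k => if k < N then Real.exp (-lam N * k) * b k else 0)
    (a₂ := fun N k => if k < N then 0 else Real.exp (-lam N * k) * b k)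
    (C := C / d + C / √(1 - 2 * d)) (fun N => summable_tempered (by linarith) hC hbC (hlam N))
    (summable_rpow_sq hd2 C) (fun N k => abs_tempered_le hbC (hlam N) k)
    (fun N k => by split_ifs <;> simp) ?_ ?_ ?_
  · filter_upwards [eventually_ge_atTop 1] with N hN n
    have hN0 : (0 : ℝ) < N := by exact_mod_cast hN
    have hrate : √N / (N : ℝ) ^ (1 / 2 - d) = (N : ℝ) ^ d := by
      rw [Real.sqrt_eq_rpow, ← Real.rpow_sub hN0]
      congr 1; ring
    have h1 : ∑ k ∈ Finset.range n, |if k < N then Real.exp (-lam N * k) * b k else 0| ≤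
        C / d * (N : ℝ) ^ d := by
      calc _ ≤ ∑ k ∈ Finset.range n, (if k < N then C * ((k : ℝ) + 1) ^ (d - 1) else 0) := by
            refine Finset.sum_le_sum fun k _ => ?_
            split_ifs
            · exact abs_tempered_le hbC (hlam N) k
            · simp
        _ = ∑ k ∈ (Finset.range n).filter (· < N), C * ((k : ℝ) + 1) ^ (d - 1) :=
            (Finset.sum_filter _ _).symm
        _ ≤ ∑ k ∈ Finset.range N, C * ((k : ℝ) + 1) ^ (d - 1) :=
            Finset.sum_le_sum_of_subset_of_nonneg (fun k hk => by simp_all)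
              fun _ _ _ => by positivity
        _ = C * ∑ k ∈ Finset.range N, ((k : ℝ) + 1) ^ (d - 1) := (Finset.mul_sum _ _ _).symm
        _ ≤ C * ((N : ℝ) ^ d / d) := by
            gcongr
            exact sum_rpow_sub_one_le hd (by linarith) N
        _ = _ := by ring
    have h2 : ∑ k ∈ Finset.range n, (if k < N then 0 else Real.exp (-lam N * k) * b k) ^ 2 ≤
        C ^ 2 * ((N : ℝ) ^ (-(1 - 2 * d)) / (1 - 2 * d)) := by
      calc _ ≤ ∑ k ∈ Finset.range n,
            C ^ 2 * (if k < N then 0 else ((k : ℝ) + 1) ^ (-(1 - 2 * d) - 1)) := by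
            refine Finset.sum_le_sum fun k _ => ?_
            split_ifs
            · simp
            · have hk : (0 : ℝ) < k + 1 := by positivity
              have h3 : ((k : ℝ) + 1) ^ (-(1 - 2 * d) - 1) = (((k : ℝ) + 1) ^ (d - 1)) ^ 2 := by
                rw [← Real.rpow_natCast, ← Real.rpow_mul hk.le]
                congr 1; push_cast; ring
              rw [h3, ← mul_pow, ← sq_abs]
              gcongr
              exact abs_tempered_le hbC (hlam N) k
        _ = C ^ 2 * ∑ k ∈ Finset.range n,
            (if k < N then 0 else ((k : ℝ) + 1) ^ (-(1 - 2 * d) - 1)) :=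
            (Finset.mul_sum _ _ _).symm
        _ ≤ _ := by
            gcongr
            exact sum_tail_rpow_le hs hN n
    have h4 : √N * √(C ^ 2 * ((N : ℝ) ^ (-(1 - 2 * d)) / (1 - 2 * d))) =
        C / √(1 - 2 * d) * (N : ℝ) ^ d := by
      have h5 : (N : ℝ) * (C ^ 2 * ((N : ℝ) ^ (-(1 - 2 * d)) / (1 - 2 * d))) =
          (C * (N : ℝ) ^ d) ^ 2 / (1 - 2 * d) := by
        have h6 : (N : ℝ) * (N : ℝ) ^ (-(1 - 2 * d)) = ((N : ℝ) ^ d) ^ 2 := by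
          rw [← Real.rpow_natCast ((N : ℝ) ^ d), ← Real.rpow_mul hN0.le]
          conv_lhs => rw [← Real.rpow_one_add' hN0.le (by linarith)]
          congr 1; push_cast; ring
        rw [mul_pow, ← h6]
        ring
      rw [← Real.sqrt_mul hN0.le, h5, Real.sqrt_div (sq_nonneg _), Real.sqrt_sq (by positivity)]
      ring
    rw [hrate]
    calc _ ≤ C / d * (N : ℝ) ^ d + √N * √(C ^ 2 * ((N : ℝ) ^ (-(1 - 2 * d)) / (1 - 2 * d))) := by
          gcongr
      _ = _ := by rw [h4]; ring
  · exact (tendsto_rpow_atTop (by linarith)).comp tendsto_natCast_atTop_atTop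
  · filter_upwards [eventually_ge_atTop 1] with N hN
    rw [Real.sqrt_eq_rpow]
    exact Real.rpow_le_rpow_of_exponent_le (by exact_mod_cast hN) (by linarith)

/-- Least squares estimators in the presence of regular noise are asymptotically linear. -/
theorem IsRegularNoise.tendsto_linearization {e : ∀ N : ℕ, Ω → EuclideanSpace ℝ (Fin N)}
    {r : ℕ → ℝ} (he : IsRegularNoise P e r) {p q : ℕ} (hq : 1 ≤ q) (hqp : q < p) {θ : Param p}
    (hθ : θ ∈ paramSpace p) (hkink : coeffs θ ⟨q, hqp⟩ ≠ 0) {Y : ∀ N : ℕ, Ω → Fin N → ℝ}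
    (hY : ∀ N ω t, Y N ω t = splineMean q θ (designPoint N t) + e N ω t)
    {θhat : ℕ → Ω → Param p}
    (hθhat : ∀ N, ∀ᵐ ω ∂P, (∃ τ : Param p, IsLeastSquares q (Y N ω) τ) →
      IsLeastSquares q (Y N ω) (θhat N ω)) {Δ : ℝ} (hΔ : 0 < Δ) :
    Tendsto (fun N => P {ω | Δ < r N * ‖θhat N ω - θ - linearTerm q θ (e N ω)‖})
      atTop (𝓝 0) := by
  rw [ENNReal.tendsto_nhds_zero]
  intro ξ hξ
  -- Each of the three noise bounds fails with probability at most `ξ / 3`.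
  have hξ3 : 0 < ξ / 3 := ENNReal.div_pos hξ.ne' (by simp)
  obtain ⟨ξ', hξ'0, hξ'⟩ := ENNReal.lt_iff_exists_real_btwn.1 hξ3
  obtain ⟨K, hK, h1⟩ := he.oneKnotBound p (knot θ) (ENNReal.ofReal_pos.1 hξ'.1)
  obtain ⟨ε, hε, r₀, hr₀, N₀, hcore⟩ := leastSquares_linearization hq hqp hθ hkink hK hΔ
  have h2 := (he.windowBound p hθ hε).eventually_le_const hξ3
  have h3 := (he.twoKnotBound p (knot θ) hε).eventually_le_const hξ3
  filter_upwards [h1, h2, h3, eventually_ge_atTop N₀, he.tendsto_rate.eventually_ge_atTop r₀,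
    he.rate_le] with N h1 h2 h3 hN hr hr'
  have hsub : {ω | Δ < r N * ‖θhat N ω - θ - linearTerm q θ (e N ω)‖} ⊆
      (({ω | ¬ OneKnotBound p (knot θ) (e N ω) (K * (√N / r N))} ∪
        {ω | ¬ WindowBound p (knot θ) (e N ω) ε (N / r N)}) ∪
        {ω | ¬ TwoKnotBound p (knot θ) (e N ω) (ε * √N)}) ∪
      {ω | ¬ ((∃ τ : Param p, IsLeastSquares q (Y N ω) τ) →
        IsLeastSquares q (Y N ω) (θhat N ω))} := by
    intro ω hω
    by_contra hcon
    simp only [Set.mem_union, Set.mem_ofPred_eq, not_or, not_not] at hcon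
    obtain ⟨⟨⟨c1, c2⟩, c3⟩, c4⟩ := hcon
    obtain ⟨hex, hle⟩ := hcore N hN (r N) hr hr' (e N ω) c1 c2 c3 (Y N ω) (hY N ω)
    exact absurd (hle _ (c4 hex)) (not_le.2 hω)
  calc _ ≤ _ := measure_mono hsub
    _ ≤ ξ / 3 + ξ / 3 + ξ / 3 + 0 := by
        refine (measure_union_le _ _).trans (add_le_add ((measure_union_le _ _).trans
          (add_le_add ((measure_union_le _ _).trans (add_le_add ?_ h2)) h3)) ?_)
        · exact h1.trans hξ'.2.le
        · exact (ae_iff.1 (hθhat N)).le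
    _ = ξ := by rw [add_zero, ENNReal.add_thirds]

end Linearization

end SplineRegression

theorem theorem4p1 {Ω : Type*} [MeasurableSpace Ω] (P : Measure Ω) [IsProbabilityMeasure P]
    (ζ : ℤ → Ω → ℝ) (hζ : IsIIDInnovation P ζ)
    (d : ℝ) (hd : 0 < d) (b : ℕ → ℝ) (hb : IsTemperedCoeff d b)
    (lam : ℕ → ℝ) (hlam_pos : ∀ N, 0 < lam N) (hlam_zero : Tendsto lam atTop (𝓝 0))
    (p q : ℕ) (hq : 1 ≤ q) (hqp : q < p)
    -- the true parameter, with nonzero coefficient of `(s - η)₊`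
    (θ : Param p) (hθ : θ ∈ paramSpace p) (hkink : θ (Fin.castSucc ⟨q, hqp⟩) ≠ 0)
    -- a least squares estimator: a minimizer whenever the criterion has one
    (θhat : ℕ → Ω → Param p)
    (hθhat : ∀ N, ∀ᵐ ω ∂P,
      (∃ τ : Param p, IsLeastSquares q (observation q θ b ζ (lam N) N ω) τ) →
        IsLeastSquares q (observation q θ b ζ (lam N) N ω) (θhat N ω)) :
    (d < 1 →
      Tendsto (fun N : ℕ => (N : ℝ) * lam N) atTop atTop →
      lam =o[atTop] (fun N : ℕ => (N : ℝ) ^ (-1 / (2 - 2 * d))) →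
      ∀ Δ : ℝ, 0 < Δ →
        Tendsto (fun N : ℕ => P {ω | Δ < lam N ^ d * Real.sqrt N *
            ‖θhat N ω - θ - linearTerm q θ (errorVec b ζ (lam N) N ω)‖})
          atTop (𝓝 0)) ∧
    (d < 1 / 2 →
      ∀ lamStar : ℝ, 0 ≤ lamStar →
      Tendsto (fun N : ℕ => (N : ℝ) * lam N) atTop (𝓝 lamStar) →
      ∀ Δ : ℝ, 0 < Δ →
        Tendsto (fun N : ℕ => P {ω | Δ < (N : ℝ) ^ (1 / 2 - d) *
            ‖θhat N ω - θ - linearTerm q θ (errorVec b ζ (lam N) N ω)‖})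
          atTop (𝓝 0)) := by
  constructor
  · intro hd1 hN ho Δ hΔ
    exact (isRegularNoise_of_strong_tempering hζ hd (lt_half_of_isLittleO hd1 hN ho) hb hlam_pos
      hlam_zero hN).tendsto_linearization hq hqp hθ hkink (fun _ _ _ => rfl) hθhat hΔ
  · intro hd2 _ _ _ Δ hΔ
    exact (isRegularNoise_of_long_memory hζ hd hd2 hb hlam_pos).tendsto_linearization hq hqp hθ
      hkink (fun _ _ _ => rfl) hθhat hΔ
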